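/- **Setting.** Let $\Omega\subset\mathbb R^2$ be a polygonal domain (bounded, open, connected, with boundary a finite union of segments). Let $\mathcal T_h$ be a finite tessellation of $\Omega$ into simple nonoverlapping polygons $E\subset\Omega$ (as open sets), so that $\overline\Omega=\bigcup_{E}\overline E$; vertices with a straight angle (hanging nodes) are allowed. Assume that there is $\rho>0$ such that, with $h_E=\operatorname{diam}E$, every $E$ is star-shaped with respect to a ball of radius $\rho h_E$ contained in $E$, and every edge $e\subset\partial E$ has length at least $\rho h_E$. Let $\ell\ge1$. $\mathbb P_k(D)$ denotes the polynomials on $D$ of total degree at most $k$, with $\mathbb P_k=\{0\}$ for $k<0$. *Nonlinearity.* Let $\mu\in C^0(\overline\Omega\times[0,\infty))$ and let $m_\mu,M_\mu>0$ be constants with $$m_\mu(t-s)\le\mu(x,t)t-\mu(x,s)s\le M_\mu(t-s)\qquad\text{for all } t\ge s\ge0,\ x\in\overline\Omega .$$ *Local spaces and projections.* For each $E\in\mathcal T_h$ let $$\widetilde V^E=\{v\in H^1(E): \Delta v\in\mathbb P_\ell(E),\ v|_e\in\mathbb P_\ell(e)\ \text{for every edge } e\subset\partial E\},$$ where $v|_{\partial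 E}$ is the trace, which is continuous on $\partial E$. Let $\Lambda^E$ be the following finite set of linear functionals (degrees of freedom) of $v\in\widetilde V^E$: the values of $v$ at the vertices of $E$; the moments $\frac1{|e|}\int_e v\,p\,ds$ for each edge $e\subset\partial E$ and each $p$ in a fixed basis of $\mathbb P_{\ell-2}(e)$; and the moments $\frac1{|E|}\int_E v\,p\,dx$ for $p$ in a fixed basis of $\mathbb P_{\ell-2}(E)$. The bases are arbitrary. Let $\Pi_0^E:\widetilde V^E\to\mathbb P_\ell(E)$ and $\Pi_0^e:\widetilde V^E\to\mathbb P_\ell(e)$ ($e\subset\partial E$) be any linear maps whose values are linear combinations (with fixed polynomial coefficients) of the degrees of freedom $\lambda(v)$, $\lambda\in\Lambda^E$, such that for all $v\in\widetilde V^E$: - $\int_E\Pi_0^Ev\,p\,dx=\int_Ev\,p\,dx$ for all $p\in\mathbb P_{\ell-2}(E)$, and $\Pi_0^Eq=q$ for all $q\in\mathbb P_\ell(E)$; - $\Pi_0^ev=v$ at both endpoints of $e$, $\int_e\Pi_0^ev\,p\,ds=\int_ev\,p\,ds$ for all $p\in\mathbb P_{\ell-2}(e)$, and $\Pi_0^eq=q|_e$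 for all $q\in\mathbb P_\ell(E)$. Define $\Pi_1^E:\widetilde V^E\to[\mathbb P_{\ell-1}(E)]^2$ by $$\int_E\Pi_1^Ev\cdot p\,dx=-\int_E\Pi_0^Ev\,\nabla\!\cdot p\,dx+\sum_{e\subset\partial E}\int_e\Pi_0^ev\;p\cdot n\,ds\qquad\forall p\in[\mathbb P_{\ell-1}(E)]^2,$$ with $n$ the unit outward normal. The local and global virtual element spaces are $$V^E_{h,\ell}=\{v\in\widetilde V^E:\ (v-\Pi_0^Ev,p)_E=0\ \ \forall p\in\mathbb P_\ell(E)\setminus\mathbb P_{\ell-2}(E)\},\qquad V_{h,\ell}=\{v\in H^1_0(\Omega):\ v|_E\in V^E_{h,\ell}\ \ \forall E\in\mathcal T_h\}.$$ *Discrete problem.* For $z,v,w\in V_{h,\ell}$ put $$a_h(z;v,w)=\sum_{E\in\mathcal T_h}\Big[\int_E\mu(x,|\Pi_1^Ez|)\,\Pi_1^Ev\cdot\Pi_1^Ew\,dx+M_\mu m_\mu\sum_{\lambda\in\Lambda^E}\lambda\big((I-\Pi_0^E)v\big)\,\lambda\big((I-\Pi_0^E)w\big)\Big].$$ For $f\in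 L^2(\Omega)$ put $(f_h,v)=\sum_{E\in\mathcal T_h}\int_E(\mathcal P_\ell^Ef)\,v\,dx$, where $\mathcal P^E_\ell$ is the $L^2(E)$-orthogonal projection onto $\mathbb P_\ell(E)$. **Theorem (existence and uniqueness of a discrete solution).** For every $f\in L^2(\Omega)$ there is exactly one $u_h\in V_{h,\ell}$ such that $$a_h(u_h;u_h,v_h)=(f_h,v_h)\qquad\text{for all } v_h\in V_{h,\ell}.$$ -/

import Mathlib

open MeasureTheory Set Filter Topology
open scoped ContDiff

namespace QuasiVEM

noncomputable section

/-! ### The plane, polygons and meshes -/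

/-- The Euclidean plane `ℝ²`. -/
abbrev Plane : Type := EuclideanSpace ℝ (Fin 2)

/-- Rotation of a planar vector by a quarter turn counterclockwise. -/
def rotLeft (t : Plane) : Plane := !₂[-t 1, t 0]

/-- A simple polygon: a bounded open set `carrier` whose boundary is a simple closed polygonal chain
with vertices `vertex 0, vertex 1, …, vertex (m + 2)` (indices are cyclic), listed counterclockwise,
that is, with the interior on the left of every edge. Straight angles at vertices are allowed, so
that hanging nodes can be vertices. -/
structure Polygon where
  carrier : Set Plane
  m : ℕ
  vertex : Fin (m + 3) → Plane
  isOpen_carrier : IsOpen carrier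
  isBounded_carrier : Bornology.IsBounded carrier
  vertex_injective : Function.Injective vertex
  simple : ∀ i j, i ≠ j →
    Disjoint (openSegment ℝ (vertex i) (vertex (i + 1))) (segment ℝ (vertex j) (vertex (j + 1)))
  frontier_eq : frontier carrier = ⋃ i, segment ℝ (vertex i) (vertex (i + 1))
  interior_left : ∀ i, ∀ x ∈ openSegment ℝ (vertex i) (vertex (i + 1)),
    ∀ᶠ s : ℝ in 𝓝[>] 0,
      x + s • rotLeft (vertex (i + 1) - vertex i) ∈ carrier ∧
      x - s • rotLeft (vertex (i + 1) - vertex i) ∉ closure carrier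

/-- The type of edges (equivalently, of vertices) of a polygon. Edge `i` joins `vertex i` to
`vertex (i + 1)`. -/
abbrev Polygon.Edge (P : Polygon) : Type := Fin (P.m + 3)

/-- Affine parametrisation of edge `i` by `[0, 1]`. -/
def Polygon.edgePt (P : Polygon) (i : P.Edge) (t : ℝ) : Plane :=
  P.vertex i + t • (P.vertex (i + 1) - P.vertex i)

/-- Length of edge `i`. -/
def Polygon.edgeLength (P : Polygon) (i : P.Edge) : ℝ := dist (P.vertex i) (P.vertex (i + 1))

/-- Unit outward normal on edge `i`. -/
def Polygon.normal (P : Polygon) (i : P.Edge) : Plane :=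
  -((P.edgeLength i)⁻¹ • rotLeft (P.vertex (i + 1) - P.vertex i))

/-- The integral `∫_e g ds` over edge `i` of a function `g` of the parameter `t ∈ [0, 1]`. -/
def Polygon.edgeIntegral (P : Polygon) (i : P.Edge) (g : ℝ → ℝ) : ℝ :=
  P.edgeLength i * ∫ t in (0 : ℝ)..1, g t

/-- A polygonal domain: a bounded, open, connected set whose boundary is a finite union of
segments. -/
structure IsPolygonalDomain (Ω : Set Plane) : Prop where
  isOpen : IsOpen Ω
  isConnected : IsConnected Ω
  isBounded : Bornology.IsBounded Ω
  frontier_eq : ∃ S : Finset (Plane × Plane), frontier Ω = ⋃ s ∈ S, segment ℝ s.1 s.2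

/-- A finite tessellation of `Ω` into simple nonoverlapping polygons. -/
structure Mesh (Ω : Set Plane) where
  numElements : ℕ
  elt : Fin numElements → Polygon
  elt_subset : ∀ K, (elt K).carrier ⊆ Ω
  closure_eq : closure Ω = ⋃ K, closure (elt K).carrier
  nonoverlapping : Pairwise fun K L => Disjoint (elt K).carrier (elt L).carrier

/-- Mesh regularity with constant `ρ`: each element is star-shaped with respect to a ball of radius
`ρ * diam E`, and each of its edges has length at least `ρ * diam E`. -/
structure Mesh.IsRegular {Ω : Set Plane} (T : Mesh Ω) (ρ : ℝ) : Prop where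
  starShaped : ∀ K, ∃ x₀ : Plane,
    Metric.ball x₀ (ρ * Metric.diam (T.elt K).carrier) ⊆ (T.elt K).carrier ∧
    ∀ y ∈ Metric.ball x₀ (ρ * Metric.diam (T.elt K).carrier), StarConvex ℝ y (T.elt K).carrier
  edge_length : ∀ K i, ρ * Metric.diam (T.elt K).carrier ≤ (T.elt K).edgeLength i

/-! ### Sobolev spaces -/

/-- The space `L²(D)`. -/
abbrev L2 (D : Set Plane) : Type := Lp ℝ 2 (volume.restrict D)

/-- The `j`-th partial derivative. -/
def partialD (j : Fin 2) (φ : Plane → ℝ) (x : Plane) : ℝ :=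
  fderiv ℝ φ x (EuclideanSpace.single j 1)

/-- Test functions: the space `C_c^∞(D)`. -/
structure IsTest (D : Set Plane) (φ : Plane → ℝ) : Prop where
  contDiff : ContDiff ℝ ∞ φ
  compact : HasCompactSupport φ
  tsupport_subset : tsupport φ ⊆ D

/-- `g = ∇v` weakly in `D`, with `v, g₀, g₁ ∈ L²(D)`. -/
def HasWeakGradient (D : Set Plane) (v : L2 D) (g : Fin 2 → L2 D) : Prop :=
  ∀ j, ∀ φ, IsTest D φ → ∫ x in D, v x * partialD j φ x = -∫ x in D, g j x * φ x

/-- `Δv = q` weakly (in the sense of distributions) in `D`. -/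
def HasWeakLaplacian (D : Set Plane) (v : L2 D) (q : Plane → ℝ) : Prop :=
  ∀ φ, IsTest D φ → ∫ x in D, v x * ∑ j, partialD j (partialD j φ) x = ∫ x in D, q x * φ x

/-- `φ k → v` in `L²(D)` and `∇(φ k) → g` in `L²(D)`. -/
def TendstoH1 (D : Set Plane) (φ : ℕ → Plane → ℝ) (v : L2 D) (g : Fin 2 → L2 D) : Prop :=
  Tendsto (fun k => eLpNorm (fun x => φ k x - v x) 2 (volume.restrict D)) atTop (𝓝 0) ∧
  ∀ j, Tendsto (fun k => eLpNorm (fun x => partialD j (φ k) x - g j x) 2 (volume.restrict D))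
    atTop (𝓝 0)

/-- `v ∈ H¹(P)` has on each edge `i` the trace `γ i`, as a function of the parameter `t ∈ [0, 1]`:
some sequence of functions smooth up to the boundary converges to `v` in `H¹(P)` while their boundary
values converge to `γ` in `L²` of the boundary. -/
def HasTrace (P : Polygon) (v : L2 P.carrier) (γ : P.Edge → ℝ → ℝ) : Prop :=
  ∃ (g : Fin 2 → L2 P.carrier) (φ : ℕ → Plane → ℝ),
    HasWeakGradient P.carrier v g ∧ (∀ k, ContDiff ℝ ∞ (φ k)) ∧ TendstoH1 P.carrier φ v g ∧
    ∀ i, Tendsto (fun k => eLpNorm (fun t => φ k (P.edgePt i t) - γ i t) 2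
      (volume.restrict (Icc (0 : ℝ) 1))) atTop (𝓝 0)

/-! ### Polynomials -/

/-- Bivariate polynomials of total degree at most `k`; this is `{0}` for `k < 0`. -/
abbrev Poly2 (k : ℤ) : Submodule ℝ (MvPolynomial (Fin 2) ℝ) :=
  MvPolynomial.restrictSupport ℝ {s | ((Finsupp.degree s : ℕ) : ℤ) ≤ k}

/-- Univariate polynomials of degree at most `k`; this is `{0}` for `k < 0`. They stand for the
polynomials on an edge, through the affine parametrisation by `[0, 1]`. -/
abbrev Poly1 (k : ℤ) : Submodule ℝ (Polynomial ℝ) := Polynomial.degreeLT ℝ (k + 1).toNat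

/-- The polynomial function on the plane. -/
def evalP (p : MvPolynomial (Fin 2) ℝ) (x : Plane) : ℝ := MvPolynomial.eval x.ofLp p

/-- Restriction of a bivariate polynomial to edge `i`, as a polynomial in the parameter. -/
def Polygon.restrictEdge (P : Polygon) (i : P.Edge) (p : MvPolynomial (Fin 2) ℝ) : Polynomial ℝ :=
  MvPolynomial.aeval (fun j => Polynomial.C (P.vertex i j) +
    Polynomial.C (P.vertex (i + 1) j - P.vertex i j) * Polynomial.X) p

/-! ### Auxiliary facts used to see that the spaces below are linear spaces -/

lemma tendsto_eLpNorm_add {X : Type*} [MeasurableSpace X] {ν : Measure X} {a b : ℕ → X → ℝ}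
    {a' b' c' : X → ℝ} (ha : ∀ k, AEStronglyMeasurable (a k) ν) (hb : ∀ k, AEStronglyMeasurable (b k) ν)
    (ha' : AEStronglyMeasurable a' ν) (hb' : AEStronglyMeasurable b' ν)
    (hc : c' =ᵐ[ν] fun x => a' x + b' x)
    (h1 : Tendsto (fun k => eLpNorm (fun x => a k x - a' x) 2 ν) atTop (𝓝 0))
    (h2 : Tendsto (fun k => eLpNorm (fun x => b k x - b' x) 2 ν) atTop (𝓝 0)) :
    Tendsto (fun k => eLpNorm (fun x => (a k x + b k x) - c' x) 2 ν) atTop (𝓝 0) := by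
  have h3 := h1.add h2
  rw [add_zero] at h3
  refine tendsto_of_tendsto_of_tendsto_of_le_of_le tendsto_const_nhds h3 (fun _ => zero_le) ?_
  intro k
  have e : eLpNorm (fun x => (a k x + b k x) - c' x) 2 ν
      = eLpNorm ((fun x => a k x - a' x) + fun x => b k x - b' x) 2 ν := by
    apply eLpNorm_congr_ae
    filter_upwards [hc] with x hx
    simp only [Pi.add_apply, hx]; ring
  simp only [e]
  exact eLpNorm_add_le ((ha k).sub ha') ((hb k).sub hb') (by norm_num)

lemma tendsto_eLpNorm_smul {X : Type*} [MeasurableSpace X] {ν : Measure X} {a : ℕ → X → ℝ}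
    {a' c' : X → ℝ} (r : ℝ) (hc : c' =ᵐ[ν] fun x => r * a' x)
    (h1 : Tendsto (fun k => eLpNorm (fun x => a k x - a' x) 2 ν) atTop (𝓝 0)) :
    Tendsto (fun k => eLpNorm (fun x => r * a k x - c' x) 2 ν) atTop (𝓝 0) := by
  have h3 := ENNReal.Tendsto.const_mul (a := ‖r‖ₑ) h1 (Or.inr (by simp))
  rw [mul_zero] at h3
  refine h3.congr fun k => ?_
  rw [← eLpNorm_const_smul]
  apply eLpNorm_congr_ae
  filter_upwards [hc] with x hx
  simp only [Pi.smul_apply, smul_eq_mul, hx]; ring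

lemma coeFn_add' {D : Set Plane} (v w : L2 D) :
    (fun x => (v + w : L2 D) x) =ᵐ[volume.restrict D] fun x => v x + w x := Lp.coeFn_add v w

lemma coeFn_smul' {D : Set Plane} (r : ℝ) (v : L2 D) :
    (fun x => (r • v : L2 D) x) =ᵐ[volume.restrict D] fun x => r * v x := Lp.coeFn_smul r v

lemma aesm_L2 {D : Set Plane} (v : L2 D) :
    AEStronglyMeasurable (fun x => v x) (volume.restrict D) := Lp.aestronglyMeasurable v

lemma continuous_partialD {φ : Plane → ℝ} (h : ContDiff ℝ ∞ φ) (j : Fin 2) :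
    Continuous (partialD j φ) :=
  (h.continuous_fderiv (by simp)).clm_apply continuous_const

lemma contDiff_partialD {φ : Plane → ℝ} (h : ContDiff ℝ ∞ φ) (j : Fin 2) :
    ContDiff ℝ ∞ (partialD j φ) :=
  (h.fderiv_right (m := ∞) (by simp)).clm_apply contDiff_const

lemma hasCompactSupport_partialD {φ : Plane → ℝ} (h : HasCompactSupport φ) (j : Fin 2) :
    HasCompactSupport (partialD j φ) :=
  (h.fderiv ℝ).comp_left (g := fun L : Plane →L[ℝ] ℝ => L (EuclideanSpace.single j 1)) (by simp)

lemma tsupport_partialD {φ : Plane → ℝ} (j : Fin 2) : tsupport (partialD j φ) ⊆ tsupport φ := by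
  refine closure_minimal (fun x hx => ?_) (isClosed_tsupport φ)
  by_contra h
  apply hx
  have : fderiv ℝ φ x = 0 := by
    by_contra h'
    exact h (support_fderiv_subset ℝ h')
  simp [partialD, this]

lemma partialD_add {φ ψ : Plane → ℝ} (h : ContDiff ℝ ∞ φ) (h' : ContDiff ℝ ∞ ψ) (j : Fin 2) :
    partialD j (fun x => φ x + ψ x) = fun x => partialD j φ x + partialD j ψ x := by
  ext x
  have := fderiv_fun_add (h.differentiable (by simp) x) (h'.differentiable (by simp) x)
  simp [partialD, this]

lemma partialD_smul {φ : Plane → ℝ} (h : ContDiff ℝ ∞ φ) (r : ℝ) (j : Fin 2) :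
    partialD j (fun x => r * φ x) = fun x => r * partialD j φ x := by
  ext x
  have := fderiv_const_mul (h.differentiable (by simp) x) r
  simp [partialD, this]

lemma memLp_test {φ : Plane → ℝ} (hc : Continuous φ) (hs : HasCompactSupport φ) (D : Set Plane) :
    MemLp φ 2 (volume.restrict D) :=
  (hc.memLp_of_hasCompactSupport hs).mono_measure Measure.restrict_le_self

lemma memLp_bounded {φ : Plane → ℝ} (hc : Continuous φ) {D : Set Plane}
    (hD : Bornology.IsBounded D) : MemLp φ 2 (volume.restrict D) := by
  have hK : IsCompact (closure D) := hD.isCompact_closure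
  obtain ⟨C, hC⟩ := hK.exists_bound_of_continuousOn hc.continuousOn
  have : IsFiniteMeasure (volume.restrict (closure D)) :=
    ⟨by simpa using hK.measure_lt_top⟩
  refine MemLp.mono_measure (Measure.restrict_mono subset_closure le_rfl)
    (MemLp.of_bound (μ := volume.restrict (closure D)) hc.aestronglyMeasurable C ?_)
  exact (ae_restrict_iff' isClosed_closure.measurableSet).2 (Eventually.of_forall hC)

lemma integrable_mul' {D : Set Plane} (v : L2 D) {φ : Plane → ℝ}
    (h : MemLp φ 2 (volume.restrict D)) : Integrable (fun x => v x * φ x) (volume.restrict D) :=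
  (Lp.memLp v).integrable_mul h

lemma integral_add_mul {D : Set Plane} (v w : L2 D) {φ : Plane → ℝ}
    (h : MemLp φ 2 (volume.restrict D)) :
    ∫ x in D, (v + w : L2 D) x * φ x = (∫ x in D, v x * φ x) + ∫ x in D, w x * φ x := by
  rw [← integral_add (integrable_mul' v h) (integrable_mul' w h)]
  apply integral_congr_ae
  filter_upwards [coeFn_add' v w] with x hx
  simp only [hx]; ring

lemma integral_smul_mul {D : Set Plane} (r : ℝ) (v : L2 D) (φ : Plane → ℝ) :
    ∫ x in D, (r • v : L2 D) x * φ x = r * ∫ x in D, v x * φ x := by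
  rw [← integral_const_mul]
  apply integral_congr_ae
  filter_upwards [coeFn_smul' r v] with x hx
  simp only [hx]; ring

lemma integral_zero_mul {D : Set Plane} (φ : Plane → ℝ) :
    ∫ x in D, (0 : L2 D) x * φ x = 0 := by
  simpa using integral_smul_mul (D := D) 0 0 φ

lemma HasWeakGradient.add {D : Set Plane} {v w : L2 D} {g h : Fin 2 → L2 D}
    (hv : HasWeakGradient D v g) (hw : HasWeakGradient D w h) :
    HasWeakGradient D (v + w) (g + h) := by
  intro j φ hφ
  have m1 := memLp_test (continuous_partialD hφ.contDiff j) (hasCompactSupport_partialD hφ.compact j) D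
  have m2 := memLp_test hφ.contDiff.continuous hφ.compact D
  rw [Pi.add_apply, integral_add_mul _ _ m1, integral_add_mul _ _ m2, hv j φ hφ, hw j φ hφ]
  ring

lemma HasWeakGradient.smul {D : Set Plane} {v : L2 D} {g : Fin 2 → L2 D} (r : ℝ)
    (hv : HasWeakGradient D v g) : HasWeakGradient D (r • v) (r • g) := by
  intro j φ hφ
  rw [Pi.smul_apply, integral_smul_mul, integral_smul_mul, hv j φ hφ]
  ring

lemma hasWeakGradient_zero (D : Set Plane) : HasWeakGradient D 0 0 := by
  intro j φ _
  rw [Pi.zero_apply, integral_zero_mul, integral_zero_mul, neg_zero]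

lemma TendstoH1.add {D : Set Plane} {φ ψ : ℕ → Plane → ℝ} {v w : L2 D} {g h : Fin 2 → L2 D}
    (hφ : ∀ k, ContDiff ℝ ∞ (φ k)) (hψ : ∀ k, ContDiff ℝ ∞ (ψ k))
    (hv : TendstoH1 D φ v g) (hw : TendstoH1 D ψ w h) :
    TendstoH1 D (fun k x => φ k x + ψ k x) (v + w) (g + h) := by
  refine ⟨tendsto_eLpNorm_add (fun k => (hφ k).continuous.aestronglyMeasurable)
    (fun k => (hψ k).continuous.aestronglyMeasurable) (aesm_L2 v) (aesm_L2 w) (coeFn_add' v w)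
    hv.1 hw.1, fun j => ?_⟩
  simp only [partialD_add (hφ _) (hψ _)]
  exact tendsto_eLpNorm_add (fun k => (continuous_partialD (hφ k) j).aestronglyMeasurable)
    (fun k => (continuous_partialD (hψ k) j).aestronglyMeasurable) (aesm_L2 _) (aesm_L2 _)
    (coeFn_add' _ _) (hv.2 j) (hw.2 j)

lemma TendstoH1.smul {D : Set Plane} {φ : ℕ → Plane → ℝ} {v : L2 D} {g : Fin 2 → L2 D} (r : ℝ)
    (hφ : ∀ k, ContDiff ℝ ∞ (φ k)) (hv : TendstoH1 D φ v g) :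
    TendstoH1 D (fun k x => r * φ k x) (r • v) (r • g) := by
  refine ⟨tendsto_eLpNorm_smul r (coeFn_smul' r v) hv.1, fun j => ?_⟩
  simp only [partialD_smul (hφ _)]
  exact tendsto_eLpNorm_smul r (coeFn_smul' r _) (hv.2 j)

lemma tendstoH1_zero (D : Set Plane) : TendstoH1 D (fun _ _ => 0) 0 0 := by
  have e : eLpNorm (fun x => (0 : ℝ) - (0 : L2 D) x) 2 (volume.restrict D) = 0 := by
    rw [eLpNorm_congr_ae (g := fun _ => (0 : ℝ))]
    · simp
    · filter_upwards [Lp.coeFn_zero ℝ 2 (volume.restrict D)] with x hx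
      rw [hx]; simp
  constructor
  · simp only [e]; exact tendsto_const_nhds
  · intro j
    have : partialD j (fun _ => (0 : ℝ)) = fun _ => 0 := by ext x; simp [partialD]
    simp only [this, Pi.zero_apply, e]
    exact tendsto_const_nhds

lemma continuous_edgePt (P : Polygon) (i : P.Edge) : Continuous (P.edgePt i) := by
  unfold Polygon.edgePt; fun_prop

lemma HasTrace.add {P : Polygon} {v w : L2 P.carrier} {γ δ : P.Edge → Polynomial ℝ}
    (hv : HasTrace P v fun i t => (γ i).eval t) (hw : HasTrace P w fun i t => (δ i).eval t) :
    HasTrace P (v + w) fun i t => ((γ + δ) i).eval t := by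
  obtain ⟨g, φ, h1, h2, h3, h4⟩ := hv
  obtain ⟨h, ψ, k1, k2, k3, k4⟩ := hw
  refine ⟨g + h, fun k x => φ k x + ψ k x, h1.add k1, fun k => (h2 k).add (k2 k), h3.add h2 k2 k3,
    fun i => ?_⟩
  refine tendsto_eLpNorm_add
    (fun k => ((h2 k).continuous.comp (continuous_edgePt P i)).aestronglyMeasurable)
    (fun k => ((k2 k).continuous.comp (continuous_edgePt P i)).aestronglyMeasurable)
    (γ i).continuous.aestronglyMeasurable (δ i).continuous.aestronglyMeasurable
    (Eventually.of_forall fun t => ?_) (h4 i) (k4 i)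
  simp

lemma HasTrace.smul {P : Polygon} {v : L2 P.carrier} {γ : P.Edge → Polynomial ℝ} (r : ℝ)
    (hv : HasTrace P v fun i t => (γ i).eval t) :
    HasTrace P (r • v) fun i t => ((r • γ) i).eval t := by
  obtain ⟨g, φ, h1, h2, h3, h4⟩ := hv
  refine ⟨r • g, fun k x => r * φ k x, h1.smul r, fun k => contDiff_const.mul (h2 k), h3.smul r h2,
    fun i => ?_⟩
  exact tendsto_eLpNorm_smul r (Eventually.of_forall fun t => by simp) (h4 i)

lemma hasTrace_zero (P : Polygon) :
    HasTrace P 0 fun i t => ((0 : P.Edge → Polynomial ℝ) i).eval t := by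
  refine ⟨0, fun _ _ => 0, hasWeakGradient_zero _, fun k => contDiff_const, tendstoH1_zero _,
    fun i => ?_⟩
  simp

/-! ### Polynomial calculus -/

lemma contDiff_evalP (p : MvPolynomial (Fin 2) ℝ) : ContDiff ℝ ∞ (evalP p) := by
  induction p using MvPolynomial.induction_on with
  | C a =>
    have e : evalP (MvPolynomial.C a) = fun _ => a := by ext x; simp [evalP]
    rw [e]; exact contDiff_const
  | add p q hp hq =>
    have e : evalP (p + q) = fun x => evalP p x + evalP q x := by ext x; simp [evalP]
    rw [e]; exact hp.add hq
  | mul_X p i hp =>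
    have h : ContDiff ℝ ∞ fun x : Plane => x i :=
      (EuclideanSpace.proj i : Plane →L[ℝ] ℝ).contDiff
    have e : evalP (p * MvPolynomial.X i) = fun x => evalP p x * x i := by ext x; simp [evalP]
    rw [e]; exact hp.mul h

lemma partialD_evalP (p : MvPolynomial (Fin 2) ℝ) (j : Fin 2) :
    partialD j (evalP p) = evalP (MvPolynomial.pderiv j p) := by
  induction p using MvPolynomial.induction_on with
  | C a =>
    have e : evalP (MvPolynomial.C a) = fun _ => a := by ext x; simp [evalP]
    ext x; rw [e]; simp [evalP, partialD]
  | add p q hp hq =>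
    have e : evalP (p + q) = fun x => evalP p x + evalP q x := by ext x; simp [evalP]
    rw [e, partialD_add (contDiff_evalP p) (contDiff_evalP q), hp, hq]
    ext x; simp [evalP]
  | mul_X p i hp =>
    have e : evalP (p * MvPolynomial.X i) = fun x => evalP p x * x i := by ext x; simp [evalP]
    ext x
    have hd : HasFDerivAt (fun x : Plane => x i) (EuclideanSpace.proj i : Plane →L[ℝ] ℝ) x :=
      (EuclideanSpace.proj i : Plane →L[ℝ] ℝ).hasFDerivAt
    have hp' : HasFDerivAt (evalP p) (fderiv ℝ (evalP p) x) x :=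
      ((contDiff_evalP p).differentiable (by simp) x).hasFDerivAt
    have hx := congrFun hp x
    rw [partialD] at hx
    have hm := (hp'.mul hd).fderiv
    have e' : (evalP p * fun x : Plane => x.ofLp i) = fun x => evalP p x * x i := rfl
    rw [e'] at hm
    rw [e, partialD, hm]
    simp only [_root_.add_apply, _root_.smul_apply, hx, smul_eq_mul]
    simp [evalP, MvPolynomial.pderiv_X, Pi.single_apply]
    by_cases h : j = i <;> simp [h, eq_comm]

lemma pderiv_mem_Poly2 {k : ℤ} {p : MvPolynomial (Fin 2) ℝ} (hp : p ∈ Poly2 k) (j : Fin 2) :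
    MvPolynomial.pderiv j p ∈ Poly2 k := by
  rw [Poly2, MvPolynomial.restrictSupport_eq_span] at hp
  induction hp using Submodule.span_induction with
  | mem x hx =>
    obtain ⟨s, hs, rfl⟩ := hx
    rw [MvPolynomial.pderiv_monomial, MvPolynomial.monomial_mem_restrictSupport]
    left
    refine le_trans ?_ (show ((Finsupp.degree s : ℕ) : ℤ) ≤ k from hs)
    exact_mod_cast Finsupp.degree_mono tsub_le_self
  | zero => simp
  | add x y _ _ hx hy => rw [map_add]; exact add_mem hx hy
  | smul r x _ hx => rw [Derivation.map_smul]; exact Submodule.smul_mem _ _ hx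

lemma isTest_partialD {D : Set Plane} {φ : Plane → ℝ} (h : IsTest D φ) (j : Fin 2) :
    IsTest D (partialD j φ) :=
  ⟨contDiff_partialD h.contDiff j, hasCompactSupport_partialD h.compact j,
    (tsupport_partialD j).trans h.tsupport_subset⟩

lemma setIntegral_test {D : Set Plane} {φ : Plane → ℝ} (h : IsTest D φ) (ψ : Plane → ℝ) :
    ∫ x in D, ψ x * φ x = ∫ x, ψ x * φ x := by
  apply setIntegral_eq_integral_of_forall_compl_eq_zero
  intro x hx
  rw [image_eq_zero_of_notMem_tsupport fun h' => hx (h.tsupport_subset h'), mul_zero]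

lemma integral_parts {D : Set Plane} {φ ψ : Plane → ℝ} (h : IsTest D φ) (hψ : ContDiff ℝ ∞ ψ)
    (j : Fin 2) : ∫ x in D, ψ x * partialD j φ x = -∫ x in D, partialD j ψ x * φ x := by
  rw [setIntegral_test h, setIntegral_test (isTest_partialD h j)]
  have hI : ∀ {a b : Plane → ℝ}, Continuous a → Continuous b → HasCompactSupport b →
      Integrable fun x => a x * b x := fun ha hb hs =>
    (ha.mul hb).integrable_of_hasCompactSupport hs.mul_left
  exact integral_mul_fderiv_eq_neg_fderiv_mul_of_integrable
    (hI (continuous_partialD hψ j) h.contDiff.continuous h.compact)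
    (hI hψ.continuous (continuous_partialD h.contDiff j) (hasCompactSupport_partialD h.compact j))
    (hI hψ.continuous h.contDiff.continuous h.compact)
    (fun x _ => hψ.differentiable (by simp) x) (fun x _ => h.contDiff.differentiable (by simp) x)

/-- A polynomial as an element of `L²(P)`. -/
def polyL2 (P : Polygon) : MvPolynomial (Fin 2) ℝ →ₗ[ℝ] L2 P.carrier where
  toFun p := (memLp_bounded (contDiff_evalP p).continuous P.isBounded_carrier).toLp
  map_add' p q := by
    rw [← MemLp.toLp_add]
    congr 1; ext x; simp [evalP]
  map_smul' r p := by
    rw [RingHom.id_apply, ← MemLp.toLp_const_smul]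
    congr 1; ext x; simp [evalP]

lemma coeFn_polyL2 (P : Polygon) (p : MvPolynomial (Fin 2) ℝ) :
    (fun x => polyL2 P p x) =ᵐ[volume.restrict P.carrier] evalP p :=
  (memLp_bounded (contDiff_evalP p).continuous P.isBounded_carrier).coeFn_toLp

lemma integral_polyL2_mul (P : Polygon) (p : MvPolynomial (Fin 2) ℝ) (φ : Plane → ℝ) :
    ∫ x in P.carrier, polyL2 P p x * φ x = ∫ x in P.carrier, evalP p x * φ x := by
  apply integral_congr_ae
  filter_upwards [coeFn_polyL2 P p] with x hx
  rw [hx]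

lemma hasWeakGradient_polyL2 (P : Polygon) (p : MvPolynomial (Fin 2) ℝ) :
    HasWeakGradient P.carrier (polyL2 P p) fun j => polyL2 P (MvPolynomial.pderiv j p) := by
  intro j φ hφ
  rw [integral_polyL2_mul, integral_polyL2_mul, integral_parts hφ (contDiff_evalP p),
    partialD_evalP]

lemma hasWeakLaplacian_polyL2 (P : Polygon) (p : MvPolynomial (Fin 2) ℝ) :
    HasWeakLaplacian P.carrier (polyL2 P p)
      (evalP (∑ j, MvPolynomial.pderiv j (MvPolynomial.pderiv j p))) := by
  intro φ hφ
  have hb : ∀ (q : MvPolynomial (Fin 2) ℝ) {ψ : Plane → ℝ}, IsTest P.carrier ψ →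
      Integrable (fun x => evalP q x * ψ x) (volume.restrict P.carrier) := fun q ψ h =>
    (memLp_bounded (contDiff_evalP q).continuous P.isBounded_carrier).integrable_mul
      (memLp_test h.contDiff.continuous h.compact _)
  have hl : ∀ j, ∫ x in P.carrier, evalP p x * partialD j (partialD j φ) x
      = ∫ x in P.carrier, evalP (MvPolynomial.pderiv j (MvPolynomial.pderiv j p)) x * φ x := by
    intro j
    rw [integral_parts (isTest_partialD hφ j) (contDiff_evalP p), partialD_evalP,
      integral_parts hφ (contDiff_evalP _), partialD_evalP, neg_neg]
  rw [integral_polyL2_mul]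
  simp only [Finset.mul_sum]
  rw [integral_finsetSum _ fun j _ => hb p (isTest_partialD (isTest_partialD hφ j) j)]
  simp only [hl]
  rw [← integral_finsetSum _ fun j _ => hb _ hφ]
  congr 1; ext x
  simp [evalP, add_mul]

lemma eval_restrictEdge (P : Polygon) (i : P.Edge) (p : MvPolynomial (Fin 2) ℝ) (t : ℝ) :
    (P.restrictEdge i p).eval t = evalP p (P.edgePt i t) := by
  induction p using MvPolynomial.induction_on with
  | C a => simp [Polygon.restrictEdge, evalP]
  | add p q hp hq =>
    simp only [Polygon.restrictEdge, evalP, map_add, Polynomial.eval_add] at hp hq ⊢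
    rw [hp, hq]
  | mul_X p j hp =>
    simp only [Polygon.restrictEdge, evalP, map_mul, Polynomial.eval_mul] at hp ⊢
    rw [hp]
    simp [Polygon.edgePt, mul_comm]

lemma restrictEdge_mem (P : Polygon) (i : P.Edge) {l : ℕ} {p : MvPolynomial (Fin 2) ℝ}
    (hp : p ∈ Poly2 l) : P.restrictEdge i p ∈ Poly1 l := by
  have e : ((l : ℤ) + 1).toNat = l + 1 := by omega
  rw [Poly2, MvPolynomial.restrictSupport_eq_span] at hp
  rw [Poly1, e]
  induction hp using Submodule.span_induction with
  | mem x hx =>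
    obtain ⟨s, hs, rfl⟩ := hx
    have hs' : Finsupp.degree s ≤ l := by exact_mod_cast hs
    rw [Polynomial.mem_degreeLT]
    have hle : (P.restrictEdge i (MvPolynomial.monomial s 1)).natDegree ≤ l := by
      refine le_trans ?_ hs'
      rw [Polygon.restrictEdge, MvPolynomial.aeval_monomial, map_one, one_mul,
        Finsupp.prod, Finsupp.degree_apply]
      refine (Polynomial.natDegree_prod_le _ _).trans (Finset.sum_le_sum fun j _ => ?_)
      refine Polynomial.natDegree_pow_le.trans ?_
      refine (Nat.mul_le_mul_left _ (?_ : _ ≤ 1)).trans (mul_one _).le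
      compute_degree
    exact lt_of_le_of_lt Polynomial.degree_le_natDegree (by exact_mod_cast Nat.lt_succ_of_le hle)
  | zero => simp [Polygon.restrictEdge]
  | add x y _ _ hx hy =>
    have : P.restrictEdge i (x + y) = P.restrictEdge i x + P.restrictEdge i y := by
      simp [Polygon.restrictEdge]
    rw [this]; exact add_mem hx hy
  | smul r x _ hx =>
    have : P.restrictEdge i (r • x) = r • P.restrictEdge i x := by simp [Polygon.restrictEdge]
    rw [this]; exact Submodule.smul_mem _ _ hx

lemma hasTrace_polyL2 (P : Polygon) (p : MvPolynomial (Fin 2) ℝ) :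
    HasTrace P (polyL2 P p) fun i t => (P.restrictEdge i p).eval t := by
  have key : ∀ q, eLpNorm (fun x => evalP q x - polyL2 P q x) 2 (volume.restrict P.carrier) = 0 := by
    intro q
    rw [eLpNorm_congr_ae (g := fun _ => (0 : ℝ))]
    · simp
    · filter_upwards [coeFn_polyL2 P q] with x hx
      simp [hx]
  refine ⟨_, fun _ => evalP p, hasWeakGradient_polyL2 P p, fun _ => contDiff_evalP p,
    ⟨?_, fun j => ?_⟩, fun i => ?_⟩
  · simp only [key]; exact tendsto_const_nhds
  · simp only [partialD_evalP, key]; exact tendsto_const_nhds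
  · simp [eval_restrictEdge]

/-! ### The space `H¹₀` -/

/-- `H¹₀(Ω)`: the closure of `C_c^∞(Ω)` in `H¹(Ω)`. -/
def H10 (Ω : Set Plane) : Submodule ℝ (L2 Ω) where
  carrier := {v | ∃ (g : Fin 2 → L2 Ω) (φ : ℕ → Plane → ℝ),
    HasWeakGradient Ω v g ∧ (∀ k, IsTest Ω (φ k)) ∧ TendstoH1 Ω φ v g}
  add_mem' := by
    rintro v w ⟨g, φ, h1, h2, h3⟩ ⟨h, ψ, k1, k2, k3⟩
    refine ⟨g + h, fun k x => φ k x + ψ k x, h1.add k1, fun k => ⟨?_, ?_, ?_⟩,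
      h3.add (fun k => (h2 k).contDiff) (fun k => (k2 k).contDiff) k3⟩
    · exact (h2 k).contDiff.add (k2 k).contDiff
    · exact (h2 k).compact.add (k2 k).compact
    · exact (tsupport_add (φ k) (ψ k)).trans
        (union_subset (h2 k).tsupport_subset (k2 k).tsupport_subset)
  zero_mem' := ⟨0, fun _ _ => 0, hasWeakGradient_zero _,
    fun _ => ⟨contDiff_const, HasCompactSupport.zero, by
      have : tsupport (fun _ : Plane => (0 : ℝ)) = ∅ := by simp [tsupport, Function.support]
      simp [this]⟩, tendstoH1_zero _⟩
  smul_mem' := by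
    rintro r v ⟨g, φ, h1, h2, h3⟩
    refine ⟨r • g, fun k x => r * φ k x, h1.smul r, fun k => ⟨?_, ?_, ?_⟩,
      h3.smul r fun k => (h2 k).contDiff⟩
    · exact contDiff_const.mul (h2 k).contDiff
    · exact (h2 k).compact.mul_left
    · exact (closure_mono (Function.support_mul_subset_right _ _)).trans (h2 k).tsupport_subset

/-! ### The enlarged local space and the degrees of freedom -/

/-- The enlarged local space of order `l`: functions `v ∈ H¹(P)` with `Δv ∈ ℙ_l(P)` whose trace is a
polynomial of degree at most `l` on each edge (the trace being continuous at the vertices). -/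
def enlargedSpace (P : Polygon) (l : ℕ) : Submodule ℝ (L2 P.carrier) where
  carrier := {v | (∃ g, HasWeakGradient P.carrier v g) ∧
    (∃ q ∈ Poly2 l, HasWeakLaplacian P.carrier v (evalP q)) ∧
    ∃ γ : P.Edge → Polynomial ℝ, (∀ i, γ i ∈ Poly1 l) ∧
      (∀ i, (γ i).eval 1 = (γ (i + 1)).eval 0) ∧ HasTrace P v fun i t => (γ i).eval t}
  add_mem' := by
    rintro v w ⟨⟨g, hg⟩, ⟨q, hq, hL⟩, γ, hγ, hc, ht⟩ ⟨⟨g', hg'⟩, ⟨q', hq', hL'⟩, γ', hγ', hc', ht'⟩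
    refine ⟨⟨_, hg.add hg'⟩, ⟨q + q', add_mem hq hq', fun φ hφ => ?_⟩, γ + γ',
      fun i => add_mem (hγ i) (hγ' i), fun i => by simp [hc, hc'], ht.add ht'⟩
    have hb : ∀ q : MvPolynomial (Fin 2) ℝ,
        Integrable (fun x => evalP q x * φ x) (volume.restrict P.carrier) := fun q =>
      (memLp_bounded (contDiff_evalP q).continuous P.isBounded_carrier).integrable_mul
        (memLp_test hφ.contDiff.continuous hφ.compact _)
    rw [integral_add_mul, hL φ hφ, hL' φ hφ, ← integral_add (hb q) (hb q')]
    · congr 1; ext x; simp [evalP, add_mul]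
    · refine memLp_finsetSum _ fun j _ => ?_
      have h := isTest_partialD (isTest_partialD hφ j) j
      exact memLp_test h.contDiff.continuous h.compact _
  zero_mem' := ⟨⟨0, hasWeakGradient_zero _⟩, ⟨0, zero_mem _, fun φ _ => by
      rw [integral_zero_mul]; simp [evalP]⟩, 0, fun i => zero_mem _, by simp, hasTrace_zero P⟩
  smul_mem' := by
    rintro r v ⟨⟨g, hg⟩, ⟨q, hq, hL⟩, γ, hγ, hc, ht⟩
    refine ⟨⟨_, hg.smul r⟩, ⟨r • q, Submodule.smul_mem _ _ hq, fun φ hφ => ?_⟩, r • γ,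
      fun i => Submodule.smul_mem _ _ (hγ i), fun i => by simp [hc], ht.smul r⟩
    rw [integral_smul_mul, hL φ hφ, ← integral_const_mul]
    congr 1; ext x; simp [evalP, mul_assoc]

/-- Polynomials of degree at most `l` as elements of the enlarged local space. -/
def polyEnl (P : Polygon) (l : ℕ) : Poly2 l →ₗ[ℝ] enlargedSpace P l :=
  LinearMap.codRestrict (enlargedSpace P l) ((polyL2 P).comp (Poly2 l).subtype) fun p =>
    ⟨⟨_, hasWeakGradient_polyL2 P p⟩,
      ⟨_, Submodule.sum_mem _ fun j _ => pderiv_mem_Poly2 (pderiv_mem_Poly2 p.2 j) j,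
        hasWeakLaplacian_polyL2 P p⟩,
      fun i => P.restrictEdge i p, fun i => restrictEdge_mem P i p.2,
      fun i => by simp [eval_restrictEdge, Polygon.edgePt], hasTrace_polyL2 P p⟩

/-- The trace of `v` on edge `i`, as a polynomial in the parameter `t ∈ [0, 1]`. -/
def traceP {P : Polygon} {l : ℕ} (v : enlargedSpace P l) (i : P.Edge) : Polynomial ℝ :=
  v.2.2.2.choose i

/-- A choice, for one element, of bases of the test polynomials `ℙ_{l-2}(e)` and `ℙ_{l-2}(P)` of the
moments that serve as degrees of freedom (both empty for `l = 1`). -/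
structure DofBasis (P : Polygon) (l : ℕ) where
  edge : P.Edge → Module.Basis (Fin (Module.finrank ℝ (Poly1 ((l : ℤ) - 2)))) ℝ (Poly1 ((l : ℤ) - 2))
  interior : Module.Basis (Fin (Module.finrank ℝ (Poly2 ((l : ℤ) - 2)))) ℝ (Poly2 ((l : ℤ) - 2))

/-- Indices of the (reduced) degrees of freedom: vertices, edge moments, interior moments. -/
abbrev DofIndex (P : Polygon) (l : ℕ) : Type :=
  P.Edge ⊕ (P.Edge × Fin (Module.finrank ℝ (Poly1 ((l : ℤ) - 2)))) ⊕
    Fin (Module.finrank ℝ (Poly2 ((l : ℤ) - 2)))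

/-- The degrees of freedom: vertex values, the moments `|e|⁻¹ ∫_e v p ds` for `p` in the basis of
`ℙ_{l-2}(e)`, and the moments `|P|⁻¹ ∫_P v p dx` for `p` in the basis of `ℙ_{l-2}(P)`. -/
def dof {P : Polygon} {l : ℕ} (b : DofBasis P l) (v : enlargedSpace P l) : DofIndex P l → ℝ
  | .inl i => (traceP v i).eval 0
  | .inr (.inl (i, a)) => (P.edgeLength i)⁻¹ *
      P.edgeIntegral i fun t => (traceP v i).eval t * (b.edge i a : Polynomial ℝ).eval t
  | .inr (.inr a) => (volume.real P.carrier)⁻¹ *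
      ∫ x in P.carrier, (v : L2 P.carrier) x * evalP (b.interior a) x

/-! ### Projections -/

/-- A value projection and edge projections on one element, computable from the degrees of freedom
and with the consistency properties that the method requires. -/
structure Projections (P : Polygon) (l : ℕ) (b : DofBasis P l) where
  value : enlargedSpace P l →ₗ[ℝ] Poly2 l
  edge : P.Edge → enlargedSpace P l →ₗ[ℝ] Poly1 l
  value_dof : ∃ c : DofIndex P l → Poly2 l, ∀ v, value v = ∑ k, dof b v k • c k
  edge_dof : ∀ i, ∃ c : DofIndex P l → Poly1 l, ∀ v, edge i v = ∑ k, dof b v k • c k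
  value_moment : ∀ v, ∀ p ∈ Poly2 ((l : ℤ) - 2),
    ∫ x in P.carrier, evalP (value v) x * evalP p x =
      ∫ x in P.carrier, (v : L2 P.carrier) x * evalP p x
  value_poly : ∀ q : Poly2 l, value (polyEnl P l q) = q
  edge_start : ∀ i v, (edge i v : Polynomial ℝ).eval 0 = (traceP v i).eval 0
  edge_end : ∀ i v, (edge i v : Polynomial ℝ).eval 1 = (traceP v (i + 1)).eval 0
  edge_moment : ∀ i v, ∀ p ∈ Poly1 ((l : ℤ) - 2),
    P.edgeIntegral i (fun t => (edge i v : Polynomial ℝ).eval t * p.eval t) =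
      P.edgeIntegral i fun t => (traceP v i).eval t * p.eval t
  edge_poly : ∀ i, ∀ q : Poly2 l, ∀ t ∈ Icc (0 : ℝ) 1,
    (edge i (polyEnl P l q) : Polynomial ℝ).eval t = evalP q (P.edgePt i t)

instance (k : ℤ) : FiniteDimensional ℝ (Poly2 k) := by
  have : Finite {s : Fin 2 →₀ ℕ | ((Finsupp.degree s : ℕ) : ℤ) ≤ k} := by
    refine Set.Finite.subset (Set.finite_Iic (Finsupp.equivFunOnFinite.symm fun _ => k.toNat))
      fun s hs j => ?_
    have h1 : s j ≤ Finsupp.degree s := Finsupp.le_degree j s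
    have h2 : ((Finsupp.degree s : ℕ) : ℤ) ≤ k := hs
    simp only [Finsupp.equivFunOnFinite_symm_apply_apply]
    omega
  exact Module.Finite.of_basis (MvPolynomial.basisRestrictSupport ℝ _)

lemma integrable_evalP_mul (P : Polygon) (p q : MvPolynomial (Fin 2) ℝ) :
    Integrable (fun x => evalP p x * evalP q x) (volume.restrict P.carrier) :=
  (memLp_bounded (contDiff_evalP p).continuous P.isBounded_carrier).integrable_mul
    (memLp_bounded (contDiff_evalP q).continuous P.isBounded_carrier)

/-- The `L²(P)` inner product on `ℙ_k(P)`. -/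
def polyForm (P : Polygon) (k : ℤ) : LinearMap.BilinForm ℝ (Poly2 k) :=
  LinearMap.mk₂ ℝ (fun p q => ∫ x in P.carrier, evalP p x * evalP q x)
    (fun p p' q => by
      rw [← integral_add (integrable_evalP_mul P _ _) (integrable_evalP_mul P _ _)]
      congr 1; ext x; simp [evalP, add_mul])
    (fun r p q => by
      rw [smul_eq_mul, ← integral_const_mul]; congr 1; ext x; simp [evalP, mul_assoc])
    (fun p q q' => by
      rw [← integral_add (integrable_evalP_mul P _ _) (integrable_evalP_mul P _ _)]
      congr 1; ext x; simp [evalP, mul_add])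
    (fun r p q => by
      rw [smul_eq_mul, ← integral_const_mul]; congr 1; ext x; simp [evalP, mul_left_comm])

lemma Polygon.nonempty (P : Polygon) : P.carrier.Nonempty := by
  have h : (frontier P.carrier).Nonempty := by
    rw [P.frontier_eq]
    exact ⟨P.vertex 0, mem_iUnion.2 ⟨0, left_mem_segment ℝ _ _⟩⟩
  rcases P.carrier.eq_empty_or_nonempty with h' | h'
  · simp [h'] at h
  · exact h'

lemma evalP_eq_zero (P : Polygon) (p : MvPolynomial (Fin 2) ℝ) (h : ∀ x ∈ P.carrier, evalP p x = 0) :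
    p = 0 := by
  obtain ⟨x₀, hx₀⟩ := P.nonempty
  have ho : IsOpen ((fun y : Fin 2 → ℝ => (WithLp.toLp 2 y : Plane)) ⁻¹' P.carrier) :=
    P.isOpen_carrier.preimage (PiLp.continuous_toLp 2 _)
  obtain ⟨ε, hε, hball⟩ := Metric.isOpen_iff.1 ho x₀.ofLp (by simpa using hx₀)
  refine MvPolynomial.funext_set (fun j => Metric.ball (x₀.ofLp j) ε) (fun j => ?_) fun y hy => ?_
  · rw [Real.ball_eq_Ioo]
    exact Ioo_infinite (by linarith)
  · rw [← ball_pi _ hε] at hy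
    simpa [evalP] using h _ (hball hy)

lemma polyForm_nondegenerate (P : Polygon) (k : ℤ) : (polyForm P k).Nondegenerate := by
  have key : ∀ p : Poly2 k, polyForm P k p p = 0 → p = 0 := by
    intro p hp
    have h0 : (fun x => evalP p x * evalP p x) =ᵐ[volume.restrict P.carrier] 0 :=
      (integral_eq_zero_iff_of_nonneg (fun x => mul_self_nonneg _)
        (integrable_evalP_mul P p p)).1 hp
    have hc := (contDiff_evalP (p : MvPolynomial (Fin 2) ℝ)).continuous
    have h1 := Measure.eqOn_open_of_ae_eq h0 P.isOpen_carrier (hc.mul hc).continuousOn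
      continuousOn_const
    exact Subtype.ext (evalP_eq_zero P p fun x hx => mul_self_eq_zero.1 (h1 hx))
  exact ⟨fun p hp => key p (hp p), fun p hp => key p (hp p)⟩

/-- The polynomial in `ℙ_k(P)` that represents a linear functional with respect to the `L²(P)` inner
product. -/
def represent (P : Polygon) (k : ℤ) (F : Module.Dual ℝ (Poly2 k)) : Poly2 k :=
  ((polyForm P k).toDual (polyForm_nondegenerate P k)).symm F

lemma represent_spec (P : Polygon) (k : ℤ) (F : Module.Dual ℝ (Poly2 k)) (p : Poly2 k) :
    ∫ x in P.carrier, evalP (represent P k F) x * evalP p x = F p :=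
  LinearMap.BilinForm.apply_toDual_symm_apply (hB := polyForm_nondegenerate P k) F p

lemma integrable_L2_evalP {P : Polygon} (v : L2 P.carrier) (p : MvPolynomial (Fin 2) ℝ) :
    Integrable (fun x => v x * evalP p x) (volume.restrict P.carrier) :=
  integrable_mul' v (memLp_bounded (contDiff_evalP p).continuous P.isBounded_carrier)

/-- The functional `p ↦ ∫_P v p dx` on `ℙ_k(P)`. -/
def moment (P : Polygon) (k : ℤ) (v : L2 P.carrier) : Module.Dual ℝ (Poly2 k) where
  toFun p := ∫ x in P.carrier, v x * evalP p x
  map_add' p q := by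
    rw [← integral_add (integrable_L2_evalP v _) (integrable_L2_evalP v _)]
    congr 1; ext x; simp [evalP, mul_add]
  map_smul' r p := by
    rw [RingHom.id_apply, smul_eq_mul, ← integral_const_mul]
    congr 1; ext x; simp [evalP, mul_left_comm]

/-- The `L²(P)`-orthogonal projection onto `ℙ_k(P)`. -/
def l2Proj (P : Polygon) (k : ℤ) (v : L2 P.carrier) : Poly2 k := represent P k (moment P k v)

lemma l2Proj_spec (P : Polygon) (k : ℤ) (v : L2 P.carrier) (p : Poly2 k) :
    ∫ x in P.carrier, evalP (l2Proj P k v) x * evalP p x = ∫ x in P.carrier, v x * evalP p x :=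
  represent_spec P k _ p

lemma continuous_edge_integrand (P : Polygon) (i : P.Edge) (r : Polynomial ℝ)
    (p : MvPolynomial (Fin 2) ℝ) (c : ℝ) :
    Continuous fun t => r.eval t * (evalP p (P.edgePt i t) * c) :=
  r.continuous.mul (((contDiff_evalP p).continuous.comp (continuous_edgePt P i)).mul continuous_const)

/-- The functional `p ↦ -∫_P (Π₀ v) ∂_j p dx + ∑_e ∫_e (Π₀^e v) p n_j ds` on `ℙ_{l-1}(P)`. -/
def gradFunctional {P : Polygon} {l : ℕ} {b : DofBasis P l} (pr : Projections P l b)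
    (v : enlargedSpace P l) (j : Fin 2) : Module.Dual ℝ (Poly2 ((l : ℤ) - 1)) where
  toFun p := -(∫ x in P.carrier, evalP (pr.value v) x * evalP (MvPolynomial.pderiv j p) x) +
    ∑ i, P.edgeIntegral i fun t =>
      (pr.edge i v : Polynomial ℝ).eval t * (evalP p (P.edgePt i t) * P.normal i j)
  map_add' p q := by
    have h1 : ∫ x in P.carrier, evalP (pr.value v) x * evalP (MvPolynomial.pderiv j (p + q : _)) x =
        (∫ x in P.carrier, evalP (pr.value v) x * evalP (MvPolynomial.pderiv j p) x) +
          ∫ x in P.carrier, evalP (pr.value v) x * evalP (MvPolynomial.pderiv j q) x := by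
      rw [← integral_add (integrable_evalP_mul P _ _) (integrable_evalP_mul P _ _)]
      congr 1; ext x; simp [evalP, mul_add]
    have h2 : ∀ i, (P.edgeIntegral i fun t => (pr.edge i v : Polynomial ℝ).eval t *
        (evalP (p + q : Poly2 ((l : ℤ) - 1)) (P.edgePt i t) * P.normal i j)) =
        (P.edgeIntegral i fun t => (pr.edge i v : Polynomial ℝ).eval t *
          (evalP p (P.edgePt i t) * P.normal i j)) +
        P.edgeIntegral i fun t => (pr.edge i v : Polynomial ℝ).eval t *
          (evalP q (P.edgePt i t) * P.normal i j) := by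
      intro i
      rw [Polygon.edgeIntegral, Polygon.edgeIntegral, Polygon.edgeIntegral, ← mul_add,
        ← intervalIntegral.integral_add
          (continuous_edge_integrand P i _ _ _).continuousOn.intervalIntegrable
          (continuous_edge_integrand P i _ _ _).continuousOn.intervalIntegrable]
      congr 2; ext t; simp only [evalP, Submodule.coe_add, map_add]; ring
    simp only [h2, Finset.sum_add_distrib]
    simp only [Submodule.coe_add] at h1 ⊢
    rw [h1]; ring
  map_smul' r p := by
    have h1 : ∫ x in P.carrier, evalP (pr.value v) x *
        evalP (MvPolynomial.pderiv j (r • (p : MvPolynomial (Fin 2) ℝ))) x =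
        r * ∫ x in P.carrier, evalP (pr.value v) x * evalP (MvPolynomial.pderiv j p) x := by
      rw [← integral_const_mul]
      congr 1; ext x; simp [evalP, mul_left_comm]
    have h2 : ∀ i, (P.edgeIntegral i fun t => (pr.edge i v : Polynomial ℝ).eval t *
        (evalP (r • p : Poly2 ((l : ℤ) - 1)) (P.edgePt i t) * P.normal i j)) =
        r * P.edgeIntegral i fun t => (pr.edge i v : Polynomial ℝ).eval t *
          (evalP p (P.edgePt i t) * P.normal i j) := by
      intro i
      simp only [Polygon.edgeIntegral, ← intervalIntegral.integral_const_mul, evalP,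
        Submodule.coe_smul, MvPolynomial.smul_eval]
      refine intervalIntegral.integral_congr fun t _ => ?_
      ring
    simp only [h2, ← Finset.mul_sum]
    simp only [Submodule.coe_smul, h1, RingHom.id_apply, smul_eq_mul]
    ring

/-- The gradient projection `Π₁ v ∈ [ℙ_{l-1}(P)]²`. -/
def gradProj {P : Polygon} {l : ℕ} {b : DofBasis P l} (pr : Projections P l b)
    (v : enlargedSpace P l) (j : Fin 2) : Poly2 ((l : ℤ) - 1) :=
  represent P _ (gradFunctional pr v j)

/-- The identity that defines the gradient projection:
`∫_P Π₁ v · p dx = -∫_P (Π₀ v) (div p) dx + ∑_e ∫_e (Π₀^e v) (p · n) ds`. -/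
lemma gradProj_spec {P : Polygon} {l : ℕ} {b : DofBasis P l} (pr : Projections P l b)
    (v : enlargedSpace P l) (p : Fin 2 → Poly2 ((l : ℤ) - 1)) :
    ∫ x in P.carrier, ∑ j, evalP (gradProj pr v j) x * evalP (p j) x =
      -(∫ x in P.carrier, evalP (pr.value v) x * ∑ j, evalP (MvPolynomial.pderiv j (p j)) x) +
      ∑ i, P.edgeIntegral i fun t => (pr.edge i v : Polynomial ℝ).eval t *
        ∑ j, evalP (p j) (P.edgePt i t) * P.normal i j := by
  have h := fun j => represent_spec P _ (gradFunctional pr v j) (p j)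
  simp only [gradFunctional, LinearMap.coe_mk, AddHom.coe_mk] at h
  rw [integral_finsetSum _ fun j _ => integrable_evalP_mul P _ _]
  have h3 : ∀ i, (P.edgeIntegral i fun t => (pr.edge i v : Polynomial ℝ).eval t *
        ∑ j, evalP (p j) (P.edgePt i t) * P.normal i j) =
      ∑ j, P.edgeIntegral i fun t => (pr.edge i v : Polynomial ℝ).eval t *
        (evalP (p j) (P.edgePt i t) * P.normal i j) := by
    intro i
    simp only [Polygon.edgeIntegral, ← Finset.mul_sum]
    rw [← intervalIntegral.integral_finsetSum fun j _ =>
      (continuous_edge_integrand P i _ _ _).continuousOn.intervalIntegrable]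
    simp only [Finset.mul_sum]
  simp only [h3]
  simp only [Finset.mul_sum]
  rw [integral_finsetSum _ fun j _ => integrable_evalP_mul P _ _, Finset.sum_comm,
    ← Finset.sum_neg_distrib, ← Finset.sum_add_distrib]
  exact Finset.sum_congr rfl fun j _ => h j

/-! ### The virtual element space and the discrete problem -/

/-- The local virtual element space: all `v` in the enlarged space with `(v - Π₀ v, p)_P = 0` for all
`p ∈ ℙ_l(P) \ ℙ_{l-2}(P)`. -/
def localSpace {P : Polygon} {l : ℕ} {b : DofBasis P l} (pr : Projections P l b) :
    Submodule ℝ (enlargedSpace P l) where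
  carrier := {v | ∀ p ∈ Poly2 l, p ∉ Poly2 ((l : ℤ) - 2) →
    ∫ x in P.carrier, (v - polyEnl P l (pr.value v) : enlargedSpace P l).1 x * evalP p x = 0}
  add_mem' := by
    intro v w hv hw p hp hp'
    have e : ((v + w) - polyEnl P l (pr.value (v + w)) : enlargedSpace P l).1 =
        (v - polyEnl P l (pr.value v) : enlargedSpace P l).1 +
        (w - polyEnl P l (pr.value w) : enlargedSpace P l).1 := by
      rw [map_add, map_add, ← Submodule.coe_add]
      congr 1; abel
    rw [e, integral_add_mul _ _
      (memLp_bounded (contDiff_evalP p).continuous P.isBounded_carrier), hv p hp hp', hw p hp hp',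
      add_zero]
  zero_mem' := by
    intro p _ _
    rw [map_zero, map_zero, sub_zero]
    exact integral_zero_mul _
  smul_mem' := by
    intro r v hv p hp hp'
    have e : (r • v - polyEnl P l (pr.value (r • v)) : enlargedSpace P l).1 =
        r • (v - polyEnl P l (pr.value v) : enlargedSpace P l).1 := by
      rw [map_smul, map_smul, ← smul_sub]; rfl
    rw [e, integral_smul_mul, hv p hp hp', mul_zero]

/-- Restriction `L²(Ω) → L²(D)` for `D ⊆ Ω`. -/
def restrictL2 {D Ω : Set Plane} (h : D ⊆ Ω) : L2 Ω →ₗ[ℝ] L2 D where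
  toFun v := ((Lp.memLp v).mono_measure (Measure.restrict_mono h le_rfl)).toLp
  map_add' v w := by
    rw [← MemLp.toLp_add]
    exact MemLp.toLp_congr _ _
      (ae_mono (Measure.restrict_mono h le_rfl) (Lp.coeFn_add v w))
  map_smul' r v := by
    rw [RingHom.id_apply, ← MemLp.toLp_const_smul]
    exact MemLp.toLp_congr _ _
      (ae_mono (Measure.restrict_mono h le_rfl) (Lp.coeFn_smul r v))

/-- The global virtual element space: all `v ∈ H¹₀(Ω)` whose restriction to each element lies in the
local virtual element space. -/
def vemSpace {Ω : Set Plane} (T : Mesh Ω) {l : ℕ} {b : ∀ K, DofBasis (T.elt K) l}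
    (pr : ∀ K, Projections (T.elt K) l (b K)) : Submodule ℝ (L2 Ω) :=
  H10 Ω ⊓ ⨅ K, ((localSpace (pr K)).map (enlargedSpace (T.elt K) l).subtype).comap
    (restrictL2 (T.elt_subset K))

lemma restrict_mem {Ω : Set Plane} {T : Mesh Ω} {l : ℕ} {b : ∀ K, DofBasis (T.elt K) l}
    {pr : ∀ K, Projections (T.elt K) l (b K)} (v : vemSpace T pr) (K : Fin T.numElements) :
    restrictL2 (T.elt_subset K) v ∈ enlargedSpace (T.elt K) l := by
  obtain ⟨w, _, hw⟩ := (Submodule.mem_iInf _).1 v.2.2 K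
  rw [← hw]
  exact w.2

/-- The restriction of `v ∈ V_h` to element `K`, as an element of the enlarged local space. -/
def localPart {Ω : Set Plane} {T : Mesh Ω} {l : ℕ} {b : ∀ K, DofBasis (T.elt K) l}
    {pr : ∀ K, Projections (T.elt K) l (b K)} (v : vemSpace T pr) (K : Fin T.numElements) :
    enlargedSpace (T.elt K) l :=
  ⟨restrictL2 (T.elt_subset K) v, restrict_mem v K⟩

/-- The assumptions on the nonlinearity `μ`. -/
structure NonlinearityAssumptions (Ω : Set Plane) (μ : Plane → ℝ → ℝ) (m M : ℝ) : Prop where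
  continuousOn : ContinuousOn (fun z : Plane × ℝ => μ z.1 z.2) (closure Ω ×ˢ Ici 0)
  pos_m : 0 < m
  pos_M : 0 < M
  lower : ∀ x ∈ closure Ω, ∀ s t, 0 ≤ s → s ≤ t → m * (t - s) ≤ μ x t * t - μ x s * s
  upper : ∀ x ∈ closure Ω, ∀ s t, 0 ≤ s → s ≤ t → μ x t * t - μ x s * s ≤ M * (t - s)

/-- The value `Π₁ v (x) ∈ ℝ²`. -/
def gradProjAt {P : Polygon} {l : ℕ} {b : DofBasis P l} (pr : Projections P l b)
    (v : enlargedSpace P l) (x : Plane) : Plane :=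
  !₂[evalP (gradProj pr v 0) x, evalP (gradProj pr v 1) x]

/-- The stabilisation `S(v, w) = M m ∑_λ λ(v) λ(w)`. -/
def stab {P : Polygon} {l : ℕ} (b : DofBasis P l) (m M : ℝ) (v w : enlargedSpace P l) : ℝ :=
  M * m * ∑ k, dof b v k * dof b w k

/-- The local discrete form
`(μ(x, |Π₁ z|) Π₁ v, Π₁ w)_P + S((I - Π₀) v, (I - Π₀) w)`. -/
def localForm {P : Polygon} {l : ℕ} {b : DofBasis P l} (pr : Projections P l b)
    (μ : Plane → ℝ → ℝ) (m M : ℝ) (z v w : enlargedSpace P l) : ℝ :=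
  (∫ x in P.carrier,
    μ x ‖gradProjAt pr z x‖ * inner ℝ (gradProjAt pr v x) (gradProjAt pr w x)) +
  stab b m M (v - polyEnl P l (pr.value v)) (w - polyEnl P l (pr.value w))

/-- The discrete form `a_h(z; v, w)`. -/
def discreteForm {Ω : Set Plane} {T : Mesh Ω} {l : ℕ} {b : ∀ K, DofBasis (T.elt K) l}
    (pr : ∀ K, Projections (T.elt K) l (b K)) (μ : Plane → ℝ → ℝ) (m M : ℝ)
    (z v w : vemSpace T pr) : ℝ :=
  ∑ K, localForm (pr K) μ m M (localPart z K) (localPart v K) (localPart w K)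

/-- The discrete right-hand side `(f_h, v)`, where `f_h` is on each element the `L²`-orthogonal
projection of `f` onto polynomials of degree at most `l`. -/
def discreteLoad {Ω : Set Plane} {T : Mesh Ω} {l : ℕ} {b : ∀ K, DofBasis (T.elt K) l}
    (pr : ∀ K, Projections (T.elt K) l (b K)) (f : L2 Ω) (v : vemSpace T pr) : ℝ :=
  ∑ K, ∫ x in (T.elt K).carrier,
    evalP (l2Proj (T.elt K) l (restrictL2 (T.elt_subset K) f)) x *
      (restrictL2 (T.elt_subset K) (v : L2 Ω)) x

end

end QuasiVEM

open QuasiVEM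

namespace QuasiVEM

noncomputable section

/-! ### Geometry of star-shaped polygons -/

/-! The solution comes from Zarantonello's theorem on the discrete space. Let B be the bilinear form
obtained from a_h by setting μ ≡ 1 (`referenceForm`, summed over the elements). The two bounds on t
↦ μ(x,t)t make the field a ↦ μ(x,|a|)a strongly monotone and Lipschitz, uniformly in x, so u ↦
a_h(u;u,·) is strongly monotone and Lipschitz relative to B (`localForm_stronglyMonotone`,
`abs_localForm_sub_localForm_le`). The bulk of the work is to show that V_h is finite-dimensional
and that B is positive definite on it.

Both facts rest on a uniqueness statement on one element, `eq_zero_of_trace_zero`. For v in the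
local space put w = v - Π₀v. If the degrees of freedom of w vanish, so does its trace. The
constraint defining the local space makes w orthogonal to all of ℙ_l, in particular to Δw, and
Green's identity ∫|∇w|² = -∫ w Δw = 0 forces w = 0. If B(v,v) = 0, the stabilisation term therefore
makes v a polynomial on each element. By the divergence theorem Π₁ maps a polynomial to its
gradient, so v is constant on each element; its weak gradient in Ω vanishes almost everywhere, and
the Poincaré inequality in H¹₀ gives v = 0. If instead all degrees of freedom of v vanish, then Π₀v
= 0 and w = v, so v = 0: the degrees of freedom embed V_h in a finite-dimensional space.

A zero trace means only that smooth functions converging to w in H¹ have boundary values tending to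
zero in L². Green's identity is reached through cutoffs χ that drop to zero in a strip of width κ at
the boundary. The error ∫ w ∇w·∇χ is controlled since |∇χ| is at most C/κ, while integration along
rays from the star centre bounds ∫ w² over the strip by Cκ² times the integral of |∇w|² there; the
powers of κ cancel, and the rest tends to zero with the strip. The same star coordinates, which cut
an element into triangles over its edges, give the divergence theorem. -/

/-- `S` contains the ball of radius `r > 0` about `x₀` and is star-shaped with respect to it. -/
structure IsStarBall (S : Set Plane) (x₀ : Plane) (r : ℝ) : Prop where
  pos : 0 < r
  ball_subset : Metric.ball x₀ r ⊆ S
  starConvex : ∀ y ∈ Metric.ball x₀ r, StarConvex ℝ y S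

/-- Replace y by a nearby point z of S and move the centre to p + (s/(1-s))(y - z), which stays in
the ball; the segment from the new centre to z still passes through p + s(y - p). -/
lemma IsStarBall.mem_of_mem_closure {S : Set Plane} {x₀ : Plane} {r : ℝ} (h : IsStarBall S x₀ r)
    {p y : Plane} (hp : p ∈ Metric.ball x₀ r) (hy : y ∈ closure S) {s : ℝ} (hs : 0 ≤ s)
    (hs1 : s < 1) : p + s • (y - p) ∈ S := by
  have h1 : (0 : ℝ) < 1 - s := by linarith
  have hc : Continuous fun z : Plane => p + (s / (1 - s)) • (y - z) := by fun_prop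
  have hn : (fun z : Plane => p + (s / (1 - s)) • (y - z)) ⁻¹' Metric.ball x₀ r ∈ 𝓝 y := by
    apply hc.continuousAt.preimage_mem_nhds
    simpa using Metric.isOpen_ball.mem_nhds hp
  obtain ⟨z, hz, hzS⟩ := mem_closure_iff_nhds.1 hy _ hn
  have := h.starConvex _ hz hzS h1.le hs (by ring)
  convert this using 1
  rw [smul_add, smul_smul, mul_div_cancel₀ _ h1.ne']
  module

lemma IsStarBall.mem_of_mem_frontier {S : Set Plane} {x₀ : Plane} {r : ℝ} (h : IsStarBall S x₀ r)
    {y : Plane} (hy : y ∈ frontier S) {s : ℝ} (hs : 0 ≤ s) (hs1 : s < 1) :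
    x₀ + s • (y - x₀) ∈ S :=
  h.mem_of_mem_closure (Metric.mem_ball_self h.pos) (frontier_subset_closure hy) hs hs1

/-- This ball is the image of the star ball under the homothety p ↦ p + s(y - p), whose values lie
in S. -/
lemma IsStarBall.ball_subset_of_mem_closure {S : Set Plane} {x₀ : Plane} {r : ℝ}
    (h : IsStarBall S x₀ r) {y : Plane} (hy : y ∈ closure S) {s : ℝ} (hs : 0 ≤ s) (hs1 : s < 1) :
    Metric.ball (x₀ + s • (y - x₀)) ((1 - s) * r) ⊆ S := by
  intro z hz
  have h1 : (0 : ℝ) < 1 - s := by linarith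
  have hp : x₀ + (1 - s)⁻¹ • (z - (x₀ + s • (y - x₀))) ∈ Metric.ball x₀ r := by
    rw [Metric.mem_ball, dist_eq_norm] at hz ⊢
    rw [add_sub_cancel_left, norm_smul, norm_inv, Real.norm_of_nonneg h1.le,
      inv_mul_lt_iff₀ h1]
    exact hz
  convert h.mem_of_mem_closure hp hy hs hs1 using 1
  have : s = 1 - (1 - s) := by ring
  generalize hq : (1 - s) = q at *
  subst this
  have hq0 : q ≠ 0 := h1.ne'
  match_scalars <;> field_simp <;> ring

/-- The half-line from x pointing away from x₀ is connected, starts in S and leaves the bounded set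
S, so it meets the frontier. The meeting point is not x itself because S is open. -/
lemma exists_frontier_ray {S : Set Plane} (hS : IsOpen S) (hb : Bornology.IsBounded S)
    {x₀ x : Plane} (hx : x ∈ S) (hne : x ≠ x₀) :
    ∃ y ∈ frontier S, ∃ s ∈ Ioo (0 : ℝ) 1, x = x₀ + s • (y - x₀) := by
  set ray : ℝ → Plane := fun c => x₀ + c • (x - x₀) with hray
  have hc : Continuous ray := by fun_prop
  have hpos : 0 < ‖x - x₀‖ := norm_pos_iff.2 (sub_ne_zero.2 hne)
  have hpre : IsPreconnected (ray '' Ici 1) := isPreconnected_Ici.image _ hc.continuousOn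
  have hin : (ray '' Ici 1 ∩ S).Nonempty := ⟨x, ⟨1, self_mem_Ici, by simp [hray]⟩, hx⟩
  have hout : (ray '' Ici 1 ∩ Sᶜ).Nonempty := by
    obtain ⟨R, hR⟩ := hb.subset_ball x₀
    refine ⟨ray (max 1 (R / ‖x - x₀‖)), ⟨_, mem_Ici.2 (le_max_left _ _), rfl⟩, fun hmem => ?_⟩
    have h1 := hR hmem
    rw [Metric.mem_ball, dist_eq_norm, hray] at h1
    simp only [add_sub_cancel_left, norm_smul] at h1
    rw [Real.norm_of_nonneg (by positivity), ← lt_div_iff₀ hpos] at h1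
    exact absurd (le_max_right 1 (R / ‖x - x₀‖)) (not_le.2 h1)
  have hfr : (ray '' Ici 1 ∩ frontier S).Nonempty := by
    by_contra hemp
    have hcl : ray '' Ici 1 ∩ closure S ⊆ S := fun z hz => by
      by_contra hzS
      exact hemp ⟨z, hz.1, hz.2, fun h => hzS (interior_subset h)⟩
    obtain ⟨z, hz, hzS, hzS'⟩ := hpre S (closure S)ᶜ hS isClosed_closure.isOpen_compl
      (fun z hz => or_iff_not_imp_right.2 fun h => hcl ⟨hz, not_not.1 h⟩) hin
      (hout.mono fun z hz => ⟨hz.1, fun h => hz.2 (hcl ⟨hz.1, h⟩)⟩)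
    exact hzS' (subset_closure hzS)
  obtain ⟨y, ⟨c, hc1, rfl⟩, hy⟩ := hfr
  have hc1' : (1 : ℝ) ≤ c := hc1
  have hcne : c ≠ 1 := by
    rintro rfl
    have : x ∈ frontier S := by simpa [hray] using hy
    exact (hS.inter_frontier_eq.le ⟨hx, this⟩ : x ∈ (∅ : Set Plane))
  have hc2 : 1 < c := lt_of_le_of_ne hc1' hcne.symm
  refine ⟨_, hy, c⁻¹, ⟨by positivity, inv_lt_one_of_one_lt₀ hc2⟩, ?_⟩
  simp only [hray, add_sub_cancel_left, smul_smul]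
  rw [inv_mul_cancel₀ (by positivity), one_smul, add_sub_cancel]

/-- Of two frontier points on one ray from x₀, the nearer would lie in the open set S by
`mem_of_mem_frontier`. -/
lemma IsStarBall.frontier_ray_unique {S : Set Plane} (hS : IsOpen S) {x₀ : Plane} {r : ℝ}
    (h : IsStarBall S x₀ r) {y y' : Plane} (hy : y ∈ frontier S) (hy' : y' ∈ frontier S)
    {s s' : ℝ} (hs : s ∈ Ioo (0 : ℝ) 1) (hs' : s' ∈ Ioo (0 : ℝ) 1)
    (he : x₀ + s • (y - x₀) = x₀ + s' • (y' - x₀)) : y = y' ∧ s = s' := by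
  have key : ∀ {y y' : Plane} {s s' : ℝ}, y ∈ frontier S → y' ∈ frontier S → 0 < s → 0 < s' →
      s • (y - x₀) = s' • (y' - x₀) → ¬ s < s' := by
    intro y y' s s' hy hy' hs hs' he hlt
    have h1 := h.mem_of_mem_frontier hy (div_nonneg hs.le hs'.le) ((div_lt_one hs').2 hlt)
    have h2 : x₀ + (s / s') • (y - x₀) = y' := by
      rw [div_eq_inv_mul, mul_smul, he, smul_smul, inv_mul_cancel₀ hs'.ne', one_smul,
        add_sub_cancel]
    rw [h2] at h1
    exact (hS.inter_frontier_eq.le ⟨h1, hy'⟩ : y' ∈ (∅ : Set Plane))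
  have he' := add_left_cancel he
  have hss : s = s' := le_antisymm (not_lt.1 (key hy' hy hs'.1 hs.1 he'.symm))
    (not_lt.1 (key hy hy' hs.1 hs'.1 he'))
  subst hss
  exact ⟨sub_left_injective (smul_right_injective _ hs.1.ne' he'), rfl⟩

/-- The planar cross product. -/
def cross (a b : Plane) : ℝ := a 0 * b 1 - a 1 * b 0

lemma Polygon.edgePt_mem_frontier (P : Polygon) (i : P.Edge) {t : ℝ} (ht : t ∈ Icc (0 : ℝ) 1) :
    P.edgePt i t ∈ frontier P.carrier := by
  rw [P.frontier_eq]
  refine mem_iUnion.2 ⟨i, ?_⟩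
  rw [segment_eq_image']
  exact ⟨t, ht, rfl⟩

lemma Polygon.edgePt_mem_openSegment (P : Polygon) (i : P.Edge) {t : ℝ} (ht : t ∈ Ioo (0 : ℝ) 1) :
    P.edgePt i t ∈ openSegment ℝ (P.vertex i) (P.vertex (i + 1)) := by
  rw [openSegment_eq_image']
  exact ⟨t, ht, rfl⟩

lemma Polygon.edgePt_mem_segment (P : Polygon) (i : P.Edge) {t : ℝ} (ht : t ∈ Icc (0 : ℝ) 1) :
    P.edgePt i t ∈ segment ℝ (P.vertex i) (P.vertex (i + 1)) := by
  rw [segment_eq_image']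
  exact ⟨t, ht, rfl⟩

lemma Polygon.edgeVec_ne_zero (P : Polygon) (i : P.Edge) : P.vertex (i + 1) - P.vertex i ≠ 0 := by
  rw [sub_ne_zero]
  intro h
  have := P.vertex_injective h
  simp at this

lemma Polygon.edgeLength_pos (P : Polygon) (i : P.Edge) : 0 < P.edgeLength i := by
  rw [Polygon.edgeLength, dist_comm, dist_eq_norm]
  exact norm_pos_iff.2 (P.edgeVec_ne_zero i)

/-- The edges of a polygon have every point of a star ball weakly on their left. -/
lemma IsStarBall.cross_nonneg {P : Polygon} {x₀ : Plane} {r : ℝ}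
    (h : IsStarBall P.carrier x₀ r) (i : P.Edge) {p : Plane} (hp : p ∈ Metric.ball x₀ r) :
    0 ≤ cross (P.vertex i - p) (P.vertex (i + 1) - P.vertex i) := by
  -- If p were strictly to the right of the edge, points just to the right of its midpoint would lie
  -- on segments from p to the edge, hence in the carrier, against `interior_left`.
  by_contra hneg
  rw [not_le] at hneg
  set b := P.vertex (i + 1) - P.vertex i with hb
  set D := cross (P.vertex i - p) b with hD
  have hb2 : 0 < b 0 ^ 2 + b 1 ^ 2 := by
    have := norm_pos_iff.2 (P.edgeVec_ne_zero i)
    rw [← hb] at this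
    have h2 : 0 < ‖b‖ ^ 2 := by positivity
    simpa [EuclideanSpace.norm_sq_eq, Fin.sum_univ_two] using h2
  -- for `s > 0` the point `x - s • rotLeft b` is `e t + τ (p - e t)` with `τ`, `t` as follows
  set x := P.edgePt i (1 / 2) with hx
  have hxm := P.edgePt_mem_openSegment i (t := 1 / 2) ⟨by norm_num, by norm_num⟩
  have hev := (P.interior_left i x hxm).mono fun s hs => hs.2
  -- Taking the cross product with b fixes τ, since every point of the edge line has cross product D
  -- relative to p; comparing components along b then fixes the edge parameter. As s tends to 0, τ
  -- tends to 0 and the parameter to 1/2.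
  let τ : ℝ → ℝ := fun s => s * (b 0 ^ 2 + b 1 ^ 2) / (-D)
  let κ : ℝ := (b 0 * (x 0 - p 0) + b 1 * (x 1 - p 1)) / (b 0 ^ 2 + b 1 ^ 2)
  let tt : ℝ → ℝ := fun s => 1 / 2 + τ s / (1 - τ s) * κ
  have hτ : Tendsto τ (𝓝[>] 0) (𝓝 0) := by
    have : Continuous τ := by fun_prop
    exact tendsto_nhdsWithin_of_tendsto_nhds (by simpa [τ] using this.tendsto 0)
  have htt : Tendsto tt (𝓝[>] 0) (𝓝 (1 / 2)) := by
    have : Tendsto (fun s => 1 / 2 + τ s / (1 - τ s) * κ) (𝓝[>] 0)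
        (𝓝 (1 / 2 + 0 / (1 - 0) * κ)) :=
      tendsto_const_nhds.add ((hτ.div (tendsto_const_nhds.sub hτ) (by norm_num)).mul_const _)
    simpa [tt] using this
  have e1 := hτ.eventually (gt_mem_nhds (show (0 : ℝ) < 1 by norm_num))
  have e2 := htt.eventually (isOpen_Ioo.mem_nhds (show (1 / 2 : ℝ) ∈ Ioo (0 : ℝ) 1 by norm_num))
  obtain ⟨s, ⟨⟨hs1, hs2⟩, hs3⟩, hs4⟩ :=
    (((hev.and e1).and e2).and self_mem_nhdsWithin).exists
  have hs4 : 0 < s := hs4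
  have hτ0 : 0 < τ s := div_pos (mul_pos hs4 hb2) (by linarith)
  have hmem := h.mem_of_mem_closure hp
    (frontier_subset_closure (P.edgePt_mem_frontier i (Ioo_subset_Icc_self hs3)))
    (s := 1 - τ s) (by linarith) (by linarith)
  apply hs1
  apply subset_closure
  convert hmem using 1
  have h1τ : 1 - τ s ≠ 0 := by linarith
  have htt' : (1 - τ s) * tt s = (1 - τ s) / 2 + τ s * κ := by
    simp only [tt]; field_simp
  have hDτ : τ s * D = - (s * (b 0 ^ 2 + b 1 ^ 2)) := by
    simp only [τ]
    rw [div_neg, neg_mul, div_mul_cancel₀ _ hneg.ne]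
  have hκ : κ * (b 0 ^ 2 + b 1 ^ 2) = b 0 * (x 0 - p 0) + b 1 * (x 1 - p 1) := by
    simp only [κ]; field_simp
  have hx0 : ∀ j, x j = P.vertex i j + 1 / 2 * b j := by intro j; simp [hx, Polygon.edgePt, hb]
  have hDx : D = (x 0 - p 0) * b 1 - (x 1 - p 1) * b 0 := by
    rw [hD, hx0, hx0]; simp [cross]; ring
  have hfin : ∀ j, (p + (1 - τ s) • (P.edgePt i (tt s) - p)) j
      = p j + (1 - τ s) * (P.vertex i j - p j) + ((1 - τ s) / 2 + τ s * κ) * b j := by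
    intro j
    rw [← htt']
    simp [Polygon.edgePt, hb]; ring
  have hN := hb2.ne'
  clear_value τ κ
  ext j
  rw [hfin]
  apply mul_left_cancel₀ hN
  have hr : (x - s • rotLeft (P.vertex (i + 1) - P.vertex i)) j
      = P.vertex i j + 1 / 2 * b j - s * rotLeft b j := by
    rw [← hx0]; simp [hb]
  rw [hr]
  have h0 := hx0 0
  have h1 := hx0 1
  rw [hDx] at hDτ
  fin_cases j
  · simp only [rotLeft, Fin.zero_eta, PiLp.toLp_apply, Matrix.cons_val_zero]
    rw [h0, h1] at hDτ hκ
    linear_combination (b 1) * hDτ - τ s * b 0 * hκ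
  · simp only [rotLeft, Fin.mk_one, PiLp.toLp_apply, Matrix.cons_val_one, Matrix.cons_val_zero]
    rw [h0, h1] at hDτ hκ
    linear_combination (-b 0) * hDτ - τ s * b 1 * hκ

/-- Strictness comes from applying the weak inequality to a ball point displaced from x₀ by δ
towards the right of the edge, which lowers the cross product by δ|b|². -/
lemma IsStarBall.cross_pos {P : Polygon} {x₀ : Plane} {r : ℝ}
    (h : IsStarBall P.carrier x₀ r) (i : P.Edge) :
    0 < cross (P.vertex i - x₀) (P.vertex (i + 1) - P.vertex i) := by
  set b := P.vertex (i + 1) - P.vertex i with hb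
  have hb2 : 0 < b 0 ^ 2 + b 1 ^ 2 := by
    have := norm_pos_iff.2 (P.edgeVec_ne_zero i)
    rw [← hb] at this
    have h2 : 0 < ‖b‖ ^ 2 := by positivity
    simpa [EuclideanSpace.norm_sq_eq, Fin.sum_univ_two] using h2
  have hc : Continuous fun δ : ℝ => x₀ - δ • rotLeft b := by fun_prop
  have hev : ∀ᶠ δ in 𝓝[>] (0 : ℝ), x₀ - δ • rotLeft b ∈ Metric.ball x₀ r := by
    apply tendsto_nhdsWithin_of_tendsto_nhds (hc.tendsto 0)
    simpa using Metric.ball_mem_nhds x₀ h.pos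
  obtain ⟨δ, hδ, hδ0⟩ := (hev.and self_mem_nhdsWithin).exists
  have hδ0 : 0 < δ := hδ0
  have := h.cross_nonneg i hδ
  have e : cross (P.vertex i - (x₀ - δ • rotLeft b)) b
      = cross (P.vertex i - x₀) b - δ * (b 0 ^ 2 + b 1 ^ 2) := by
    simp [cross, rotLeft]; ring
  rw [← hb, e] at this
  nlinarith [mul_pos hδ0 hb2]

/-- The radius ρ·diam is positive because the diameter is that of the closure, which contains two
distinct vertices. -/
lemma Mesh.IsRegular.isStarBall {Ω : Set Plane} {T : Mesh Ω} {ρ : ℝ} (hρ : 0 < ρ)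
    (hT : T.IsRegular ρ) (K : Fin T.numElements) :
    ∃ x₀ r, IsStarBall (T.elt K).carrier x₀ r := by
  obtain ⟨x₀, h1, h2⟩ := hT.starShaped K
  refine ⟨x₀, _, mul_pos hρ ?_, h1, h2⟩
  rw [← Metric.diam_closure]
  have hb := (T.elt K).isBounded_carrier.closure
  have hv : ∀ i, (T.elt K).vertex i ∈ closure (T.elt K).carrier := fun i => by
    simpa [Polygon.edgePt] using frontier_subset_closure
      ((T.elt K).edgePt_mem_frontier i (t := 0) ⟨le_rfl, zero_le_one⟩)
  exact ((T.elt K).edgeLength_pos 0).trans_le (Metric.dist_le_diam_of_mem hb (hv _) (hv _))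

/-! ### Sectors and polar coordinates -/

/-- Star coordinates on the triangle spanned by `x₀` and edge `i`. -/
def sectorMap (P : Polygon) (x₀ : Plane) (i : P.Edge) (z : ℝ × ℝ) : Plane :=
  x₀ + z.1 • (P.edgePt i z.2 - x₀)

/-- The part of the triangle spanned by `x₀` and edge `i` with radial coordinate beyond `σ`. -/
def sector (P : Polygon) (x₀ : Plane) (i : P.Edge) (σ : ℝ) : Set Plane :=
  sectorMap P x₀ i '' (Ioo σ 1 ×ˢ Ioo 0 1)

lemma continuous_sectorMap (P : Polygon) (x₀ : Plane) (i : P.Edge) :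
    Continuous (sectorMap P x₀ i) := by
  unfold sectorMap Polygon.edgePt; fun_prop

lemma sector_subset {P : Polygon} {x₀ : Plane} {r : ℝ} (h : IsStarBall P.carrier x₀ r)
    (i : P.Edge) {σ : ℝ} (hσ : 0 ≤ σ) : sector P x₀ i σ ⊆ P.carrier := by
  rintro _ ⟨⟨s, t⟩, ⟨hs, ht⟩, rfl⟩
  exact h.mem_of_mem_frontier (P.edgePt_mem_frontier i (Ioo_subset_Icc_self ht))
    (hσ.trans hs.1.le) hs.2

lemma edgePt_injective (P : Polygon) (i : P.Edge) : Function.Injective (P.edgePt i) :=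
  fun _ _ h => smul_left_injective ℝ (P.edgeVec_ne_zero i) (add_left_cancel h)

lemma sectorMap_injOn {P : Polygon} {x₀ : Plane} {r : ℝ} (h : IsStarBall P.carrier x₀ r)
    (i : P.Edge) {σ : ℝ} (hσ : 0 ≤ σ) : InjOn (sectorMap P x₀ i) (Ioo σ 1 ×ˢ Ioo 0 1) := by
  rintro ⟨s, t⟩ ⟨hs, ht⟩ ⟨s', t'⟩ ⟨hs', ht'⟩ he
  obtain ⟨h1, h2⟩ := h.frontier_ray_unique P.isOpen_carrier
    (P.edgePt_mem_frontier i (Ioo_subset_Icc_self ht))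
    (P.edgePt_mem_frontier i (Ioo_subset_Icc_self ht')) ⟨hσ.trans_lt hs.1, hs.2⟩
    ⟨hσ.trans_lt hs'.1, hs'.2⟩ he
  exact Prod.ext h2 (edgePt_injective P i h1)

/-- A common point of two sectors would determine a single frontier point, lying in the open edge i
and in edge j, which simplicity of the polygon excludes. -/
lemma disjoint_sector {P : Polygon} {x₀ : Plane} {r : ℝ} (h : IsStarBall P.carrier x₀ r)
    {σ : ℝ} (hσ : 0 ≤ σ) : Pairwise fun i j => Disjoint (sector P x₀ i σ) (sector P x₀ j σ) := by
  intro i j hij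
  rw [Set.disjoint_left]
  rintro _ ⟨⟨s, t⟩, ⟨hs, ht⟩, rfl⟩ ⟨⟨s', t'⟩, ⟨hs', ht'⟩, he⟩
  obtain ⟨h1, -⟩ := h.frontier_ray_unique P.isOpen_carrier
    (P.edgePt_mem_frontier j (Ioo_subset_Icc_self ht'))
    (P.edgePt_mem_frontier i (Ioo_subset_Icc_self ht)) ⟨hσ.trans_lt hs'.1, hs'.2⟩
    ⟨hσ.trans_lt hs.1, hs.2⟩ he
  exact Set.disjoint_left.1 (P.simple i j hij) (P.edgePt_mem_openSegment i ht)
    (h1 ▸ P.edgePt_mem_segment j (Ioo_subset_Icc_self ht'))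

lemma measurableSet_sector {P : Polygon} {x₀ : Plane} {r : ℝ} (h : IsStarBall P.carrier x₀ r)
    (i : P.Edge) {σ : ℝ} (hσ : 0 ≤ σ) : MeasurableSet (sector P x₀ i σ) :=
  (measurableSet_Ioo.prod measurableSet_Ioo).image_of_continuousOn_injOn
    (continuous_sectorMap P x₀ i).continuousOn (sectorMap_injOn h i hσ)

lemma volume_segment (a b : Plane) : volume (segment ℝ a b) = 0 := by
  have hne : (affineSpan ℝ {a, b} : AffineSubspace ℝ Plane) ≠ ⊤ := by
    intro htop
    have h1 := congrArg AffineSubspace.direction htop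
    rw [direction_affineSpan, AffineSubspace.direction_top, vectorSpan_pair] at h1
    have h2 : Module.finrank ℝ (ℝ ∙ (a -ᵥ b)) ≤ 1 :=
      (finrank_span_le_card (R := ℝ) ({a -ᵥ b} : Set Plane)).trans_eq (by simp)
    have h3 := congrArg (fun S : Submodule ℝ Plane => Module.finrank ℝ S) h1
    simp only [finrank_top, finrank_euclideanSpace, Fintype.card_fin] at h3
    omega
  refine measure_mono_null ?_ (Measure.addHaar_affineSubspace volume _ hne)
  rw [← convexHull_pair]
  exact convexHull_subset_affineSpan _

lemma Polygon.volume_frontier (P : Polygon) : volume (frontier P.carrier) = 0 := by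
  rw [P.frontier_eq]
  exact measure_iUnion_null fun i => volume_segment _ _

/-- Every point other than x₀ lies on a ray to a frontier point; it is missed by the sectors only if
that point is a vertex, so the exceptional set is covered by finitely many segments from x₀. -/
lemma carrier_ae_eq_iUnion_sector {P : Polygon} {x₀ : Plane} {r : ℝ}
    (h : IsStarBall P.carrier x₀ r) :
    P.carrier =ᵐ[volume] ⋃ i, sector P x₀ i 0 := by
  refine (ae_eq_set.2 ⟨?_, ?_⟩)
  · refine measure_mono_null (t := ⋃ i, segment ℝ x₀ (P.vertex i)) ?_
      (measure_iUnion_null fun i => volume_segment _ _)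
    rintro x ⟨hx, hx'⟩
    by_cases hne : x = x₀
    · exact mem_iUnion.2 ⟨0, hne ▸ left_mem_segment ℝ _ _⟩
    obtain ⟨y, hy, s, hs, rfl⟩ := exists_frontier_ray P.isOpen_carrier P.isBounded_carrier hx hne
    rw [P.frontier_eq] at hy
    obtain ⟨i, hi⟩ := mem_iUnion.1 hy
    rw [segment_eq_image'] at hi
    obtain ⟨t, ht, rfl⟩ := hi
    have hv : ∀ v : Plane, x₀ + s • (v - x₀) ∈ segment ℝ x₀ v := fun v => by
      rw [segment_eq_image']; exact ⟨s, Ioo_subset_Icc_self hs, rfl⟩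
    rcases eq_or_lt_of_le ht.1 with h0 | h0
    · refine mem_iUnion.2 ⟨i, ?_⟩
      simpa [← h0] using hv (P.vertex i)
    rcases eq_or_lt_of_le ht.2 with h1 | h1
    · refine mem_iUnion.2 ⟨i + 1, ?_⟩
      simpa [h1] using hv (P.vertex (i + 1))
    · exact (hx' (mem_iUnion.2 ⟨i, ⟨(s, t), ⟨hs, h0, h1⟩, rfl⟩⟩)).elim
  · rw [Set.sdiff_eq_empty.2 (iUnion_subset fun i => sector_subset h i le_rfl), measure_empty]

lemma setIntegral_carrier_eq_sum {P : Polygon} {x₀ : Plane} {r : ℝ}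
    (h : IsStarBall P.carrier x₀ r) {f : Plane → ℝ} (hf : IntegrableOn f P.carrier) :
    ∫ x in P.carrier, f x = ∑ i, ∫ x in sector P x₀ i 0, f x := by
  rw [setIntegral_congr_set (carrier_ae_eq_iUnion_sector h)]
  exact integral_iUnion_fintype (fun i => measurableSet_sector h i le_rfl)
    (disjoint_sector h le_rfl) fun i => hf.mono_set (sector_subset h i le_rfl)

/-- The plane as a product, as a measurable equivalence. -/
def planeEquiv : ℝ × ℝ ≃ᵐ Plane :=
  (MeasurableEquiv.finTwoArrow (α := ℝ)).symm.trans (MeasurableEquiv.toLp 2 (Fin 2 → ℝ))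

lemma measurePreserving_planeEquiv : MeasurePreserving planeEquiv :=
  (PiLp.volume_preserving_toLp (Fin 2)).comp (volume_preserving_finTwoArrow ℝ).symm

lemma planeEquiv_apply (z : ℝ × ℝ) : planeEquiv z = !₂[z.1, z.2] := rfl

/-- Change of variables: the Jacobian of star coordinates is s times the cross product, which is
positive, so no absolute value remains. -/
lemma setIntegral_sector {P : Polygon} {x₀ : Plane} {r : ℝ} (h : IsStarBall P.carrier x₀ r)
    (i : P.Edge) {σ : ℝ} (hσ : 0 ≤ σ) (f : Plane → ℝ) :
    ∫ x in sector P x₀ i σ, f x =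
      cross (P.vertex i - x₀) (P.vertex (i + 1) - P.vertex i) *
        ∫ z in Ioo σ 1 ×ˢ Ioo (0 : ℝ) 1, z.1 * f (sectorMap P x₀ i z) := by
  set a := P.vertex i - x₀ with ha
  set b := P.vertex (i + 1) - P.vertex i with hb
  let Ψ : ℝ × ℝ → ℝ × ℝ := fun z =>
    (x₀ 0 + z.1 * (a 0 + z.2 * b 0), x₀ 1 + z.1 * (a 1 + z.2 * b 1))
  have hΨ : ∀ z, planeEquiv (Ψ z) = sectorMap P x₀ i z := by
    intro z
    rw [planeEquiv_apply]
    ext j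
    fin_cases j <;> simp [Ψ, sectorMap, Polygon.edgePt, ha, hb] <;> left <;> ring
  let Ψ' : ℝ × ℝ → ℝ × ℝ →L[ℝ] ℝ × ℝ := fun z =>
    LinearMap.toContinuousLinearMap (Matrix.toLin (Module.Basis.finTwoProd ℝ)
      (Module.Basis.finTwoProd ℝ) !![a 0 + z.2 * b 0, z.1 * b 0; a 1 + z.2 * b 1, z.1 * b 1])
  have hΨ' : ∀ z, HasFDerivAt Ψ (Ψ' z) z := by
    intro z
    have hg : ∀ c α β : ℝ, HasFDerivAt (fun z : ℝ × ℝ => c + z.1 * (α + z.2 * β))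
        (z.1 • (β • ContinuousLinearMap.snd ℝ ℝ ℝ) +
          (α + z.2 * β) • ContinuousLinearMap.fst ℝ ℝ ℝ) z := fun c α β =>
      ((hasFDerivAt_fst (p := z)).mul ((hasFDerivAt_snd.mul_const β).const_add α)).const_add c
    refine ((hg (x₀ 0) (a 0) (b 0)).prodMk (hg (x₀ 1) (a 1) (b 1))).congr_fderiv ?_
    ext <;> simp [Ψ', Matrix.toLin_finTwoProd_apply]
  have hdet : ∀ z, (Ψ' z).det = cross a b * z.1 := by
    intro z
    simp only [Ψ', LinearMap.det_toContinuousLinearMap, LinearMap.det_toLin,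
      Matrix.det_fin_two_of, cross]
    ring
  have him : sector P x₀ i σ = planeEquiv '' (Ψ '' (Ioo σ 1 ×ˢ Ioo 0 1)) := by
    rw [image_image, sector]; simp only [hΨ]
  have hinj : InjOn Ψ (Ioo σ 1 ×ˢ Ioo 0 1) := by
    intro z hz z' hz' he
    apply sectorMap_injOn h i hσ hz hz'
    rw [← hΨ, ← hΨ, he]
  rw [him, measurePreserving_planeEquiv.setIntegral_image_emb planeEquiv.measurableEmbedding,
    integral_image_eq_integral_abs_det_fderiv_smul volume
      (measurableSet_Ioo.prod measurableSet_Ioo) (fun z _ => (hΨ' z).hasFDerivWithinAt) hinj,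
    ← integral_const_mul]
  refine setIntegral_congr_fun (measurableSet_Ioo.prod measurableSet_Ioo) fun z hz => ?_
  have hz1 : 0 < z.1 := hσ.trans_lt hz.1.1
  simp only [hΨ, hdet, smul_eq_mul]
  rw [abs_of_pos (mul_pos (h.cross_pos i) hz1), mul_assoc]

lemma setIntegral_sector_of_continuous {P : Polygon} {x₀ : Plane} {r : ℝ}
    (h : IsStarBall P.carrier x₀ r) (i : P.Edge) {σ : ℝ} (hσ : 0 ≤ σ) (hσ1 : σ ≤ 1)
    {f : Plane → ℝ} (hf : Continuous f) :
    ∫ x in sector P x₀ i σ, f x =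
      cross (P.vertex i - x₀) (P.vertex (i + 1) - P.vertex i) *
        ∫ t in (0 : ℝ)..1, ∫ s in σ..1, s * f (sectorMap P x₀ i (s, t)) := by
  have hc : Continuous fun z : ℝ × ℝ => z.1 * f (sectorMap P x₀ i z) :=
    continuous_fst.mul (hf.comp (continuous_sectorMap P x₀ i))
  have hint : IntegrableOn (fun z : ℝ × ℝ => z.1 * f (sectorMap P x₀ i z))
      (Ioo σ 1 ×ˢ Ioo (0 : ℝ) 1) :=
    (hc.continuousOn.integrableOn_compact (isCompact_Icc.prod isCompact_Icc)).mono_set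
      (prod_mono Ioo_subset_Icc_self Ioo_subset_Icc_self)
  rw [setIntegral_sector h i hσ]
  congr 1
  rw [Measure.volume_eq_prod] at hint ⊢
  rw [← Measure.prod_restrict, integral_prod_symm _ (by rwa [Measure.prod_restrict]),
    intervalIntegral.integral_of_le zero_le_one, integral_Ioc_eq_integral_Ioo]
  congr 1 with t
  rw [intervalIntegral.integral_of_le hσ1, integral_Ioc_eq_integral_Ioo]

/-! ### The divergence theorem on star-shaped polygons -/

lemma fderiv_eq_sum (φ : Plane → ℝ) (x w : Plane) :
    fderiv ℝ φ x w = w 0 * partialD 0 φ x + w 1 * partialD 1 φ x := by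
  have : w = w 0 • EuclideanSpace.single 0 1 + w 1 • EuclideanSpace.single 1 1 := by
    ext j; fin_cases j <;> simp
  conv_lhs => rw [this]
  simp [partialD]

/-- The variables are swapped here: the edge parameter t comes first and the radial parameter s
second, to match the integration order of the divergence theorem on the square. -/
lemma hasFDerivAt_comp_sectorMap (P : Polygon) (x₀ : Plane) (i : P.Edge) {φ : Plane → ℝ}
    (hφ : ContDiff ℝ ∞ φ) (t s : ℝ) :
    ∃ L : ℝ × ℝ →L[ℝ] ℝ, HasFDerivAt (fun z : ℝ × ℝ => φ (sectorMap P x₀ i (z.2, z.1))) L (t, s) ∧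
      L (1, 0) = s * fderiv ℝ φ (sectorMap P x₀ i (s, t)) (P.vertex (i + 1) - P.vertex i) ∧
      L (0, 1) = fderiv ℝ φ (sectorMap P x₀ i (s, t)) (P.edgePt i t - x₀) := by
  have h1 : HasFDerivAt (fun z : ℝ × ℝ => P.edgePt i z.1 - x₀)
      ((ContinuousLinearMap.fst ℝ ℝ ℝ).smulRight (P.vertex (i + 1) - P.vertex i)) (t, s) :=
    ((hasFDerivAt_fst.smul_const _).const_add _).sub_const _
  have h2 := (((hasFDerivAt_snd (𝕜 := ℝ) (E := ℝ) (F := ℝ) (p := (t, s))).smul h1).const_add x₀)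
  have h3 : HasFDerivAt φ (fderiv ℝ φ (sectorMap P x₀ i (s, t))) (sectorMap P x₀ i (s, t)) :=
    (hφ.differentiable (by simp) _).hasFDerivAt
  refine ⟨_, HasFDerivAt.comp (t, s) h3 h2, ?_, ?_⟩
  · simp
  · simp

/-- In the coordinates (t, s) the integrand, Jacobian included, is the divergence of a field on the
unit square. The side s = 1 gives the edge term, the sides t = 0 and t = 1 give the two spokes from
x₀, and the side s = 0 contributes nothing because the s-component of the field has the factor s. -/
lemma integral_sector_partialD {P : Polygon} {x₀ : Plane} {r : ℝ}
    (h : IsStarBall P.carrier x₀ r) (i : P.Edge) {φ : Plane → ℝ} (hφ : ContDiff ℝ ∞ φ)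
    (j : Fin 2) :
    ∫ x in sector P x₀ i 0, partialD j φ x =
      -rotLeft (P.vertex (i + 1) - P.vertex i) j * (∫ t in (0 : ℝ)..1, φ (P.edgePt i t)) +
      (rotLeft (P.vertex (i + 1) - x₀) j *
        (∫ s in (0 : ℝ)..1, φ (x₀ + s • (P.vertex (i + 1) - x₀))) -
      rotLeft (P.vertex i - x₀) j * ∫ s in (0 : ℝ)..1, φ (x₀ + s • (P.vertex i - x₀))) := by
  rw [setIntegral_sector_of_continuous h i le_rfl zero_le_one (continuous_partialD hφ j)]
  set a := P.vertex i - x₀ with ha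
  set b := P.vertex (i + 1) - P.vertex i with hb
  have hab : P.vertex (i + 1) - x₀ = a + b := by rw [ha, hb]; abel
  choose L hL hL1 hL2 using hasFDerivAt_comp_sectorMap P x₀ i hφ
  set u : ℝ × ℝ → ℝ := fun z => φ (sectorMap P x₀ i (z.2, z.1)) with hu
  -- The two components are the Piola transform of φ times the j-th unit vector; in their
  -- divergence, computed in `hval`, the terms containing φ undifferentiated cancel.
  have hf : ∀ z : ℝ × ℝ, HasFDerivAt (fun z : ℝ × ℝ => (z.1 * rotLeft b j + rotLeft a j) * u z)
      ((z.1 * rotLeft b j + rotLeft a j) • L z.1 z.2 +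
        u z • (rotLeft b j • ContinuousLinearMap.fst ℝ ℝ ℝ)) z := fun z =>
    ((hasFDerivAt_fst.mul_const (rotLeft b j)).add_const (rotLeft a j)).mul (hL z.1 z.2)
  have hg : ∀ z : ℝ × ℝ, HasFDerivAt (fun z : ℝ × ℝ => z.2 * -rotLeft b j * u z)
      ((z.2 * -rotLeft b j) • L z.1 z.2 +
        u z • (-rotLeft b j • ContinuousLinearMap.snd ℝ ℝ ℝ)) z := fun z =>
    (hasFDerivAt_snd.mul_const (-rotLeft b j)).mul (hL z.1 z.2)
  have hval : ∀ t s : ℝ, ((t * rotLeft b j + rotLeft a j) • L t s +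
        u (t, s) • (rotLeft b j • ContinuousLinearMap.fst ℝ ℝ ℝ)) (1, 0) +
      ((s * -rotLeft b j) • L t s +
        u (t, s) • (-rotLeft b j • ContinuousLinearMap.snd ℝ ℝ ℝ)) (0, 1) =
      cross a b * (s * partialD j φ (sectorMap P x₀ i (s, t))) := by
    intro t s
    have he : P.edgePt i t - x₀ = a + t • b := by rw [Polygon.edgePt, ha, hb]; abel
    simp only [_root_.add_apply, _root_.smul_apply, ContinuousLinearMap.coe_fst',
      ContinuousLinearMap.coe_snd', smul_eq_mul, hL1, hL2, he, ← hb, map_add, map_smul, fderiv_eq_sum]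
    fin_cases j <;> simp [rotLeft, cross] <;> ring
  have hcont : Continuous fun z : ℝ × ℝ =>
      cross a b * (z.2 * partialD j φ (sectorMap P x₀ i (z.2, z.1))) := by
    have := (continuous_partialD hφ j).comp
      ((continuous_sectorMap P x₀ i).comp (continuous_snd.prodMk continuous_fst))
    exact continuous_const.mul (continuous_snd.mul this)
  have key := integral2_divergence_prod_of_hasFDerivAt_off_countable
    (fun z : ℝ × ℝ => (z.1 * rotLeft b j + rotLeft a j) * u z)
    (fun z : ℝ × ℝ => z.2 * -rotLeft b j * u z) _ _ 0 0 1 1 ∅ countable_empty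
    (fun z _ => (hf z).continuousAt.continuousWithinAt)
    (fun z _ => (hg z).continuousAt.continuousWithinAt) (fun z _ => hf z) (fun z _ => hg z)
    (by
      refine (ContinuousOn.integrableOn_compact (isCompact_uIcc.prod isCompact_uIcc) ?_)
      refine hcont.continuousOn.congr fun z _ => ?_
      exact hval z.1 z.2)
  simp only [hval] at key
  have e0 : ∀ t, u (t, 1) = φ (P.edgePt i t) := fun t => by simp [hu, sectorMap]
  have e1 : ∀ s, u (1, s) = φ (x₀ + s • (a + b)) := fun s => by
    simp [hu, sectorMap, Polygon.edgePt, ha, hb]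
  have e2 : ∀ s, u (0, s) = φ (x₀ + s • a) := fun s => by
    simp [hu, sectorMap, Polygon.edgePt, ha]
  simp only [e0, e1, e2, one_mul, zero_mul, zero_add, intervalIntegral.integral_zero, sub_zero,
    intervalIntegral.integral_const_mul] at key
  rw [key, hab]
  have hr : rotLeft (a + b) j = rotLeft b j + rotLeft a j := by
    fin_cases j
    · simp [rotLeft]
    · simp [rotLeft, add_comm]
  rw [hr]
  ring

lemma Polygon.edgeLength_mul_normal (P : Polygon) (i : P.Edge) (j : Fin 2) :
    P.edgeLength i * P.normal i j = -rotLeft (P.vertex (i + 1) - P.vertex i) j := by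
  have := (P.edgeLength_pos i).ne'
  simp only [Polygon.normal, PiLp.neg_apply, PiLp.smul_apply, smul_eq_mul]
  field_simp

/-- Neighbouring sectors share a spoke with opposite signs, so in the sum over the cyclically
ordered edges only the edge terms survive. -/
theorem integral_partialD_eq_sum_edgeIntegral {P : Polygon} {x₀ : Plane} {r : ℝ}
    (h : IsStarBall P.carrier x₀ r) {φ : Plane → ℝ} (hφ : ContDiff ℝ ∞ φ) (j : Fin 2) :
    ∫ x in P.carrier, partialD j φ x =
      ∑ i, P.edgeIntegral i fun t => φ (P.edgePt i t) * P.normal i j := by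
  have hint : IntegrableOn (partialD j φ) P.carrier :=
    ((continuous_partialD hφ j).continuousOn.integrableOn_compact
      P.isBounded_carrier.isCompact_closure).mono_set subset_closure
  rw [setIntegral_carrier_eq_sum h hint]
  simp only [integral_sector_partialD h _ hφ j, Finset.sum_add_distrib, Finset.sum_sub_distrib]
  have hcyc := Equiv.sum_comp (Equiv.addRight (1 : P.Edge)) fun i => rotLeft (P.vertex i - x₀) j *
    ∫ s in (0 : ℝ)..1, φ (x₀ + s • (P.vertex i - x₀))
  simp only [Equiv.coe_addRight] at hcyc
  rw [hcyc, sub_self, add_zero]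
  refine Finset.sum_congr rfl fun i _ => ?_
  rw [Polygon.edgeIntegral, intervalIntegral.integral_mul_const, ← P.edgeLength_mul_normal]
  ring

/-! ### Estimates near the boundary -/

/-- Integrate the derivative of s(s - σ)u²: the weight vanishes at σ and leaves (1 - σ)u(1)² at 1.
Young's inequality absorbs the mixed term 2s(s - σ)uu' into su²/2 and 2s(s - σ)²u'². The factor s is
the Jacobian of star coordinates, and the power (1 - σ)² is what later balances the gradient of the
cutoff. -/
lemma integral_radial_sq_le {u u' : ℝ → ℝ} (hu : ∀ s, HasDerivAt u (u' s) s)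
    (hu' : Continuous u') {σ : ℝ} (hσ : 0 ≤ σ) (hσ1 : σ ≤ 1) :
    ∫ s in σ..1, s * u s ^ 2 ≤
      2 * (1 - σ) * u 1 ^ 2 + 4 * (1 - σ) ^ 2 * ∫ s in σ..1, s * u' s ^ 2 := by
  have hcu : Continuous u := continuous_iff_continuousAt.2 fun s => (hu s).continuousAt
  have hF : ∀ s, HasDerivAt (fun s => s * (s - σ) * u s ^ 2)
      ((1 * (s - σ) + s * 1) * u s ^ 2 + s * (s - σ) * (2 * u s ^ 1 * u' s)) s := fun s => by
    have := ((hasDerivAt_id' s).fun_mul ((hasDerivAt_id' s).sub_const σ)).fun_mul ((hu s).fun_pow 2)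
    simpa using this
  have hFc : Continuous fun s => (1 * (s - σ) + s * 1) * u s ^ 2 +
      s * (s - σ) * (2 * u s ^ 1 * u' s) := by fun_prop
  have h1 := intervalIntegral.integral_eq_sub_of_hasDerivAt (fun s _ => hF s)
    (hFc.intervalIntegrable σ 1)
  have hG : Continuous fun s => 1 / 2 * (s * u s ^ 2) - 2 * (1 - σ) ^ 2 * (s * u' s ^ 2) := by
    fun_prop
  have h2 := intervalIntegral.integral_mono_on (μ := volume) hσ1 (hG.intervalIntegrable σ 1)
    (hFc.intervalIntegrable σ 1) (fun s hs => by
      have hs0 : 0 ≤ s := hσ.trans hs.1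
      have ha : 0 ≤ s - σ := by linarith [hs.1]
      have hb : (s - σ) ^ 2 ≤ (1 - σ) ^ 2 := by
        apply pow_le_pow_left₀ ha; linarith [hs.2]
      have hc := mul_le_mul_of_nonneg_right hb (mul_nonneg hs0 (sq_nonneg (u' s)))
      have hd := mul_nonneg hs0 (sq_nonneg (u s + 2 * (s - σ) * u' s))
      have he := mul_nonneg ha (sq_nonneg (u s))
      nlinarith)
  rw [h1, intervalIntegral.integral_sub (Continuous.intervalIntegrable (by fun_prop) _ _)
    (Continuous.intervalIntegrable (by fun_prop) _ _), intervalIntegral.integral_const_mul,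
    intervalIntegral.integral_const_mul] at h2
  simp only [one_mul, sub_self, mul_zero, zero_mul, sub_zero] at h2
  linarith

/-- The radial estimate holds on each ray, where the derivative is ∇φ·(y - x₀) with y on the edge,
hence at most d|∇φ| by Cauchy–Schwarz. Integrating over the edge parameter gives the claim. -/
lemma integral_sector_sq_le {P : Polygon} {x₀ : Plane} {r : ℝ} (h : IsStarBall P.carrier x₀ r)
    (i : P.Edge) {σ d : ℝ} (hσ : 0 ≤ σ) (hσ1 : σ ≤ 1)
    (hd : ∀ y ∈ closure P.carrier, ‖y - x₀‖ ≤ d) {φ : Plane → ℝ} (hφ : ContDiff ℝ ∞ φ) :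
    ∫ x in sector P x₀ i σ, φ x ^ 2 ≤
      2 * (1 - σ) * (cross (P.vertex i - x₀) (P.vertex (i + 1) - P.vertex i) *
        ∫ t in (0 : ℝ)..1, φ (P.edgePt i t) ^ 2) +
      4 * (1 - σ) ^ 2 * d ^ 2 *
        ∫ x in sector P x₀ i σ, (partialD 0 φ x ^ 2 + partialD 1 φ x ^ 2) := by
  have hG : Continuous fun x => partialD 0 φ x ^ 2 + partialD 1 φ x ^ 2 :=
    ((continuous_partialD hφ 0).pow 2).add ((continuous_partialD hφ 1).pow 2)
  have hφ2 : Continuous fun x => φ x ^ 2 := hφ.continuous.pow 2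
  rw [setIntegral_sector_of_continuous h i hσ hσ1 hφ2,
    setIntegral_sector_of_continuous h i hσ hσ1 hG]
  set D := cross (P.vertex i - x₀) (P.vertex (i + 1) - P.vertex i) with hD
  have hDpos : 0 < D := h.cross_pos i
  have hsm : Continuous fun z : ℝ × ℝ => sectorMap P x₀ i (z.2, z.1) :=
    (continuous_sectorMap P x₀ i).comp (continuous_snd.prodMk continuous_fst)
  have hin : ∀ t ∈ Icc (0 : ℝ) 1, ∫ s in σ..1, s * φ (sectorMap P x₀ i (s, t)) ^ 2 ≤
      2 * (1 - σ) * φ (P.edgePt i t) ^ 2 + 4 * (1 - σ) ^ 2 * d ^ 2 *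
        ∫ s in σ..1, s * (partialD 0 φ (sectorMap P x₀ i (s, t)) ^ 2 +
          partialD 1 φ (sectorMap P x₀ i (s, t)) ^ 2) := by
    intro t ht
    set w := P.edgePt i t - x₀ with hw
    have hwd : ‖w‖ ≤ d := hd _ (frontier_subset_closure (P.edgePt_mem_frontier i ht))
    have hu : ∀ s, HasDerivAt (fun s => φ (sectorMap P x₀ i (s, t)))
        (fderiv ℝ φ (sectorMap P x₀ i (s, t)) w) s := fun s => by
      have h1 : HasDerivAt (fun s : ℝ => sectorMap P x₀ i (s, t)) w s := by
        simpa [sectorMap] using ((hasDerivAt_id s).smul_const w).const_add x₀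
      exact ((hφ.differentiable (by simp) _).hasFDerivAt).comp_hasDerivAt s h1
    have hsm' : Continuous fun s : ℝ => sectorMap P x₀ i (s, t) :=
      (continuous_sectorMap P x₀ i).comp (continuous_id.prodMk continuous_const)
    have hu' : Continuous fun s => fderiv ℝ φ (sectorMap P x₀ i (s, t)) w :=
      ((hφ.continuous_fderiv (by simp)).comp hsm').clm_apply continuous_const
    have h1 := integral_radial_sq_le hu hu' hσ hσ1
    have e1 : sectorMap P x₀ i (1, t) = P.edgePt i t := by simp [sectorMap]
    rw [e1] at h1
    refine h1.trans (add_le_add_right ?_ _)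
    rw [mul_assoc (4 * (1 - σ) ^ 2), ← intervalIntegral.integral_const_mul (d ^ 2)]
    refine mul_le_mul_of_nonneg_left ?_ (by positivity)
    refine intervalIntegral.integral_mono_on hσ1
      (Continuous.intervalIntegrable (continuous_id.mul (hu'.pow 2)) _ _)
      (Continuous.intervalIntegrable
        (continuous_const.mul (continuous_id.mul (hG.comp hsm'))) _ _) fun s hs => ?_
    have hs0 : 0 ≤ s := hσ.trans hs.1
    rw [fderiv_eq_sum, mul_left_comm]
    refine mul_le_mul_of_nonneg_left ?_ hs0
    have hw2 : w 0 ^ 2 + w 1 ^ 2 ≤ d ^ 2 := by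
      have h2 := pow_le_pow_left₀ (norm_nonneg w) hwd 2
      simpa [EuclideanSpace.norm_sq_eq, Fin.sum_univ_two] using h2
    set p := partialD 0 φ (sectorMap P x₀ i (s, t))
    set q := partialD 1 φ (sectorMap P x₀ i (s, t))
    have := mul_le_mul_of_nonneg_right hw2 (add_nonneg (sq_nonneg p) (sq_nonneg q))
    nlinarith [sq_nonneg (w 0 * q - w 1 * p)]
  have hp : ∀ {f : Plane → ℝ}, Continuous f →
      Continuous fun t => ∫ s in σ..1, s * f (sectorMap P x₀ i (s, t)) := fun hf => by
    apply intervalIntegral.continuous_parametric_intervalIntegral_of_continuous'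
    exact continuous_snd.mul (hf.comp hsm)
  have hA : Continuous fun t => 2 * (1 - σ) * φ (P.edgePt i t) ^ 2 :=
    continuous_const.mul (hφ2.comp (continuous_edgePt P i))
  have hB : Continuous fun t => 4 * (1 - σ) ^ 2 * d ^ 2 *
      ∫ s in σ..1, s * (partialD 0 φ (sectorMap P x₀ i (s, t)) ^ 2 +
        partialD 1 φ (sectorMap P x₀ i (s, t)) ^ 2) := continuous_const.mul (hp hG)
  have hint := intervalIntegral.integral_mono_on (μ := volume) zero_le_one
    ((hp hφ2).intervalIntegrable 0 1)
    ((hA.intervalIntegrable 0 1).add (hB.intervalIntegrable 0 1)) hin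
  rw [intervalIntegral.integral_add (hA.intervalIntegrable 0 1) (hB.intervalIntegrable 0 1),
    intervalIntegral.integral_const_mul, intervalIntegral.integral_const_mul] at hint
  exact (mul_le_mul_of_nonneg_left hint hDpos.le).trans_eq (by ring)

/-! ### Limits in `L²` -/

lemma tendsto_integral_mul {X : Type*} [MeasurableSpace X] {ν : Measure X} {a : X → ℝ}
    {b : ℕ → X → ℝ} {b' : X → ℝ} (ha : MemLp a 2 ν) (hb : ∀ k, MemLp (b k) 2 ν)
    (hb' : MemLp b' 2 ν) (h : Tendsto (fun k => eLpNorm (fun x => b k x - b' x) 2 ν) atTop (𝓝 0)) :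
    Tendsto (fun k => ∫ x, a x * b k x ∂ν) atTop (𝓝 (∫ x, a x * b' x ∂ν)) := by
  have h1 := (Lp.tendsto_Lp_iff_tendsto_eLpNorm'' b hb b' hb').2 h
  have e : ∀ {c : X → ℝ} (hc : MemLp c 2 ν), inner ℝ (ha.toLp a) (hc.toLp c) =
      ∫ x, a x * c x ∂ν := by
    intro c hc
    rw [L2.inner_def]
    apply integral_congr_ae
    filter_upwards [ha.coeFn_toLp, hc.coeFn_toLp] with x hx hx'
    rw [hx, hx']
    simp [mul_comm]
  have h2 := (tendsto_const_nhds (x := ha.toLp a)).inner (𝕜 := ℝ) h1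
  simpa only [e] using h2

lemma tendsto_integral_sq {X : Type*} [MeasurableSpace X] {ν : Measure X}
    {b : ℕ → X → ℝ} {b' : X → ℝ} (hb : ∀ k, MemLp (b k) 2 ν)
    (hb' : MemLp b' 2 ν) (h : Tendsto (fun k => eLpNorm (fun x => b k x - b' x) 2 ν) atTop (𝓝 0)) :
    Tendsto (fun k => ∫ x, b k x ^ 2 ∂ν) atTop (𝓝 (∫ x, b' x ^ 2 ∂ν)) := by
  have h1 := (Lp.tendsto_Lp_iff_tendsto_eLpNorm'' b hb b' hb').2 h
  have e : ∀ {c : X → ℝ} (hc : MemLp c 2 ν), inner ℝ (hc.toLp c) (hc.toLp c) =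
      ∫ x, c x ^ 2 ∂ν := by
    intro c hc
    rw [L2.inner_def]
    apply integral_congr_ae
    filter_upwards [hc.coeFn_toLp] with x hx
    rw [hx]
    simp
  have h2 := h1.inner (𝕜 := ℝ) h1
  simpa only [e] using h2

lemma tendsto_eLpNorm_mono_set {D S : Set Plane} (hS : S ⊆ D) {b : ℕ → Plane → ℝ} {b' : Plane → ℝ}
    (h : Tendsto (fun k => eLpNorm (fun x => b k x - b' x) 2 (volume.restrict D)) atTop (𝓝 0)) :
    Tendsto (fun k => eLpNorm (fun x => b k x - b' x) 2 (volume.restrict S)) atTop (𝓝 0) :=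
  tendsto_of_tendsto_of_tendsto_of_le_of_le tendsto_const_nhds h (fun _ => zero_le)
    fun _ => eLpNorm_mono_measure _ (Measure.restrict_mono hS le_rfl)

lemma MemLp.mul_bounded {X : Type*} [MeasurableSpace X] {ν : Measure X} {a c : X → ℝ}
    (ha : MemLp a 2 ν) (hc : AEStronglyMeasurable c ν) (C : ℝ) (hC : ∀ x, ‖c x‖ ≤ C) :
    MemLp (fun x => a x * c x) 2 ν :=
  MemLp.mul' (memLp_top_of_bound hc C (Eventually.of_forall hC)) ha

/-! ### Smooth cutoff functions -/

lemma lipschitzWith_cutoff (S : Set Plane) {ε : ℝ} (hε : 0 < ε) (x y : Plane) :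
    |max 0 (min 1 (Metric.infDist x S / ε - 1)) - max 0 (min 1 (Metric.infDist y S / ε - 1))| ≤
      ε⁻¹ * ‖x - y‖ := by
  have h1 : ∀ a b : ℝ, |max 0 (min 1 a) - max 0 (min 1 b)| ≤ |a - b| := fun a b =>
    (abs_max_sub_max_le_max _ _ _ _).trans (by
      rw [sub_self, abs_zero, max_eq_right (abs_nonneg _)]
      refine (abs_min_sub_min_le_max _ _ _ _).trans ?_
      rw [sub_self, abs_zero, max_eq_right (abs_nonneg _)])
  refine (h1 _ _).trans ?_
  have h2 := (Metric.lipschitz_infDist_pt S).dist_le_mul x y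
  rw [Real.dist_eq, NNReal.coe_one, one_mul, dist_eq_norm] at h2
  rw [sub_sub_sub_cancel_right, ← sub_div, abs_div, abs_of_pos hε, div_eq_inv_mul]
  exact mul_le_mul_of_nonneg_left h2 (inv_nonneg.2 hε.le)

open scoped Convolution in
-- With δ the distance to the complement, δ/ε - 1 clamped to [0, 1] is ε⁻¹-Lipschitz, vanishes for δ
-- ≤ ε and equals 1 for δ ≥ 2ε. Convolution with a probability density keeps the bound and the
-- Lipschitz constant, which controls the derivatives.
theorem exists_cutoff {S : Set Plane} (hb : Bornology.IsBounded S) {ε : ℝ} (hε : 0 < ε) :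
    ∃ χ : Plane → ℝ, IsTest S χ ∧ (∀ x, |χ x| ≤ 1) ∧ (∀ j x, |partialD j χ x| ≤ ε⁻¹) ∧
      (∀ x, 3 * ε ≤ Metric.infDist x Sᶜ → χ x = 1 ∧ ∀ j, partialD j χ x = 0) := by
  set δ : Plane → ℝ := fun x => Metric.infDist x Sᶜ with hδ
  have hδc : Continuous δ := Metric.continuous_infDist_pt _
  have hδd : ∀ x y, δ x ≤ δ y + dist x y := fun x y => Metric.infDist_le_infDist_add_dist
  set f : Plane → ℝ := fun x => max 0 (min 1 (δ x / ε - 1)) with hf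
  have hfc : Continuous f := by fun_prop
  have hf1 : ∀ x, |f x| ≤ 1 := fun x => by
    rw [abs_of_nonneg (le_max_left _ _)]
    exact max_le zero_le_one (min_le_left _ _)
  have hflip := lipschitzWith_cutoff Sᶜ hε
  -- Mollifying at radius ε/2 moves the thresholds ε and 2ε to ε/2 and 5ε/2; the first keeps the
  -- support inside S.
  let η : ContDiffBump (0 : Plane) := ⟨ε / 4, ε / 2, by positivity, by linarith⟩
  set χ : Plane → ℝ := η.normed volume ⋆[ContinuousLinearMap.lsmul ℝ ℝ, volume] f with hχ
  have hχs : ContDiff ℝ ∞ χ := η.hasCompactSupport_normed.contDiff_convolution_left _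
    η.contDiff_normed hfc.locallyIntegrable
  have hdef : ∀ x, χ x = ∫ t, η.normed volume t * f (x - t) := fun x => rfl
  have hηi : Integrable (η.normed volume) := η.integrable_normed
  have hint : ∀ x, Integrable fun t => η.normed volume t * f (x - t) := fun x => by
    refine hηi.mul_bdd (c := 1) ((hfc.comp (by fun_prop)).aestronglyMeasurable)
      (Eventually.of_forall fun t => hf1 _)
  have hbd : ∀ (F : Plane → ℝ) (C : ℝ), (∀ t, |F t| ≤ C) →
      |∫ t, η.normed volume t * F t| ≤ C := by
    intro F C hF
    have h1 := norm_integral_le_of_norm_le (hηi.mul_const C)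
      (f := fun t => η.normed volume t * F t) (Eventually.of_forall fun t => by
        rw [norm_mul, Real.norm_of_nonneg (η.nonneg_normed t)]
        exact mul_le_mul_of_nonneg_left (hF t) (η.nonneg_normed t))
    rwa [integral_mul_const, η.integral_normed, one_mul] at h1
  have hlip : LipschitzWith (ε⁻¹).toNNReal χ := by
    refine LipschitzWith.of_dist_le_mul fun x y => ?_
    rw [Real.dist_eq, hdef, hdef, ← integral_sub (hint x) (hint y),
      Real.coe_toNNReal _ (inv_nonneg.2 hε.le), dist_eq_norm]
    simp only [← mul_sub]
    refine hbd _ _ fun t => ?_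
    have := hflip (x - t) (y - t)
    rwa [sub_sub_sub_cancel_right] at this
  have hone : ∀ x, 5 / 2 * ε ≤ δ x → χ x = 1 := by
    intro x hx
    have hx1 : ∀ y ∈ Metric.ball x η.rOut, f y = 1 := fun y hy => by
      have h1 := hδd x y
      have h2 : dist y x < ε / 2 := hy
      rw [dist_comm] at h2
      have h3 : 2 ≤ δ y / ε := by rw [le_div_iff₀ hε]; linarith
      simp only [hf]
      rw [min_eq_left (by linarith), max_eq_right zero_le_one]
    have hxx := hx1 x (Metric.mem_ball_self η.rOut_pos)
    rw [hχ, η.normed_convolution_eq_right fun y hy => (hx1 y hy).trans hxx.symm, hxx]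
  have hzero : ∀ x, δ x ≤ ε / 2 → χ x = 0 := by
    intro x hx
    have hx1 : ∀ y ∈ Metric.ball x η.rOut, f y = 0 := fun y hy => by
      have h1 := hδd y x
      have h2 : dist y x < ε / 2 := hy
      have h3 : δ y / ε ≤ 1 := by rw [div_le_one hε]; linarith
      simp only [hf]
      exact max_eq_left ((min_le_right _ _).trans (by linarith))
    have hxx := hx1 x (Metric.mem_ball_self η.rOut_pos)
    rw [hχ, η.normed_convolution_eq_right fun y hy => (hx1 y hy).trans hxx.symm, hxx]
  have hsupp : tsupport χ ⊆ S := by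
    have h1 : tsupport χ ⊆ {x | ε / 2 ≤ δ x} :=
      closure_minimal (fun x hx => le_of_not_ge fun h => hx (hzero x h))
        (isClosed_le continuous_const hδc)
    intro x hx
    by_contra hxS
    have h2 : ε / 2 ≤ δ x := h1 hx
    rw [hδ] at h2
    simp only [Metric.infDist_zero_of_mem (mem_compl hxS)] at h2
    linarith
  refine ⟨χ, ⟨hχs, ?_, hsupp⟩, fun x => hbd _ _ fun t => hf1 _, fun j x => ?_, fun x hx => ?_⟩
  · exact hb.isCompact_closure.of_isClosed_subset (isClosed_tsupport χ)
      (hsupp.trans subset_closure)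
  · have h1 := norm_fderiv_le_of_lipschitz ℝ hlip (x₀ := x)
    rw [Real.coe_toNNReal _ (inv_nonneg.2 hε.le)] at h1
    have h2 := (fderiv ℝ χ x).le_of_opNorm_le h1 (EuclideanSpace.single j 1)
    simpa [partialD] using h2
  · have hx' : 3 * ε ≤ δ x := hx
    refine ⟨hone x (by linarith), fun j => ?_⟩
    -- The margin between 5ε/2 and 3ε makes χ equal to 1 in a whole neighbourhood, so its derivative
    -- vanishes too.
    have hev : χ =ᶠ[𝓝 x] fun _ => 1 := by
      filter_upwards [hδc.continuousAt.eventually (lt_mem_nhds (show 5 / 2 * ε < δ x by linarith))]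
        with y hy using hone y (le_of_lt hy)
    rw [partialD, hev.fderiv_eq]
    simp

/-! ### Functions with vanishing trace -/

lemma integrable_mul_mul {D : Set Plane} (v w : L2 D) {c : Plane → ℝ}
    (hc : Continuous c) (C : ℝ) (hC : ∀ x, ‖c x‖ ≤ C) :
    Integrable (fun x => v x * c x * w x) (volume.restrict D) :=
  (MemLp.mul_bounded (Lp.memLp v) hc.aestronglyMeasurable C hC).integrable_mul (Lp.memLp w)

/-- Limit of `integral_sector_sq_le` along the approximating smooth functions: the edge term
disappears because their boundary values tend to zero. -/
lemma integral_sector_sq_le_of_trace_zero {P : Polygon} {x₀ : Plane} {r : ℝ}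
    (h : IsStarBall P.carrier x₀ r) {d : ℝ} (hd : ∀ y ∈ closure P.carrier, ‖y - x₀‖ ≤ d)
    {w : L2 P.carrier} {g : Fin 2 → L2 P.carrier} {φ : ℕ → Plane → ℝ}
    (hφ : ∀ k, ContDiff ℝ ∞ (φ k)) (hw : TendstoH1 P.carrier φ w g)
    (ht : ∀ i, Tendsto (fun k => eLpNorm (fun t => φ k (P.edgePt i t) - 0) 2
      (volume.restrict (Icc (0 : ℝ) 1))) atTop (𝓝 0)) (i : P.Edge) {σ : ℝ} (hσ : 0 ≤ σ)
    (hσ1 : σ ≤ 1) :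
    ∫ x in sector P x₀ i σ, w x ^ 2 ≤
      4 * (1 - σ) ^ 2 * d ^ 2 * ∫ x in sector P x₀ i σ, (g 0 x ^ 2 + g 1 x ^ 2) := by
  have hS := sector_subset h i hσ
  have hb := P.isBounded_carrier.subset hS
  have hm : ∀ u : L2 P.carrier, MemLp u 2 (volume.restrict (sector P x₀ i σ)) := fun u =>
    (Lp.memLp u).mono_measure (Measure.restrict_mono hS le_rfl)
  have l1 := tendsto_integral_sq (fun k => memLp_bounded (hφ k).continuous hb) (hm w)
    (tendsto_eLpNorm_mono_set hS hw.1)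
  have l2 := fun j => tendsto_integral_sq
    (fun k => memLp_bounded (continuous_partialD (hφ k) j) hb) (hm (g j))
    (tendsto_eLpNorm_mono_set hS (hw.2 j))
  have l3 := tendsto_integral_sq (ν := volume.restrict (Icc (0 : ℝ) 1))
    (b := fun k t => φ k (P.edgePt i t)) (b' := fun _ => 0) (fun k => by
      obtain ⟨C, hC⟩ := isCompact_Icc.exists_bound_of_continuousOn (s := Icc (0 : ℝ) 1)
        ((hφ k).continuous.comp (continuous_edgePt P i)).continuousOn
      exact MemLp.of_bound ((hφ k).continuous.comp (continuous_edgePt P i)).aestronglyMeasurable C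
        ((ae_restrict_iff' measurableSet_Icc).2 (Eventually.of_forall hC)))
    (MemLp.zero') (ht i)
  have l4 := ((l3.const_mul (cross (P.vertex i - x₀) (P.vertex (i + 1) - P.vertex i))).const_mul
    (2 * (1 - σ))).add (((l2 0).add (l2 1)).const_mul (4 * (1 - σ) ^ 2 * d ^ 2))
  rw [integral_add (hm (g 0)).integrable_sq (hm (g 1)).integrable_sq]
  have l5 := le_of_tendsto_of_tendsto' l1 l4 fun k => by
    have := integral_sector_sq_le h i hσ hσ1 hd (hφ k)
    rw [integral_add (memLp_bounded (continuous_partialD (hφ k) 0) hb).integrable_sq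
      (memLp_bounded (continuous_partialD (hφ k) 1) hb).integrable_sq,
      intervalIntegral.integral_of_le zero_le_one, ← integral_Icc_eq_integral_Ioc] at this
    exact this
  simpa using l5

/-- The weak form of the equation `Δ w = q` tested with a cutoff of `w`. -/
lemma weak_identity_cutoff {D : Set Plane} (hD : Bornology.IsBounded D)
    {w : L2 D} {g : Fin 2 → L2 D} {φ : ℕ → Plane → ℝ}
    (hg : HasWeakGradient D w g) (hφ : ∀ k, ContDiff ℝ ∞ (φ k)) (hw : TendstoH1 D φ w g)
    {q : MvPolynomial (Fin 2) ℝ} (hq : HasWeakLaplacian D w (evalP q)) {χ : Plane → ℝ}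
    (hχ : IsTest D χ) {C : ℝ} (hC : ∀ x, ‖χ x‖ ≤ C) {C' : ℝ} (hC' : ∀ j x, ‖partialD j χ x‖ ≤ C') :
    (∑ j, ∫ x in D, g j x * χ x * g j x) + ∑ j, ∫ x in D, g j x * partialD j χ x * w x =
      -∫ x in D, evalP q x * χ x * w x := by
  have hχc := hχ.contDiff.continuous
  have hm : ∀ k, MemLp (φ k) 2 (volume.restrict D) := fun k => memLp_bounded (hφ k).continuous hD
  have hdm : ∀ j k, MemLp (partialD j (φ k)) 2 (volume.restrict D) := fun j k =>
    memLp_bounded (continuous_partialD (hφ k) j) hD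
  have m1 : ∀ j, MemLp (fun x => g j x * χ x) 2 (volume.restrict D) := fun j =>
    MemLp.mul_bounded (Lp.memLp (g j)) hχc.aestronglyMeasurable C hC
  have m2 : ∀ j, MemLp (fun x => g j x * partialD j χ x) 2 (volume.restrict D) := fun j =>
    MemLp.mul_bounded (Lp.memLp (g j)) (continuous_partialD hχ.contDiff j).aestronglyMeasurable C'
      (hC' j)
  have m3 : MemLp (fun x => evalP q x * χ x) 2 (volume.restrict D) :=
    MemLp.mul_bounded (memLp_bounded (contDiff_evalP q).continuous hD)
      hχc.aestronglyMeasurable C hC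
  have l1 := tendsto_finsetSum (Finset.univ : Finset (Fin 2)) fun j _ =>
    tendsto_integral_mul (m1 j) (hdm j) (Lp.memLp (g j)) (hw.2 j)
  have l2 := tendsto_finsetSum (Finset.univ : Finset (Fin 2)) fun j _ =>
    tendsto_integral_mul (m2 j) hm (Lp.memLp w) hw.1
  have l3 := (tendsto_integral_mul m3 hm (Lp.memLp w) hw.1).neg
  refine tendsto_nhds_unique (l1.add l2) (l3.congr fun k => ?_)
  -- The product χw need not be smooth, so the equation is tested with χφ_k and k is sent to
  -- infinity. Applying the weak gradient to ∂_jψ turns ∫ w Δψ into -∑ ∫ g_j ∂_jψ.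
  have hψ : IsTest D fun x => χ x * φ k x :=
    ⟨hχ.contDiff.mul (hφ k), hχ.compact.mul_right,
      (closure_mono (Function.support_mul_subset_left _ _)).trans hχ.tsupport_subset⟩
  have e1 := hq _ hψ
  simp only [Finset.mul_sum] at e1
  rw [integral_finsetSum _ fun j _ => integrable_mul' w (memLp_test
    (isTest_partialD (isTest_partialD hψ j) j).contDiff.continuous
    (isTest_partialD (isTest_partialD hψ j) j).compact D)] at e1
  simp only [fun j => hg j _ (isTest_partialD hψ j)] at e1
  have e2 : ∀ j x, partialD j (fun x => χ x * φ k x) x =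
      χ x * partialD j (φ k) x + partialD j χ x * φ k x := fun j x => by
    have := fderiv_fun_mul (hχ.contDiff.differentiable (by simp) x)
      ((hφ k).differentiable (by simp) x)
    rw [partialD, this]
    simp [partialD, mul_comm]
  have e3 : ∀ j, ∫ x in D, g j x * partialD j (fun x => χ x * φ k x) x =
      (∫ x in D, g j x * χ x * partialD j (φ k) x) +
        ∫ x in D, g j x * partialD j χ x * φ k x := fun j => by
    have i1 : Integrable (fun x => g j x * χ x * partialD j (φ k) x) (volume.restrict D) :=
      (m1 j).integrable_mul (hdm j k)
    have i2 : Integrable (fun x => g j x * partialD j χ x * φ k x) (volume.restrict D) :=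
      (m2 j).integrable_mul (hm k)
    rw [← integral_add i1 i2]
    congr 1 with x
    rw [e2]; ring
  simp only [e3, Finset.sum_neg_distrib, Finset.sum_add_distrib] at e1
  simp only [mul_assoc] at e1 ⊢
  linarith

/-- The radial coordinate bounds the distance to the complement from below, so a set of points close
to the boundary lies in an outer part of the sectors. -/
lemma le_infDist_compl_of_isStarBall {P : Polygon} {x₀ : Plane} {r : ℝ}
    (h : IsStarBall P.carrier x₀ r) (i : P.Edge) {s t : ℝ} (hs : s ∈ Ioo (0 : ℝ) 1)
    (ht : t ∈ Ioo (0 : ℝ) 1) :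
    (1 - s) * r ≤ Metric.infDist (sectorMap P x₀ i (s, t)) P.carrierᶜ := by
  have hfr := P.edgePt_mem_frontier i (Ioo_subset_Icc_self ht)
  have hne : (P.carrierᶜ).Nonempty := ⟨_, fun hmem =>
    (P.isOpen_carrier.inter_frontier_eq.le ⟨hmem, hfr⟩ : P.edgePt i t ∈ (∅ : Set Plane))⟩
  refine (Metric.le_infDist hne).2 fun y hy => ?_
  by_contra hlt
  rw [not_le, dist_comm] at hlt
  exact hy (h.ball_subset_of_mem_closure (frontier_subset_closure hfr) hs.1.le hs.2 hlt)

/-- The outer sectors decrease to the empty set, since each point has a fixed radial coordinate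
below 1. -/
lemma tendsto_integral_sector_zero {P : Polygon} {x₀ : Plane} {r : ℝ}
    (h : IsStarBall P.carrier x₀ r) (i : P.Edge) {f : Plane → ℝ} (hf : IntegrableOn f P.carrier) :
    Tendsto (fun n : ℕ => ∫ x in sector P x₀ i (1 - 1 / ((n : ℝ) + 1)), f x) atTop (𝓝 0) := by
  have hσ : ∀ n : ℕ, 0 ≤ 1 - 1 / ((n : ℝ) + 1) := fun n => by
    rw [sub_nonneg, div_le_one (by positivity)]; linarith [n.cast_nonneg (α := ℝ)]
  have hanti : Antitone fun n : ℕ => sector P x₀ i (1 - 1 / ((n : ℝ) + 1)) := by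
    intro n k hnk
    refine image_mono (prod_mono (Ioo_subset_Ioo_left ?_) le_rfl)
    have : (n : ℝ) ≤ k := by exact_mod_cast hnk
    gcongr
  have hemp : ⋂ n : ℕ, sector P x₀ i (1 - 1 / ((n : ℝ) + 1)) = ∅ := by
    rw [eq_empty_iff_forall_notMem]
    intro x hx
    rw [mem_iInter] at hx
    obtain ⟨z, hz, rfl⟩ := hx 0
    have hz0 : z ∈ Ioo (0 : ℝ) 1 ×ˢ Ioo (0 : ℝ) 1 := by simpa using hz
    obtain ⟨n, hn⟩ := exists_nat_one_div_lt (sub_pos.2 hz0.1.2)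
    obtain ⟨z', hz', he⟩ := hx n
    have : z' = z := sectorMap_injOn h i le_rfl
      (prod_mono (Ioo_subset_Ioo_left (hσ n)) le_rfl hz') hz0 he
    rw [this] at hz'
    have := hz'.1.1
    linarith
  have := tendsto_setIntegral_of_antitone (μ := volume) (f := f)
    (fun n : ℕ => measurableSet_sector h i (hσ n)) hanti
    ⟨0, hf.mono_set (sector_subset h i (hσ 0))⟩
  rwa [hemp, setIntegral_empty] at this

/-- The cutoff has scale ε = κr/3, so its gradient vanishes at distance 3ε = κr from the complement,
hence wherever s ≤ 1 - κ. On the outer sector Young's inequality leaves |g|²/2 + ε⁻²w², and ε⁻² ·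
4κ²d² = 36d²/r²: the strip estimate for w² cancels κ exactly. -/
lemma abs_integral_cutoff_error_le {P : Polygon} {x₀ : Plane} {r : ℝ}
    (h : IsStarBall P.carrier x₀ r) {d : ℝ} {w : L2 P.carrier} {g : Fin 2 → L2 P.carrier}
    {κ : ℝ} (hκ : 0 < κ) (hκ1 : κ ≤ 1)
    (hstrip : ∀ i, ∫ x in sector P x₀ i (1 - κ), w x ^ 2 ≤
      4 * (1 - (1 - κ)) ^ 2 * d ^ 2 * ∫ x in sector P x₀ i (1 - κ), (g 0 x ^ 2 + g 1 x ^ 2))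
    {χ : Plane → ℝ} (hχ : ContDiff ℝ ∞ χ) (hb : ∀ j x, |partialD j χ x| ≤ (κ * r / 3)⁻¹)
    (hz : ∀ x, 3 * (κ * r / 3) ≤ Metric.infDist x P.carrierᶜ → ∀ j, partialD j χ x = 0) :
    |∑ j, ∫ x in P.carrier, g j x * partialD j χ x * w x| ≤
      ∑ i, (1 / 2 + 36 * d ^ 2 / r ^ 2) *
        ∫ x in sector P x₀ i (1 - κ), (g 0 x ^ 2 + g 1 x ^ 2) := by
  have hr := h.pos
  have hint : ∀ j, Integrable (fun x => g j x * partialD j χ x * w x)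
      (volume.restrict P.carrier) := fun j =>
    integrable_mul_mul (g j) w (continuous_partialD hχ j) _ (hb j)
  rw [← integral_finsetSum _ fun j _ => hint j,
    setIntegral_carrier_eq_sum h (integrable_finsetSum _ fun j _ => hint j)]
  refine (Finset.abs_sum_le_sum_abs _ _).trans (Finset.sum_le_sum fun i _ => ?_)
  have hsub : sector P x₀ i (1 - κ) ⊆ sector P x₀ i 0 :=
    image_mono (prod_mono (Ioo_subset_Ioo_left (by linarith)) le_rfl)
  have hS := hsub.trans (sector_subset h i le_rfl)
  -- The sector integral reduces to s > 1 - κ; elsewhere the distance bound puts the point where ∂χ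
  -- = 0.
  rw [setIntegral_eq_of_subset_of_forall_sdiff_eq_zero
    (f := fun x => ∑ j, g j x * partialD j χ x * w x) (measurableSet_sector h i le_rfl) hsub (by
      rintro _ ⟨⟨⟨s, t⟩, ⟨hs, ht⟩, rfl⟩, hx⟩
      have hsκ : s ≤ 1 - κ := by
        by_contra hlt
        exact hx ⟨(s, t), ⟨⟨not_le.1 hlt, hs.2⟩, ht⟩, rfl⟩
      have h1 := le_infDist_compl_of_isStarBall h i hs ht
      have h2 : κ * r ≤ (1 - s) * r := mul_le_mul_of_nonneg_right (by linarith) hr.le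
      have h3 := hz (sectorMap P x₀ i (s, t)) (by simp only at h1; linarith)
      simp [h3])]
  have hm : ∀ u : L2 P.carrier, MemLp u 2 (volume.restrict (sector P x₀ i (1 - κ))) := fun u =>
    (Lp.memLp u).mono_measure (Measure.restrict_mono hS le_rfl)
  have hG : Integrable (fun x => g 0 x ^ 2 + g 1 x ^ 2)
      (volume.restrict (sector P x₀ i (1 - κ))) :=
    (hm (g 0)).integrable_sq.add (hm (g 1)).integrable_sq
  have hbound := norm_integral_le_of_norm_le
    ((hG.const_mul (1 / 2)).add ((hm w).integrable_sq.const_mul ((κ * r / 3)⁻¹ ^ 2)))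
    (f := fun x => ∑ j, g j x * partialD j χ x * w x) (Eventually.of_forall fun x => by
      rw [Fin.sum_univ_two, Real.norm_eq_abs]
      have hj : ∀ j, |g j x * partialD j χ x * w x| ≤
          1 / 2 * g j x ^ 2 + 1 / 2 * ((κ * r / 3)⁻¹ ^ 2 * w x ^ 2) := fun j => by
        have h1 : partialD j χ x ^ 2 ≤ (κ * r / 3)⁻¹ ^ 2 := sq_le_sq' (abs_le.1 (hb j x)).1
          (abs_le.1 (hb j x)).2
        have h2 := mul_le_mul_of_nonneg_right h1 (sq_nonneg (w x))
        rw [abs_le]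
        constructor
        · nlinarith [sq_nonneg (g j x + partialD j χ x * w x)]
        · nlinarith [sq_nonneg (g j x - partialD j χ x * w x)]
      have := abs_add_le (g 0 x * partialD 0 χ x * w x) (g 1 x * partialD 1 χ x * w x)
      have h0 := hj 0
      have h1 := hj 1
      simp only [Pi.add_apply]
      linarith)
  simp only [Pi.add_apply] at hbound
  rw [integral_add (hG.const_mul _) ((hm w).integrable_sq.const_mul _), integral_const_mul,
    integral_const_mul] at hbound
  refine hbound.trans ?_
  have h4 := mul_le_mul_of_nonneg_left (hstrip i) (sq_nonneg (κ * r / 3)⁻¹)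
  have h5 : (κ * r / 3)⁻¹ ^ 2 * (4 * (1 - (1 - κ)) ^ 2 * d ^ 2 *
      ∫ x in sector P x₀ i (1 - κ), (g 0 x ^ 2 + g 1 x ^ 2)) = 36 * d ^ 2 / r ^ 2 *
      ∫ x in sector P x₀ i (1 - κ), (g 0 x ^ 2 + g 1 x ^ 2) := by
    field_simp
    ring
  rw [add_mul]
  linarith

/-- A function with zero trace and with a polynomial Laplacian to which it is orthogonal vanishes. -/
theorem eq_zero_of_trace_zero {P : Polygon} {x₀ : Plane} {r : ℝ}
    (h : IsStarBall P.carrier x₀ r) {w : L2 P.carrier} (hw : HasTrace P w fun _ _ => 0)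
    {q : MvPolynomial (Fin 2) ℝ} (hq : HasWeakLaplacian P.carrier w (evalP q))
    (hwq : ∫ x in P.carrier, w x * evalP q x = 0) : w = 0 := by
  obtain ⟨g, φ, hg, hφ, hH, ht⟩ := hw
  have hr := h.pos
  obtain ⟨d, hd⟩ : ∃ d, ∀ y ∈ closure P.carrier, ‖y - x₀‖ ≤ d := by
    obtain ⟨R, hR⟩ := P.isBounded_carrier.closure.subset_closedBall x₀
    exact ⟨R, fun y hy => by simpa [dist_eq_norm] using hR hy⟩
  have hG : IntegrableOn (fun x => g 0 x ^ 2 + g 1 x ^ 2) P.carrier :=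
    (Lp.memLp (g 0)).integrable_sq.add (Lp.memLp (g 1)).integrable_sq
  have hstrip := fun i {σ : ℝ} => integral_sector_sq_le_of_trace_zero h hd hφ hH ht i (σ := σ)
  have hκ : ∀ n : ℕ, 0 < 1 / ((n : ℝ) + 1) := fun n => by positivity
  have hκ1 : ∀ n : ℕ, 1 / ((n : ℝ) + 1) ≤ 1 := fun n => by
    rw [div_le_one (by positivity)]; linarith [n.cast_nonneg (α := ℝ)]
  have hε : ∀ n : ℕ, 0 < 1 / ((n : ℝ) + 1) * r / 3 := fun n => by positivity
  -- One cutoff for each strip width κ = 1/(n + 1), at scale κr/3.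
  choose χ hχ hχ1 hχ' hχe using fun n => exists_cutoff P.isBounded_carrier (hε n)
  have hpt : ∀ x ∈ P.carrier, ∀ᶠ n in atTop, χ n x = 1 := by
    intro x hx
    have hne : (P.carrierᶜ).Nonempty := by
      rw [nonempty_compl]
      intro huniv
      have := P.isBounded_carrier
      rw [huniv] at this
      exact NormedSpace.unbounded_univ ℝ Plane this
    have hpos : 0 < Metric.infDist x P.carrierᶜ :=
      (P.isOpen_carrier.isClosed_compl.notMem_iff_infDist_pos hne).1 (not_not.2 hx)
    have hlim : Tendsto (fun n : ℕ => 3 * (1 / ((n : ℝ) + 1) * r / 3)) atTop (𝓝 0) := by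
      have := ((tendsto_one_div_add_atTop_nhds_zero_nat (𝕜 := ℝ)).mul_const r).div_const 3
      simpa using this.const_mul 3
    filter_upwards [hlim.eventually (gt_mem_nhds hpos)] with n hn
    exact (hχe n x hn.le).1
  have l1 : Tendsto (fun n => ∑ j, ∫ x in P.carrier, g j x * χ n x * g j x) atTop
      (𝓝 (∑ j, ∫ x in P.carrier, g j x ^ 2)) := by
    refine tendsto_finsetSum _ fun j _ => ?_
    refine tendsto_integral_of_dominated_convergence (fun x => g j x ^ 2)
      (fun n => (integrable_mul_mul (g j) (g j) (hχ n).contDiff.continuous 1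
        (hχ1 n)).aestronglyMeasurable) (Lp.memLp (g j)).integrable_sq (fun n => ?_) ?_
    · refine Eventually.of_forall fun x => ?_
      rw [norm_mul, norm_mul, mul_right_comm, ← norm_mul, ← sq, norm_pow, Real.norm_eq_abs, sq_abs]
      exact mul_le_of_le_one_right (sq_nonneg _) (hχ1 n x)
    · filter_upwards [ae_restrict_mem P.isOpen_carrier.measurableSet] with x hx
      refine tendsto_const_nhds.congr' ?_
      filter_upwards [hpt x hx] with n hn
      rw [hn]; ring
  have l3 : Tendsto (fun n => ∫ x in P.carrier, evalP q x * χ n x * w x) atTop (𝓝 0) := by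
    rw [← hwq]
    have hi := integrable_L2_evalP w q
    refine tendsto_integral_of_dominated_convergence (fun x => ‖w x * evalP q x‖)
      (fun n => ?_) hi.norm (fun n => ?_) ?_
    · exact (((contDiff_evalP q).continuous.mul
        (hχ n).contDiff.continuous).aestronglyMeasurable).mul (aesm_L2 w)
    · refine Eventually.of_forall fun x => ?_
      rw [mul_right_comm, norm_mul, mul_comm (w x)]
      exact mul_le_of_le_one_right (norm_nonneg _) (hχ1 n x)
    · filter_upwards [ae_restrict_mem P.isOpen_carrier.measurableSet] with x hx
      refine tendsto_const_nhds.congr' ?_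
      filter_upwards [hpt x hx] with n hn
      rw [hn]; ring
  have l2 : Tendsto (fun n => ∑ j, ∫ x in P.carrier, g j x * partialD j (χ n) x * w x) atTop
      (𝓝 0) := by
    refine squeeze_zero_norm (fun n => abs_integral_cutoff_error_le h (hκ n) (hκ1 n)
      (fun i => hstrip i (by linarith [hκ1 n]) (by linarith [hκ n])) (hχ n).contDiff (hχ' n)
      fun x hx => (hχe n x hx).2) ?_
    have := tendsto_finsetSum (Finset.univ : Finset P.Edge) fun i _ =>
      (tendsto_integral_sector_zero h i hG).const_mul (1 / 2 + 36 * d ^ 2 / r ^ 2)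
    simpa using this
  -- In the limit the cutoff identity reads ∫|g|² = -∫ qw = 0.
  have hsum := tendsto_nhds_unique (l1.add l2) (l3.neg.congr fun n =>
    (weak_identity_cutoff P.isBounded_carrier hg hφ hH hq (hχ n) (hχ1 n) (hχ' n)).symm)
  rw [Fin.sum_univ_two, add_zero, neg_zero,
    ← integral_add (Lp.memLp (g 0)).integrable_sq (Lp.memLp (g 1)).integrable_sq] at hsum
  -- The strip estimate with σ = 0 covers whole sectors and is a Poincaré inequality for w.
  have hw0 : ∫ x in P.carrier, w x ^ 2 ≤ 0 := by
    rw [setIntegral_carrier_eq_sum h (Lp.memLp w).integrable_sq]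
    refine Finset.sum_nonpos fun i _ => (hstrip i le_rfl zero_le_one).trans ?_
    refine mul_nonpos_of_nonneg_of_nonpos (by positivity) (le_of_le_of_eq ?_ hsum)
    exact setIntegral_mono_set hG (Eventually.of_forall fun x => by positivity)
      (sector_subset h i le_rfl).eventuallyLE
  have h0 := (integral_eq_zero_iff_of_nonneg (fun x => sq_nonneg (w x))
    (Lp.memLp w).integrable_sq).1
    (le_antisymm hw0 (integral_nonneg fun x => sq_nonneg (w x)))
  rw [Lp.eq_zero_iff_ae_eq_zero]
  filter_upwards [h0] with x hx
  simpa using hx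

/-! ### The Poincaré inequality -/

/-- Write φ² = ∂₀(x₀)φ² and integrate by parts: ∫φ² = -∫ 2x₀φ∂₀φ, where x₀ is the first coordinate.
Young's inequality, with half of φ² absorbed on the left, gives 4R². -/
lemma integral_test_sq_le {D : Set Plane} (hD : IsOpen D) {R : ℝ} (hR : ∀ x ∈ D, |x 0| ≤ R)
    {φ : Plane → ℝ} (h : IsTest D φ) :
    ∫ x in D, φ x ^ 2 ≤ 4 * R ^ 2 * ∫ x in D, partialD 0 φ x ^ 2 := by
  have hφ := h.contDiff
  have hsq : IsTest D fun x => φ x * φ x :=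
    ⟨hφ.mul hφ, h.compact.mul_left,
      (closure_mono (Function.support_mul_subset_left _ _)).trans h.tsupport_subset⟩
  have hX : evalP (MvPolynomial.X 0) = fun x => x 0 := by ext x; simp [evalP]
  have e1 := integral_parts hsq (contDiff_evalP (MvPolynomial.X 0)) 0
  rw [partialD_evalP, hX] at e1
  have e2 : ∀ x, partialD 0 (fun x => φ x * φ x) x = 2 * φ x * partialD 0 φ x := fun x => by
    have := fderiv_fun_mul (hφ.differentiable (by simp) x) (hφ.differentiable (by simp) x)
    rw [partialD, this]
    simp [partialD]; ring
  have e3 : ∫ x in D, φ x ^ 2 = -∫ x in D, x 0 * (2 * φ x * partialD 0 φ x) := by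
    simp only [e2] at e1
    rw [e1, neg_neg]
    congr 1 with x
    simp [evalP, sq]
  have i1 : Integrable (fun x => φ x ^ 2) (volume.restrict D) :=
    (memLp_test hφ.continuous h.compact D).integrable_sq
  have i2 : Integrable (fun x => partialD 0 φ x ^ 2) (volume.restrict D) :=
    (memLp_test (continuous_partialD hφ 0) (hasCompactSupport_partialD h.compact 0) D).integrable_sq
  have e4 := norm_integral_le_of_norm_le ((i1.const_mul (1 / 2)).add (i2.const_mul (2 * R ^ 2)))
    (f := fun x => x 0 * (2 * φ x * partialD 0 φ x)) (by
      filter_upwards [ae_restrict_mem hD.measurableSet] with x hx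
      have h1 : (x 0) ^ 2 ≤ R ^ 2 := sq_le_sq' (abs_le.1 (hR x hx)).1 (abs_le.1 (hR x hx)).2
      have h2 := mul_le_mul_of_nonneg_right h1 (sq_nonneg (partialD 0 φ x))
      simp only [Pi.add_apply, Real.norm_eq_abs]
      rw [abs_le]
      constructor
      · nlinarith [sq_nonneg (φ x + 2 * x 0 * partialD 0 φ x)]
      · nlinarith [sq_nonneg (φ x - 2 * x 0 * partialD 0 φ x)])
  simp only [Pi.add_apply] at e4
  rw [integral_add (i1.const_mul _) (i2.const_mul _), integral_const_mul, integral_const_mul,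
    Real.norm_eq_abs, abs_le] at e4
  linarith [e4.1]

lemma eq_zero_of_H10_of_grad_eq_zero {D : Set Plane} (hD : IsOpen D)
    (hb : Bornology.IsBounded D) {v : L2 D} {g : Fin 2 → L2 D} {φ : ℕ → Plane → ℝ}
    (hφ : ∀ k, IsTest D (φ k)) (hH : TendstoH1 D φ v g)
    (hg : ∀ᵐ x ∂volume.restrict D, g 0 x = 0) : v = 0 := by
  obtain ⟨R, hR⟩ := hb.exists_norm_le
  have hR' : ∀ x ∈ D, |x 0| ≤ R := fun x hx =>
    ((PiLp.norm_apply_le x 0).trans (hR x hx) : ‖x 0‖ ≤ R)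
  have l1 := tendsto_integral_sq (fun k => memLp_test (hφ k).contDiff.continuous (hφ k).compact D)
    (Lp.memLp v) hH.1
  have l2 := tendsto_integral_sq (fun k => memLp_test (continuous_partialD (hφ k).contDiff 0)
    (hasCompactSupport_partialD (hφ k).compact 0) D) (Lp.memLp (g 0)) (hH.2 0)
  have h1 := le_of_tendsto_of_tendsto' l1 (l2.const_mul (4 * R ^ 2)) fun k =>
    integral_test_sq_le hD hR' (hφ k)
  have h2 : ∫ x in D, g 0 x ^ 2 = 0 := integral_eq_zero_of_ae (by
    filter_upwards [hg] with x hx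
    simp [hx])
  rw [h2, mul_zero] at h1
  have h0 := (integral_eq_zero_iff_of_nonneg (fun x => sq_nonneg (v x))
    (Lp.memLp v).integrable_sq).1
    (le_antisymm h1 (integral_nonneg fun x => sq_nonneg (v x)))
  rw [Lp.eq_zero_iff_ae_eq_zero]
  filter_upwards [h0] with x hx
  simpa using hx

/-! ### Polynomial moments and traces -/

/-- The set difference ℙ_l \ ℙ_{l-2} spans ℙ_l: an element p of ℙ_{l-2} equals (p + p₀) - p₀ with p₀
the l-th power of the first variable, and both terms lie outside ℙ_{l-2}. So the constraint of the
local space gives orthogonality to all of ℙ_l. -/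
lemma integral_mul_evalP_eq_zero {P : Polygon} {l : ℕ} {w : L2 P.carrier}
    (hw : ∀ p ∈ Poly2 l, p ∉ Poly2 ((l : ℤ) - 2) → ∫ x in P.carrier, w x * evalP p x = 0)
    {p : MvPolynomial (Fin 2) ℝ} (hp : p ∈ Poly2 l) : ∫ x in P.carrier, w x * evalP p x = 0 := by
  by_cases hp' : p ∈ Poly2 ((l : ℤ) - 2)
  · let p₀ : MvPolynomial (Fin 2) ℝ := MvPolynomial.monomial (Finsupp.single 0 l) 1
    have h1 : p₀ ∈ Poly2 l := by
      rw [MvPolynomial.monomial_mem_restrictSupport]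
      left; simp
    have h2 : p₀ ∉ Poly2 ((l : ℤ) - 2) := by
      rw [MvPolynomial.monomial_mem_restrictSupport]
      simp
    have h3 : p + p₀ ∉ Poly2 ((l : ℤ) - 2) := fun h => h2 ((Submodule.add_mem_iff_right _ hp').1 h)
    have e1 := hw _ (add_mem hp h1) h3
    have e2 := hw _ h1 h2
    have e3 : ∫ x in P.carrier, w x * evalP (p + p₀) x =
        (∫ x in P.carrier, w x * evalP p x) + ∫ x in P.carrier, w x * evalP p₀ x := by
      rw [← integral_add (integrable_L2_evalP w p) (integrable_L2_evalP w p₀)]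
      congr 1; ext x; simp [evalP, mul_add]
    linarith
  · exact hw p hp hp'

/-- The endpoint zeros give γ = t(t - 1)s with s of degree at most l - 2. Testing with s itself
yields ∫ t(1 - t)s² = 0, so s = 0. -/
lemma polynomial_eq_zero_of_moments {l : ℕ} {γ : Polynomial ℝ} (hγ : γ ∈ Poly1 l)
    (h0 : γ.eval 0 = 0) (h1 : γ.eval 1 = 0)
    (hm : ∀ p ∈ Poly1 ((l : ℤ) - 2), ∫ t in (0 : ℝ)..1, γ.eval t * p.eval t = 0) : γ = 0 := by
  by_contra hne
  obtain ⟨u, hu⟩ := Polynomial.dvd_iff_isRoot.2 (show γ.IsRoot 0 from h0)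
  have hu1 : u.eval 1 = 0 := by rw [hu] at h1; simpa using h1
  obtain ⟨s, rfl⟩ := Polynomial.dvd_iff_isRoot.2 (show u.IsRoot 1 from hu1)
  have hs : s ≠ 0 := by rintro rfl; simp at hu; exact hne hu
  have hsm : s ∈ Poly1 ((l : ℤ) - 2) := by
    rw [Poly1, Polynomial.mem_degreeLT, hu, Polynomial.degree_mul, Polynomial.degree_mul,
      Polynomial.degree_X_sub_C, Polynomial.degree_X_sub_C,
      Polynomial.degree_eq_natDegree hs] at hγ
    rw [Poly1, Polynomial.mem_degreeLT, Polynomial.degree_eq_natDegree hs]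
    -- For l ≤ 1 this inequality is contradictory, so the truncation in `toNat` does no harm.
    have h2 : 1 + (1 + s.natDegree) < ((l : ℤ) + 1).toNat := by exact_mod_cast hγ
    have h3 : s.natDegree < ((l : ℤ) - 2 + 1).toNat := by omega
    exact_mod_cast h3
  have hz := hm s hsm
  have hpos : 0 < ∫ t in (0 : ℝ)..1, t * (1 - t) * s.eval t ^ 2 := by
    have hc : Continuous fun t : ℝ => t * (1 - t) * s.eval t ^ 2 := by
      have := s.continuous
      fun_prop
    refine intervalIntegral.integral_pos zero_lt_one hc.continuousOn (fun t ht => ?_) ?_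
    · have h1 : 0 ≤ 1 - t := by linarith [ht.2]
      have h2 : 0 ≤ t := ht.1.le
      positivity
    · by_contra! hall
      refine hs (Polynomial.eq_zero_of_infinite_isRoot s
        ((Ioo_infinite (zero_lt_one' ℝ)).mono fun t ht => ?_))
      have h1 := hall t (Ioo_subset_Icc_self ht)
      have h2 : 0 < t * (1 - t) := mul_pos ht.1 (by linarith [ht.2])
      have h3 : s.eval t ^ 2 ≤ 0 := by
        by_contra hlt
        exact absurd (mul_pos h2 (not_le.1 hlt)) (not_lt.2 h1)
      exact pow_eq_zero_iff (two_ne_zero) |>.1 (le_antisymm h3 (sq_nonneg _))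
  have e : ∀ t : ℝ, γ.eval t * s.eval t = -(t * (1 - t) * s.eval t ^ 2) := fun t => by
    rw [hu]; simp; ring
  simp only [e, intervalIntegral.integral_neg] at hz
  linarith

lemma continuous_eval_mul_eval (γ p : Polynomial ℝ) : Continuous fun t => γ.eval t * p.eval t :=
  γ.continuous.mul p.continuous

section Local

variable {P : Polygon} {l : ℕ} {b : DofBasis P l}

lemma traceP_spec (v : enlargedSpace P l) :
    (∀ i, traceP v i ∈ Poly1 l) ∧ (∀ i, (traceP v i).eval 1 = (traceP v (i + 1)).eval 0) ∧
      HasTrace P v fun i t => (traceP v i).eval t :=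
  v.2.2.2.choose_spec

/-- A function all of whose degrees of freedom vanish has zero trace. -/
lemma hasTrace_zero_of_dof_eq_zero {v : enlargedSpace P l} (h : ∀ k, dof b v k = 0) :
    HasTrace P v fun _ _ => 0 := by
  obtain ⟨h1, h2, h3⟩ := traceP_spec v
  have h0 : ∀ i, (traceP v i).eval 0 = 0 := fun i => h (.inl i)
  have hz : ∀ i, traceP v i = 0 := fun i => by
    refine polynomial_eq_zero_of_moments (h1 i) (h0 i) ((h2 i).trans (h0 _)) fun p hp => ?_
    -- The degrees of freedom only give moments against the chosen basis; linearity extends their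
    -- vanishing to all of ℙ_{l-2}(e).
    let F : Poly1 ((l : ℤ) - 2) →ₗ[ℝ] ℝ :=
      { toFun := fun p => ∫ t in (0 : ℝ)..1, (traceP v i).eval t * (p : Polynomial ℝ).eval t
        map_add' := fun p p' => by
          rw [← intervalIntegral.integral_add
            ((continuous_eval_mul_eval _ _).intervalIntegrable _ _)
            ((continuous_eval_mul_eval _ _).intervalIntegrable _ _)]
          congr 1 with t
          simp [mul_add]
        map_smul' := fun c p => by
          rw [RingHom.id_apply, smul_eq_mul, ← intervalIntegral.integral_const_mul]
          congr 1 with t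
          simp [mul_left_comm] }
    have hF : F = 0 := (b.edge i).ext fun a => by
      have h4 := h (.inr (.inl (i, a)))
      simp only [dof, Polygon.edgeIntegral] at h4
      rwa [inv_mul_cancel_left₀ (P.edgeLength_pos i).ne'] at h4
    exact LinearMap.congr_fun hF ⟨p, hp⟩
  simpa [hz] using h3

/-! ### Linearity and unisolvence of the degrees of freedom -/

lemma edgeIntegral_add {i : P.Edge} {f g : ℝ → ℝ} (hf : Continuous f) (hg : Continuous g) :
    P.edgeIntegral i (fun t => f t + g t) = P.edgeIntegral i f + P.edgeIntegral i g := by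
  simp only [Polygon.edgeIntegral]
  rw [intervalIntegral.integral_add (hf.intervalIntegrable _ _) (hg.intervalIntegrable _ _),
    mul_add]

lemma edgeIntegral_const_mul {i : P.Edge} (c : ℝ) (f : ℝ → ℝ) :
    P.edgeIntegral i (fun t => c * f t) = c * P.edgeIntegral i f := by
  simp only [Polygon.edgeIntegral]
  rw [intervalIntegral.integral_const_mul, mul_left_comm]

/-- The degrees of freedom as a linear map. -/
def dofLin (pr : Projections P l b) : enlargedSpace P l →ₗ[ℝ] (DofIndex P l → ℝ) where
  toFun := dof b
  -- `traceP` is a choice and not visibly linear in v. Vertex values and edge moments agree with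
  -- those of the edge projection, which is linear by assumption.
  map_add' v w := by
    ext k
    rcases k with i | ⟨i, a⟩ | a
    · simp only [dof, Pi.add_apply, ← pr.edge_start, map_add, Submodule.coe_add,
        Polynomial.eval_add]
    · simp only [dof, Pi.add_apply, ← pr.edge_moment _ _ _ (b.edge i a).2, map_add,
        Submodule.coe_add, Polynomial.eval_add, add_mul]
      rw [edgeIntegral_add (continuous_eval_mul_eval _ _) (continuous_eval_mul_eval _ _), mul_add]
    · simp only [dof, Pi.add_apply, Submodule.coe_add]
      rw [integral_add_mul _ _
        (memLp_bounded (contDiff_evalP _).continuous P.isBounded_carrier), mul_add]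
  map_smul' r v := by
    ext k
    rcases k with i | ⟨i, a⟩ | a
    · simp only [dof, Pi.smul_apply, ← pr.edge_start, map_smul, Submodule.coe_smul,
        Polynomial.eval_smul, RingHom.id_apply]
    · simp only [dof, Pi.smul_apply, ← pr.edge_moment _ _ _ (b.edge i a).2, map_smul,
        Submodule.coe_smul, Polynomial.eval_smul, RingHom.id_apply, smul_eq_mul, mul_assoc]
      rw [edgeIntegral_const_mul, mul_left_comm]
    · simp only [dof, Pi.smul_apply, Submodule.coe_smul, RingHom.id_apply, smul_eq_mul]
      rw [integral_smul_mul, mul_left_comm]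

/-- The difference v - Π₀v has zero trace, a Laplacian in ℙ_l, and is orthogonal to ℙ_l, so
`eq_zero_of_trace_zero` applies. This is what the stabilisation detects. -/
lemma eq_polyEnl_value_of_dof_eq_zero {x₀ : Plane} {r : ℝ} (h : IsStarBall P.carrier x₀ r)
    (pr : Projections P l b) {v : enlargedSpace P l} (hv : v ∈ localSpace pr)
    (hd : ∀ k, dof b (v - polyEnl P l (pr.value v)) k = 0) : v = polyEnl P l (pr.value v) := by
  set w := v - polyEnl P l (pr.value v) with hw
  obtain ⟨q, hq, hL⟩ := w.2.2.1
  have h0 : (w : L2 P.carrier) = 0 := eq_zero_of_trace_zero h (hasTrace_zero_of_dof_eq_zero hd) hL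
    (integral_mul_evalP_eq_zero (fun p hp hp' => hv p hp hp') hq)
  exact sub_eq_zero.1 (Subtype.ext h0 : w = 0)

/-- Π₀ is computed from the degrees of freedom, so Π₀v = 0 and v equals v - Π₀v, to which the
preceding lemma applies. -/
lemma eq_zero_of_dof_eq_zero {x₀ : Plane} {r : ℝ} (h : IsStarBall P.carrier x₀ r)
    (pr : Projections P l b) {v : enlargedSpace P l} (hv : v ∈ localSpace pr)
    (hd : ∀ k, dof b v k = 0) : v = 0 := by
  obtain ⟨c, hc⟩ := pr.value_dof
  have h0 : pr.value v = 0 := by rw [hc]; simp [hd]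
  have h1 := eq_polyEnl_value_of_dof_eq_zero h pr hv (by simpa [h0] using hd)
  rwa [h0, map_zero] at h1

/-! ### Consistency and linearity of the gradient projection -/

lemma pderiv_mem_Poly2_sub_one {k : ℤ} {p : MvPolynomial (Fin 2) ℝ} (hp : p ∈ Poly2 k)
    (j : Fin 2) : MvPolynomial.pderiv j p ∈ Poly2 (k - 1) := by
  rw [Poly2, MvPolynomial.restrictSupport_eq_span] at hp
  induction hp using Submodule.span_induction with
  | mem x hx =>
    obtain ⟨s, hs, rfl⟩ := hx
    rw [MvPolynomial.pderiv_monomial, MvPolynomial.monomial_mem_restrictSupport]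
    by_cases hsj : s j = 0
    · right; simp [hsj]
    · left
      have hs' : ((Finsupp.degree s : ℕ) : ℤ) ≤ k := hs
      have hle : Finsupp.single j 1 ≤ s := by
        rw [Finsupp.single_le_iff]; omega
      have h1 : Finsupp.degree (s - Finsupp.single j 1) + 1 = Finsupp.degree s := by
        conv_rhs => rw [← tsub_add_cancel_of_le hle, map_add, Finsupp.degree_single]
      change ((Finsupp.degree (s - Finsupp.single j 1) : ℕ) : ℤ) ≤ k - 1
      omega
  | zero => simp
  | add x y _ _ hx hy => rw [map_add]; exact add_mem hx hy
  | smul r x _ hx => rw [Derivation.map_smul]; exact Submodule.smul_mem _ _ hx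

lemma gradProj_spec_apply (pr : Projections P l b) (v : enlargedSpace P l) (j : Fin 2)
    (p : Poly2 ((l : ℤ) - 1)) :
    ∫ x in P.carrier, evalP (gradProj pr v j) x * evalP p x =
      -(∫ x in P.carrier, evalP (pr.value v) x * evalP (MvPolynomial.pderiv j p) x) +
        ∑ i, P.edgeIntegral i fun t =>
          (pr.edge i v : Polynomial ℝ).eval t * (evalP p (P.edgePt i t) * P.normal i j) :=
  represent_spec P _ (gradFunctional pr v j) p

/-- The gradient projection reproduces gradients of polynomials. -/
lemma integral_gradProj_polyEnl {x₀ : Plane} {r : ℝ} (h : IsStarBall P.carrier x₀ r)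
    (pr : Projections P l b) (q : Poly2 l) (j : Fin 2) (p : Poly2 ((l : ℤ) - 1)) :
    ∫ x in P.carrier, evalP (gradProj pr (polyEnl P l q) j) x * evalP p x =
      ∫ x in P.carrier, evalP (MvPolynomial.pderiv j q) x * evalP p x := by
  -- On polynomials both Π₀ and the edge projections are exact, so the definition of Π₁ is the
  -- integration by parts formula for the product qp.
  have hdiv := integral_partialD_eq_sum_edgeIntegral h
    (contDiff_evalP ((q : MvPolynomial (Fin 2) ℝ) * p)) j
  rw [partialD_evalP, Derivation.leibniz] at hdiv
  have e1 : ∫ x in P.carrier, evalP ((q : MvPolynomial (Fin 2) ℝ) • MvPolynomial.pderiv j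
      (p : MvPolynomial (Fin 2) ℝ) + (p : MvPolynomial (Fin 2) ℝ) • MvPolynomial.pderiv j
      (q : MvPolynomial (Fin 2) ℝ)) x =
      (∫ x in P.carrier, evalP q x * evalP (MvPolynomial.pderiv j p) x) +
      ∫ x in P.carrier, evalP (MvPolynomial.pderiv j q) x * evalP p x := by
    rw [← integral_add (integrable_evalP_mul P _ _) (integrable_evalP_mul P _ _)]
    congr 1 with x
    simp [evalP, mul_comm]
  have e2 : ∀ i, (P.edgeIntegral i fun t => (pr.edge i (polyEnl P l q) : Polynomial ℝ).eval t *
      (evalP p (P.edgePt i t) * P.normal i j)) =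
      P.edgeIntegral i fun t => evalP ((q : MvPolynomial (Fin 2) ℝ) * p) (P.edgePt i t) *
        P.normal i j := fun i => by
    simp only [Polygon.edgeIntegral]
    congr 1
    refine intervalIntegral.integral_congr fun t ht => ?_
    rw [uIcc_of_le zero_le_one] at ht
    simp only [pr.edge_poly i q t ht]
    simp [evalP, mul_assoc]
  rw [gradProj_spec_apply, pr.value_poly]
  simp only [e2]
  rw [← hdiv, e1]
  ring

/-- The derivative of q lies in ℙ_{l-1} and has the same moments against ℙ_{l-1} as the projection,
hence none. -/
lemma pderiv_eq_zero_of_gradProj_eq_zero {x₀ : Plane} {r : ℝ} (h : IsStarBall P.carrier x₀ r)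
    (pr : Projections P l b) {q : Poly2 l} {j : Fin 2} (hq : gradProj pr (polyEnl P l q) j = 0) :
    MvPolynomial.pderiv j (q : MvPolynomial (Fin 2) ℝ) = 0 := by
  have hm := pderiv_mem_Poly2_sub_one q.2 j
  have h0 := (polyForm_nondegenerate P ((l : ℤ) - 1)).1 ⟨_, hm⟩ fun p => by
    have := integral_gradProj_polyEnl h pr q j p
    rw [hq] at this
    refine this.symm.trans ?_
    simp [evalP]
  exact congrArg Subtype.val h0

/-- The gradient projection as a linear map. -/
def gradProjLin (pr : Projections P l b) (j : Fin 2) :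
    enlargedSpace P l →ₗ[ℝ] Poly2 ((l : ℤ) - 1) where
  toFun v := gradProj pr v j
  map_add' v w := by
    simp only [gradProj, represent]
    rw [← map_add]
    congr 1
    ext p
    have e1 : ∫ x in P.carrier, evalP (pr.value (v + w)) x * evalP (MvPolynomial.pderiv j p) x =
        (∫ x in P.carrier, evalP (pr.value v) x * evalP (MvPolynomial.pderiv j p) x) +
        ∫ x in P.carrier, evalP (pr.value w) x * evalP (MvPolynomial.pderiv j p) x := by
      rw [← integral_add (integrable_evalP_mul P _ _) (integrable_evalP_mul P _ _)]
      congr 1 with x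
      simp [evalP, add_mul]
    have e2 : ∀ i, (P.edgeIntegral i fun t => (pr.edge i (v + w) : Polynomial ℝ).eval t *
        (evalP p (P.edgePt i t) * P.normal i j)) =
        (P.edgeIntegral i fun t => (pr.edge i v : Polynomial ℝ).eval t *
          (evalP p (P.edgePt i t) * P.normal i j)) +
        P.edgeIntegral i fun t => (pr.edge i w : Polynomial ℝ).eval t *
          (evalP p (P.edgePt i t) * P.normal i j) := fun i => by
      rw [← edgeIntegral_add (continuous_edge_integrand P i _ _ _)
        (continuous_edge_integrand P i _ _ _)]
      simp [add_mul]
    simp only [gradFunctional, LinearMap.coe_mk, AddHom.coe_mk, LinearMap.add_apply, e1, e2,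
      Finset.sum_add_distrib]
    ring
  map_smul' c v := by
    simp only [gradProj, represent]
    rw [RingHom.id_apply, ← map_smul]
    congr 1
    ext p
    have e1 : ∫ x in P.carrier, evalP (pr.value (c • v)) x * evalP (MvPolynomial.pderiv j p) x =
        c * ∫ x in P.carrier, evalP (pr.value v) x * evalP (MvPolynomial.pderiv j p) x := by
      rw [← integral_const_mul]
      congr 1 with x
      simp [evalP, mul_assoc]
    have e2 : ∀ i, (P.edgeIntegral i fun t => (pr.edge i (c • v) : Polynomial ℝ).eval t *
        (evalP p (P.edgePt i t) * P.normal i j)) =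
        c * P.edgeIntegral i fun t => (pr.edge i v : Polynomial ℝ).eval t *
          (evalP p (P.edgePt i t) * P.normal i j) := fun i => by
      rw [← edgeIntegral_const_mul]
      simp [mul_assoc]
    simp only [gradFunctional, LinearMap.coe_mk, AddHom.coe_mk, LinearMap.smul_apply, e1, e2,
      ← Finset.mul_sum, smul_eq_mul]
    ring

lemma gradProjLin_apply (pr : Projections P l b) (j : Fin 2) (v : enlargedSpace P l) :
    gradProjLin pr j v = gradProj pr v j := rfl

end Local

/-! ### Strongly monotone operators -/

/-- Zarantonello's theorem: a strongly monotone Lipschitz operator on a Hilbert space is bijective. -/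
theorem existsUnique_of_stronglyMonotone {V : Type*} [NormedAddCommGroup V]
    [InnerProductSpace ℝ V] [CompleteSpace V] (A : V → V) {α L : ℝ} (hα : 0 < α) (hL0 : 0 < L)
    (hmono : ∀ u w, α * ‖u - w‖ ^ 2 ≤ inner ℝ (A u - A w) (u - w))
    (hL : ∀ u w, ‖A u - A w‖ ≤ L * ‖u - w‖) (F : V) : ∃! u, A u = F := by
  -- This step size minimises 1 - 2τα + τ²L², the bound for the squared contraction factor of u ↦ u
  -- - τ(Au - F); the minimum is 1 - α²/L². Taking the maximum with 0 avoids proving α ≤ L, which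
  -- can fail on the zero space.
  set τ := α / L ^ 2 with hτ
  have hτ0 : 0 < τ := by positivity
  set c := max 0 (1 - α ^ 2 / L ^ 2) with hc
  have hc1 : Real.sqrt c < 1 := by
    rw [Real.sqrt_lt' one_pos, one_pow]
    have : 0 < α ^ 2 / L ^ 2 := by positivity
    exact max_lt one_pos (by linarith)
  have hT : ContractingWith (Real.sqrt c).toNNReal fun u => u - τ • (A u - F) := by
    refine ⟨by rwa [← NNReal.coe_lt_coe, Real.coe_toNNReal _ (Real.sqrt_nonneg _)],
      LipschitzWith.of_dist_le_mul fun u w => ?_⟩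
    rw [Real.coe_toNNReal _ (Real.sqrt_nonneg _), dist_eq_norm, dist_eq_norm]
    have e : u - τ • (A u - F) - (w - τ • (A w - F)) = (u - w) - τ • (A u - A w) := by module
    rw [e]
    refine le_of_sq_le_sq ?_ (by positivity)
    rw [norm_sub_sq_real, norm_smul, inner_smul_right, real_inner_comm, mul_pow, mul_pow,
      Real.sq_sqrt (le_max_left _ _), Real.norm_of_nonneg hτ0.le]
    have h1 := mul_le_mul_of_nonneg_left (hmono u w) hτ0.le
    have h2 := mul_le_mul_of_nonneg_left (pow_le_pow_left₀ (norm_nonneg _) (hL u w) 2)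
      (sq_nonneg τ)
    have h3 : (1 - α ^ 2 / L ^ 2) * ‖u - w‖ ^ 2 ≤ c * ‖u - w‖ ^ 2 :=
      mul_le_mul_of_nonneg_right (le_max_right _ _) (sq_nonneg _)
    have e1 : τ * (α * ‖u - w‖ ^ 2) = α ^ 2 / L ^ 2 * ‖u - w‖ ^ 2 := by
      rw [hτ]; ring
    have e2 : τ ^ 2 * (L * ‖u - w‖) ^ 2 = α ^ 2 / L ^ 2 * ‖u - w‖ ^ 2 := by
      rw [hτ]; field_simp
    rw [e1] at h1
    rw [e2] at h2
    linarith
  refine ⟨hT.fixedPoint, ?_, fun w hw => ?_⟩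
  · have h1 : _ - _ = _ := hT.fixedPoint_isFixedPt
    rw [sub_eq_self, smul_eq_zero, sub_eq_zero] at h1
    exact h1.resolve_left hτ0.ne'
  · refine hT.fixedPoint_unique ?_
    simp [Function.IsFixedPt, hw]

/-- A nonlinear variational problem that is strongly monotone and Lipschitz with respect to a
positive definite form on a finite-dimensional space is uniquely solvable. -/
theorem existsUnique_variational {V : Type*} [NormedAddCommGroup V]
    [InnerProductSpace ℝ V] [FiniteDimensional ℝ V] (B : V →ₗ[ℝ] V →ₗ[ℝ] ℝ)
    (hB : ∀ v, v ≠ 0 → 0 < B v v) (A : V → V →ₗ[ℝ] ℝ) {α C : ℝ} (hα : 0 < α) (hC : 0 < C)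
    (hmono : ∀ u w, α * B (u - w) (u - w) ≤ A u (u - w) - A w (u - w))
    (hLip : ∀ u w v, |A u v - A w v| ≤ C * (B (u - w) (u - w) + B v v)) (F : V →ₗ[ℝ] ℝ) :
    ∃! u, ∀ v, A u v = F v := by
  have : CompleteSpace V := FiniteDimensional.complete ℝ V
  have : ProperSpace V := FiniteDimensional.proper_real V
  have hcont : Continuous fun v => B v v := by
    let B' : V →ₗ[ℝ] V →L[ℝ] ℝ := (LinearMap.toContinuousLinearMap : _ ≃ₗ[ℝ] _).toLinearMap ∘ₗ B
    exact (LinearMap.continuous_of_finiteDimensional B').clm_apply continuous_id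
  -- By compactness of the unit sphere and homogeneity, B(v,v) is comparable with ‖v‖². Only the
  -- diagonal of B enters, so symmetry plays no role.
  have hK : IsCompact (Metric.sphere (0 : V) 1) := isCompact_sphere 0 1
  obtain ⟨c, hc, hcB⟩ := hK.exists_forall_le' hcont.continuousOn (a := 0) fun v hv =>
    hB v (by rintro rfl; simp at hv)
  obtain ⟨D, hD⟩ := hK.exists_bound_of_continuousOn hcont.continuousOn
  have hscale : ∀ v : V, v ≠ 0 → (‖v‖⁻¹ • v) ∈ Metric.sphere (0 : V) 1 ∧
      B v v = ‖v‖ ^ 2 * B (‖v‖⁻¹ • v) (‖v‖⁻¹ • v) := fun v hv => by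
    have hn := norm_ne_zero_iff.2 hv
    refine ⟨by simp [norm_smul, hn], ?_⟩
    simp only [map_smul, LinearMap.smul_apply, smul_eq_mul]
    field_simp
  have hlow : ∀ v, c * ‖v‖ ^ 2 ≤ B v v := fun v => by
    rcases eq_or_ne v 0 with rfl | hv
    · simp
    · obtain ⟨h1, h2⟩ := hscale v hv
      rw [h2, mul_comm]
      exact mul_le_mul_of_nonneg_left (hcB _ h1) (sq_nonneg _)
  have hup : ∀ v, B v v ≤ (|D| + 1) * ‖v‖ ^ 2 := fun v => by
    rcases eq_or_ne v 0 with rfl | hv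
    · simp
    · obtain ⟨h1, h2⟩ := hscale v hv
      rw [h2, mul_comm]
      refine mul_le_mul_of_nonneg_right ?_ (sq_nonneg _)
      linarith [le_abs_self (B (‖v‖⁻¹ • v) (‖v‖⁻¹ • v)), hD _ h1, le_abs_self D,
        Real.norm_eq_abs (B (‖v‖⁻¹ • v) (‖v‖⁻¹ • v))]
  -- Riesz representatives turn the variational problem into an operator equation in V.
  let R : (V →ₗ[ℝ] ℝ) → V := fun f => (InnerProductSpace.toDual ℝ V).symm f.toContinuousLinearMap
  have hR : ∀ f v, inner ℝ (R f) v = f v := fun f v => by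
    simp [R, InnerProductSpace.toDual_symm_apply]
  have hE : 0 < |D| + 1 := by positivity
  have h_mono : ∀ u w, α * c * ‖u - w‖ ^ 2 ≤ inner ℝ (R (A u) - R (A w)) (u - w) := fun u w => by
    rw [inner_sub_left, hR, hR, mul_assoc]
    exact (mul_le_mul_of_nonneg_left (hlow _) hα.le).trans (hmono u w)
  have h_lip : ∀ u w, ‖R (A u) - R (A w)‖ ≤ 2 * (C * (|D| + 1)) * ‖u - w‖ := fun u w => by
    set z := R (A u) - R (A w) with hz
    rcases eq_or_ne z 0 with h0 | h0
    · rw [h0, norm_zero]; positivity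
    rcases eq_or_ne (u - w) 0 with h1 | h1
    · exact absurd (by rw [hz, sub_eq_zero.1 h1, sub_self]) h0
    have hzn := norm_pos_iff.2 h0
    have hun := norm_pos_iff.2 h1
    -- The hypothesis is a sum of squares; scaling the test vector z to the length of u - w balances
    -- the two terms and gives the linear Lipschitz bound.
    set t := ‖u - w‖ / ‖z‖ with ht
    have h2 := hLip u w (t • z)
    have h3 : A u (t • z) - A w (t • z) = t * ‖z‖ ^ 2 := by
      rw [← real_inner_self_eq_norm_sq z]
      conv_rhs => rw [hz, inner_sub_left, hR, hR, ← hz]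
      rw [map_smul, map_smul, smul_eq_mul, smul_eq_mul]; ring
    rw [h3] at h2
    have h4 := (le_abs_self _).trans (h2.trans (mul_le_mul_of_nonneg_left
      (add_le_add (hup (u - w)) (hup (t • z))) hC.le))
    rw [norm_smul, Real.norm_of_nonneg (by positivity)] at h4
    have e1 : t * ‖z‖ = ‖u - w‖ := by rw [ht]; field_simp
    rw [sq ‖z‖, ← mul_assoc, e1] at h4
    refine le_of_mul_le_mul_left ?_ hun
    linarith
  obtain ⟨u, hu, huniq⟩ := existsUnique_of_stronglyMonotone (fun u => R (A u))
    (mul_pos hα hc) (by positivity) h_mono h_lip (R F)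
  refine ⟨u, fun v => ?_, fun w hw => huniq w ?_⟩
  · rw [← hR, ← hR, hu]
  · exact ext_inner_right ℝ fun v => by rw [hR, hR, hw]

/-! ### The nonlinearity -/

section Nonlinearity

variable {f : ℝ → ℝ} {m M : ℝ}

/-- After subtracting m the coefficients f(|a|) - m and f(|c|) - m are nonnegative, so
Cauchy–Schwarz reduces the claim to monotonicity of the scalar function (f(t) - m)t. The cases a = 0
and c = 0 are separate because the assumption does not control f(0), which there multiplies zero. -/
lemma inner_nonlinearity_ge (hm : ∀ s t, 0 ≤ s → s ≤ t → m * (t - s) ≤ f t * t - f s * s)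
    (a c : Plane) :
    m * ‖a - c‖ ^ 2 ≤ inner ℝ (f ‖a‖ • a - f ‖c‖ • c) (a - c) := by
  have hip := real_inner_le_norm a c
  have h1 := norm_nonneg a
  have h2 := norm_nonneg c
  have e : inner ℝ (f ‖a‖ • a - f ‖c‖ • c) (a - c) - m * ‖a - c‖ ^ 2 =
      (f ‖a‖ - m) * ‖a‖ ^ 2 + (f ‖c‖ - m) * ‖c‖ ^ 2 -
        (f ‖a‖ + f ‖c‖ - 2 * m) * inner ℝ a c := by
    rw [norm_sub_sq_real]
    simp only [inner_sub_left, inner_sub_right, real_inner_smul_left, real_inner_self_eq_norm_sq,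
      real_inner_comm a c]
    ring
  rw [← sub_nonneg, e]
  have ha := hm 0 ‖a‖ le_rfl h1
  have hc := hm 0 ‖c‖ le_rfl h2
  rcases eq_or_ne a 0 with rfl | ha0
  · simp only [norm_zero, inner_zero_left] at *
    nlinarith
  rcases eq_or_ne c 0 with rfl | hc0
  · simp only [norm_zero, inner_zero_right] at *
    nlinarith
  have ha' := norm_pos_iff.2 ha0
  have hc' := norm_pos_iff.2 hc0
  have hfa : 0 ≤ f ‖a‖ - m := by
    have : 0 ≤ (f ‖a‖ - m) * ‖a‖ := by linarith
    exact nonneg_of_mul_nonneg_left this ha'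
  have hfc : 0 ≤ f ‖c‖ - m := by
    have : 0 ≤ (f ‖c‖ - m) * ‖c‖ := by linarith
    exact nonneg_of_mul_nonneg_left this hc'
  have h5 : 0 ≤ (f ‖a‖ * ‖a‖ - f ‖c‖ * ‖c‖ - m * (‖a‖ - ‖c‖)) * (‖a‖ - ‖c‖) := by
    rcases le_total ‖a‖ ‖c‖ with h | h
    · have := hm _ _ h1 h
      exact mul_nonneg_of_nonpos_of_nonpos (by linarith) (by linarith)
    · have := hm _ _ h2 h
      exact mul_nonneg (by linarith) (by linarith)
  have h6 := mul_le_mul_of_nonneg_left hip (add_nonneg hfa hfc)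
  linarith

/-- Split the difference as f(|a|)(a - c) + (f(|a|) - f(|c|))c. The first term costs M; the second
is compared with the scalar function f(t)t and costs 2M times the difference of the norms. As
before, f(0) is uncontrolled and zero vectors are treated apart. -/
lemma norm_nonlinearity_sub_le (hm0 : 0 < m)
    (hm : ∀ s t, 0 ≤ s → s ≤ t → m * (t - s) ≤ f t * t - f s * s)
    (hM : ∀ s t, 0 ≤ s → s ≤ t → f t * t - f s * s ≤ M * (t - s)) (a c : Plane) :
    ‖f ‖a‖ • a - f ‖c‖ • c‖ ≤ 3 * M * ‖a - c‖ := by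
  have hM0 : 0 ≤ M := by
    have h1 := hm 0 1 le_rfl zero_le_one
    have h2 := hM 0 1 le_rfl zero_le_one
    linarith
  have hbd : ∀ v : Plane, v ≠ 0 → 0 ≤ f ‖v‖ ∧ f ‖v‖ ≤ M := fun v hv => by
    have hv' := norm_pos_iff.2 hv
    have h1 := hm 0 ‖v‖ le_rfl hv'.le
    have h2 := hM 0 ‖v‖ le_rfl hv'.le
    have h3 : 0 ≤ (f ‖v‖ - m) * ‖v‖ := by linarith
    have h4 : 0 ≤ (M - f ‖v‖) * ‖v‖ := by linarith
    have h5 := nonneg_of_mul_nonneg_left h3 hv'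
    have h6 := nonneg_of_mul_nonneg_left h4 hv'
    exact ⟨by linarith, by linarith⟩
  have hzero : ∀ v : Plane, ‖f ‖v‖ • v‖ ≤ 3 * M * ‖v‖ := fun v => by
    rcases eq_or_ne v 0 with rfl | hv
    · simp
    · rw [norm_smul, Real.norm_of_nonneg (hbd v hv).1]
      exact mul_le_mul_of_nonneg_right (by linarith [(hbd v hv).2]) (norm_nonneg v)
  rcases eq_or_ne a 0 with rfl | ha0
  · simpa using hzero c
  rcases eq_or_ne c 0 with rfl | hc0
  · simpa using hzero a
  obtain ⟨ha1, ha2⟩ := hbd a ha0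
  have hd := abs_norm_sub_norm_le a c
  have e : f ‖a‖ • a - f ‖c‖ • c = f ‖a‖ • (a - c) + (f ‖a‖ - f ‖c‖) • c := by module
  have h1 : ‖f ‖a‖ • (a - c)‖ ≤ M * ‖a - c‖ := by
    rw [norm_smul, Real.norm_of_nonneg ha1]
    exact mul_le_mul_of_nonneg_right ha2 (norm_nonneg _)
  have h2 : |f ‖a‖ * ‖a‖ - f ‖c‖ * ‖c‖| ≤ M * |‖a‖ - ‖c‖| := by
    rcases le_total ‖a‖ ‖c‖ with h | h
    · have h3 := hm _ _ (norm_nonneg a) h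
      have h4 := hM _ _ (norm_nonneg a) h
      have h5 := mul_nonneg hm0.le (sub_nonneg.2 h)
      rw [abs_sub_comm, abs_sub_comm ‖a‖, abs_of_nonneg (by linarith),
        abs_of_nonneg (sub_nonneg.2 h)]
      exact h4
    · have h3 := hm _ _ (norm_nonneg c) h
      have h4 := hM _ _ (norm_nonneg c) h
      have h5 := mul_nonneg hm0.le (sub_nonneg.2 h)
      rw [abs_of_nonneg (by linarith), abs_of_nonneg (sub_nonneg.2 h)]
      exact h4
  have h3 : ‖(f ‖a‖ - f ‖c‖) • c‖ ≤ M * |‖a‖ - ‖c‖| + M * |‖a‖ - ‖c‖| := by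
    rw [norm_smul, Real.norm_eq_abs, ← abs_of_nonneg (norm_nonneg c), ← abs_mul,
      abs_of_nonneg (norm_nonneg c)]
    have e1 : (f ‖a‖ - f ‖c‖) * ‖c‖ =
        (f ‖a‖ * ‖a‖ - f ‖c‖ * ‖c‖) - f ‖a‖ * (‖a‖ - ‖c‖) := by ring
    rw [e1]
    refine (abs_sub _ _).trans (add_le_add h2 ?_)
    rw [abs_mul, abs_of_nonneg ha1]
    exact mul_le_mul_of_nonneg_right ha2 (abs_nonneg _)
  have h4 := mul_le_mul_of_nonneg_left hd hM0
  rw [e]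
  refine (norm_add_le _ _).trans ?_
  linarith

end Nonlinearity

/-! ### The local discrete form -/

section Local

variable {P : Polygon} {l : ℕ} {b : DofBasis P l}

/-- The degrees of freedom of `(I - Π₀) v`. -/
def stabLin (pr : Projections P l b) : enlargedSpace P l →ₗ[ℝ] (DofIndex P l → ℝ) :=
  dofLin pr ∘ₗ (LinearMap.id - polyEnl P l ∘ₗ pr.value)

lemma stab_eq (pr : Projections P l b) (m M : ℝ) (v w : enlargedSpace P l) :
    stab b m M (v - polyEnl P l (pr.value v)) (w - polyEnl P l (pr.value w)) =
      M * m * ∑ k, stabLin pr v k * stabLin pr w k := rfl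

lemma gradProjAt_sub (pr : Projections P l b) (v w : enlargedSpace P l) (x : Plane) :
    gradProjAt pr (v - w) x = gradProjAt pr v x - gradProjAt pr w x := by
  have h := fun j => (gradProjLin pr j).map_sub v w
  simp only [gradProjLin_apply] at h
  ext j
  fin_cases j <;> simp [gradProjAt, h, evalP]

lemma gradProjAt_add (pr : Projections P l b) (v w : enlargedSpace P l) (x : Plane) :
    gradProjAt pr (v + w) x = gradProjAt pr v x + gradProjAt pr w x := by
  have h := fun j => (gradProjLin pr j).map_add v w
  simp only [gradProjLin_apply] at h
  ext j
  fin_cases j <;> simp [gradProjAt, h, evalP]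

lemma gradProjAt_smul (pr : Projections P l b) (c : ℝ) (v : enlargedSpace P l) (x : Plane) :
    gradProjAt pr (c • v) x = c • gradProjAt pr v x := by
  have h := fun j => (gradProjLin pr j).map_smul c v
  simp only [gradProjLin_apply] at h
  ext j
  fin_cases j <;> simp [gradProjAt, h, evalP]

lemma continuous_gradProjAt (pr : Projections P l b) (v : enlargedSpace P l) :
    Continuous (gradProjAt pr v) := by
  have h := fun j => (contDiff_evalP (gradProj pr v j : MvPolynomial (Fin 2) ℝ)).continuous
  refine (PiLp.continuous_toLp 2 _).comp (continuous_pi fun j => ?_)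
  fin_cases j
  · exact h 0
  · exact h 1

lemma integrableOn_of_continuousOn_closure {E : Type*} [NormedAddCommGroup E] {f : Plane → E}
    (hf : ContinuousOn f (closure P.carrier)) :
    Integrable f (volume.restrict P.carrier) :=
  (hf.integrableOn_compact P.isBounded_carrier.isCompact_closure).mono_set subset_closure

/-- The linear form of the scheme in which `μ ≡ 1`. -/
def referenceForm (pr : Projections P l b) (m M : ℝ) :
    enlargedSpace P l →ₗ[ℝ] enlargedSpace P l →ₗ[ℝ] ℝ :=
  (∑ j, (polyForm P ((l : ℤ) - 1)).compl₁₂ (gradProjLin pr j) (gradProjLin pr j)) +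
    (M * m) • ∑ k, (LinearMap.mul ℝ ℝ).compl₁₂ (LinearMap.proj k ∘ₗ stabLin pr)
      (LinearMap.proj k ∘ₗ stabLin pr)

lemma referenceForm_self (pr : Projections P l b) (m M : ℝ) (v : enlargedSpace P l) :
    referenceForm pr m M v v =
      (∫ x in P.carrier, ‖gradProjAt pr v x‖ ^ 2) + M * m * ∑ k, stabLin pr v k ^ 2 := by
  have e : ∫ x in P.carrier, ‖gradProjAt pr v x‖ ^ 2 =
      ∑ j, polyForm P ((l : ℤ) - 1) (gradProj pr v j) (gradProj pr v j) := by
    rw [Fin.sum_univ_two]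
    refine Eq.trans ?_ (integral_add (integrable_evalP_mul P (gradProj pr v 0) (gradProj pr v 0))
      (integrable_evalP_mul P (gradProj pr v 1) (gradProj pr v 1)))
    congr 1 with x
    rw [EuclideanSpace.norm_sq_eq, Fin.sum_univ_two]
    simp [gradProjAt, sq]
  rw [e]
  simp [referenceForm, LinearMap.sum_apply, gradProjLin_apply, sq]
  ring

lemma referenceForm_self_nonneg (pr : Projections P l b) {m M : ℝ} (hm : 0 < m) (hM : 0 < M)
    (v : enlargedSpace P l) : 0 ≤ referenceForm pr m M v v := by
  rw [referenceForm_self]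
  exact add_nonneg (integral_nonneg fun x => sq_nonneg _)
    (mul_nonneg (by positivity) (Finset.sum_nonneg fun k _ => sq_nonneg _))

/-- Both nonnegative parts of the form vanish: the stabilisation makes v a polynomial, and then the
vanishing projected gradient is its true gradient. -/
lemma eq_polyEnl_of_referenceForm_eq_zero {x₀ : Plane} {r : ℝ} (h : IsStarBall P.carrier x₀ r)
    (pr : Projections P l b) {m M : ℝ} (hm : 0 < m) (hM : 0 < M) {v : enlargedSpace P l}
    (hv : v ∈ localSpace pr) (h0 : referenceForm pr m M v v = 0) :
    ∃ q : Poly2 l, v = polyEnl P l q ∧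
      ∀ j, MvPolynomial.pderiv j (q : MvPolynomial (Fin 2) ℝ) = 0 := by
  have hMm : 0 < M * m := by positivity
  rw [referenceForm_self] at h0
  have h1 : 0 ≤ ∫ x in P.carrier, ‖gradProjAt pr v x‖ ^ 2 := integral_nonneg fun x => sq_nonneg _
  have h2 : 0 ≤ ∑ k, stabLin pr v k ^ 2 := Finset.sum_nonneg fun k _ => sq_nonneg _
  have h3 : ∑ k, stabLin pr v k ^ 2 = 0 := by nlinarith [mul_nonneg hMm.le h2]
  have h4 : ∫ x in P.carrier, ‖gradProjAt pr v x‖ ^ 2 = 0 := by nlinarith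
  have h5 : ∀ k, stabLin pr v k = 0 := fun k => by
    have := (Finset.sum_eq_zero_iff_of_nonneg fun k _ => sq_nonneg (stabLin pr v k)).1 h3 k
      (Finset.mem_univ k)
    simpa using this
  have hpoly := eq_polyEnl_value_of_dof_eq_zero h pr hv h5
  have hc := (continuous_gradProjAt pr v).norm.pow 2
  have h6 := (integral_eq_zero_iff_of_nonneg (fun x => sq_nonneg _)
    (integrableOn_of_continuousOn_closure hc.continuousOn)).1 h4
  have h7 := Measure.eqOn_open_of_ae_eq h6 P.isOpen_carrier hc.continuousOn continuousOn_const
  have h8 : ∀ x ∈ P.carrier, gradProjAt pr v x = 0 := fun x hx => by simpa using h7 hx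
  refine ⟨pr.value v, hpoly, fun j => pderiv_eq_zero_of_gradProj_eq_zero h pr ?_⟩
  rw [← hpoly]
  refine Subtype.ext (evalP_eq_zero P _ fun x hx => ?_)
  have h9 := congrArg (fun y : Plane => y j) (h8 x hx)
  fin_cases j <;> simpa [gradProjAt] using h9

/-! ### Strong monotonicity and Lipschitz bound of the local form -/

section Nonlinear

variable {μ : Plane → ℝ → ℝ} {m M : ℝ} {Ω : Set Plane}

lemma integrable_nonlinear (hμ : NonlinearityAssumptions Ω μ m M) (hP : P.carrier ⊆ Ω)
    (pr : Projections P l b) (z v w : enlargedSpace P l) :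
    Integrable (fun x => μ x ‖gradProjAt pr z x‖ *
      inner ℝ (gradProjAt pr v x) (gradProjAt pr w x)) (volume.restrict P.carrier) := by
  refine integrableOn_of_continuousOn_closure (ContinuousOn.mul ?_ ?_)
  · exact hμ.continuousOn.comp (f := fun x => (x, ‖gradProjAt pr z x‖))
      (continuous_id.prodMk (continuous_gradProjAt pr z).norm).continuousOn
      fun x hx => ⟨closure_mono hP hx, norm_nonneg _⟩
  · exact ((continuous_gradProjAt pr v).inner (continuous_gradProjAt pr w)).continuousOn

/-- The form `w ↦ a_E(z; z, w)` as a linear map. -/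
def localFormLin (hμ : NonlinearityAssumptions Ω μ m M) (hP : P.carrier ⊆ Ω)
    (pr : Projections P l b) (z : enlargedSpace P l) : enlargedSpace P l →ₗ[ℝ] ℝ where
  toFun w := localForm pr μ m M z z w
  map_add' v w := by
    simp only [localForm, stab_eq]
    simp only [gradProjAt_add, inner_add_right, mul_add, map_add, Pi.add_apply,
      Finset.sum_add_distrib]
    rw [integral_add (integrable_nonlinear hμ hP pr z z v) (integrable_nonlinear hμ hP pr z z w)]
    ring
  map_smul' c v := by
    simp only [localForm, stab_eq]
    simp only [gradProjAt_smul, inner_smul_right, map_smul, Pi.smul_apply,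
      smul_eq_mul, mul_left_comm _ c, integral_const_mul, ← Finset.mul_sum, RingHom.id_apply]
    ring

lemma localForm_sub_localForm (hμ : NonlinearityAssumptions Ω μ m M) (hP : P.carrier ⊆ Ω)
    (pr : Projections P l b) (u w v : enlargedSpace P l) :
    localForm pr μ m M u u v - localForm pr μ m M w w v =
      (∫ x in P.carrier, inner ℝ (μ x ‖gradProjAt pr u x‖ • gradProjAt pr u x -
        μ x ‖gradProjAt pr w x‖ • gradProjAt pr w x) (gradProjAt pr v x)) +
      M * m * ∑ k, stabLin pr (u - w) k * stabLin pr v k := by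
  simp only [localForm, stab_eq, inner_sub_left, real_inner_smul_left, map_sub, Pi.sub_apply,
    sub_mul, Finset.sum_sub_distrib]
  rw [integral_sub (integrable_nonlinear hμ hP pr u u v) (integrable_nonlinear hμ hP pr w w v)]
  ring

lemma integrable_inner_nonlinear (hμ : NonlinearityAssumptions Ω μ m M) (hP : P.carrier ⊆ Ω)
    (pr : Projections P l b) (u w v : enlargedSpace P l) :
    Integrable (fun x => inner ℝ (μ x ‖gradProjAt pr u x‖ • gradProjAt pr u x -
        μ x ‖gradProjAt pr w x‖ • gradProjAt pr w x) (gradProjAt pr v x))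
      (volume.restrict P.carrier) := by
  simp only [inner_sub_left, real_inner_smul_left]
  exact (integrable_nonlinear hμ hP pr u u v).sub (integrable_nonlinear hμ hP pr w w v)

lemma integrable_gradProjAt_sq (pr : Projections P l b) (v : enlargedSpace P l) :
    Integrable (fun x => ‖gradProjAt pr v x‖ ^ 2) (volume.restrict P.carrier) :=
  integrableOn_of_continuousOn_closure ((continuous_gradProjAt pr v).norm.pow 2).continuousOn

/-- The gradient part contributes the factor m pointwise; the stabilisation is linear and
contributes 1, whence min m 1. -/
lemma localForm_stronglyMonotone (hμ : NonlinearityAssumptions Ω μ m M) (hP : P.carrier ⊆ Ω)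
    (pr : Projections P l b) (u w : enlargedSpace P l) :
    min m 1 * referenceForm pr m M (u - w) (u - w) ≤
      localForm pr μ m M u u (u - w) - localForm pr μ m M w w (u - w) := by
  have hm := hμ.pos_m
  have hM := hμ.pos_M
  rw [localForm_sub_localForm hμ hP, referenceForm_self, mul_add]
  refine add_le_add ?_ ?_
  · have h1 : m * ∫ x in P.carrier, ‖gradProjAt pr (u - w) x‖ ^ 2 ≤
        ∫ x in P.carrier, inner ℝ (μ x ‖gradProjAt pr u x‖ • gradProjAt pr u x -
          μ x ‖gradProjAt pr w x‖ • gradProjAt pr w x) (gradProjAt pr (u - w) x) := by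
      rw [← integral_const_mul]
      refine setIntegral_mono_on ((integrable_gradProjAt_sq pr (u - w)).const_mul m)
        (integrable_inner_nonlinear hμ hP pr u w (u - w)) P.isOpen_carrier.measurableSet
        fun x hx => ?_
      rw [gradProjAt_sub]
      exact inner_nonlinearity_ge (hμ.lower x (subset_closure (hP hx))) _ _
    exact (mul_le_mul_of_nonneg_right (min_le_left m 1)
      (integral_nonneg fun x => sq_nonneg _)).trans h1
  · have h2 : 0 ≤ M * m * ∑ k, stabLin pr (u - w) k ^ 2 :=
      mul_nonneg (by positivity) (Finset.sum_nonneg fun k _ => sq_nonneg _)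
    refine (mul_le_mul_of_nonneg_right (min_le_right m 1) h2).trans_eq ?_
    simp only [one_mul, sq]

/-- The constant 3M is the pointwise Lipschitz constant of the flux and 1 is for the linear
stabilisation. Products are replaced by sums of squares so that both parts fit into the diagonal of
the reference form. -/
lemma abs_localForm_sub_localForm_le (hμ : NonlinearityAssumptions Ω μ m M) (hP : P.carrier ⊆ Ω)
    (pr : Projections P l b) (u w v : enlargedSpace P l) :
    |localForm pr μ m M u u v - localForm pr μ m M w w v| ≤
      (3 * M + 1) * (referenceForm pr m M (u - w) (u - w) + referenceForm pr m M v v) := by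
  have hm := hμ.pos_m
  have hM := hμ.pos_M
  have hMm : 0 < M * m := by positivity
  rw [localForm_sub_localForm hμ hP, referenceForm_self, referenceForm_self]
  have i1 := integrable_gradProjAt_sq pr (u - w)
  have i2 := integrable_gradProjAt_sq pr v
  have h1 : |∫ x in P.carrier, inner ℝ (μ x ‖gradProjAt pr u x‖ • gradProjAt pr u x -
      μ x ‖gradProjAt pr w x‖ • gradProjAt pr w x) (gradProjAt pr v x)| ≤
      3 * M * ((∫ x in P.carrier, ‖gradProjAt pr (u - w) x‖ ^ 2) +
        ∫ x in P.carrier, ‖gradProjAt pr v x‖ ^ 2) := by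
    rw [← integral_add i1 i2, ← integral_const_mul]
    rw [← Real.norm_eq_abs]
    refine norm_integral_le_of_norm_le ((i1.add i2).const_mul (3 * M)) ?_
    filter_upwards [ae_restrict_mem P.isOpen_carrier.measurableSet] with x hx
    have hx' := subset_closure (hP hx)
    have h2 := norm_nonlinearity_sub_le hm (hμ.lower x hx') (hμ.upper x hx')
      (gradProjAt pr u x) (gradProjAt pr w x)
    refine (norm_inner_le_norm (𝕜 := ℝ) _ _).trans ?_
    refine (mul_le_mul_of_nonneg_right h2 (norm_nonneg _)).trans ?_
    rw [← gradProjAt_sub, mul_assoc]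
    refine mul_le_mul_of_nonneg_left ?_ (by positivity)
    nlinarith [two_mul_le_add_sq ‖gradProjAt pr (u - w) x‖ ‖gradProjAt pr v x‖,
      sq_nonneg ‖gradProjAt pr (u - w) x‖, sq_nonneg ‖gradProjAt pr v x‖]
  have h3 : |∑ k, stabLin pr (u - w) k * stabLin pr v k| ≤
      (∑ k, stabLin pr (u - w) k ^ 2) + ∑ k, stabLin pr v k ^ 2 := by
    rw [← Finset.sum_add_distrib]
    refine (Finset.abs_sum_le_sum_abs _ _).trans (Finset.sum_le_sum fun k _ => ?_)
    rw [abs_le]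
    constructor <;> nlinarith [sq_nonneg (stabLin pr (u - w) k + stabLin pr v k),
      sq_nonneg (stabLin pr (u - w) k - stabLin pr v k), sq_nonneg (stabLin pr (u - w) k),
      sq_nonneg (stabLin pr v k)]
  have h4 := mul_le_mul_of_nonneg_left h3 hMm.le
  have p1 : 0 ≤ ∫ x in P.carrier, ‖gradProjAt pr (u - w) x‖ ^ 2 :=
    integral_nonneg fun x => sq_nonneg _
  have p2 : 0 ≤ ∫ x in P.carrier, ‖gradProjAt pr v x‖ ^ 2 := integral_nonneg fun x => sq_nonneg _
  have p3 : 0 ≤ M * m * ∑ k, stabLin pr (u - w) k ^ 2 :=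
    mul_nonneg hMm.le (Finset.sum_nonneg fun k _ => sq_nonneg _)
  have p4 : 0 ≤ M * m * ∑ k, stabLin pr v k ^ 2 :=
    mul_nonneg hMm.le (Finset.sum_nonneg fun k _ => sq_nonneg _)
  have p5 := mul_nonneg hM.le (add_nonneg p3 p4)
  refine (abs_add_le _ _).trans ?_
  rw [abs_mul (M * m), abs_of_pos hMm]
  linarith

end Nonlinear

end Local

/-! ### The global problem -/

section Global

variable {Ω : Set Plane} {T : Mesh Ω} {l : ℕ} {b : ∀ K, DofBasis (T.elt K) l}
  {pr : ∀ K, Projections (T.elt K) l (b K)}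

lemma coeFn_restrictL2 {D Ω : Set Plane} (h : D ⊆ Ω) (v : L2 Ω) :
    (fun x => restrictL2 h v x) =ᵐ[volume.restrict D] fun x => v x :=
  MemLp.coeFn_toLp ((Lp.memLp v).mono_measure (Measure.restrict_mono h le_rfl))

/-- Restriction to an element as a linear map. -/
def localPartLin (pr : ∀ K, Projections (T.elt K) l (b K)) (K : Fin T.numElements) :
    vemSpace T pr →ₗ[ℝ] enlargedSpace (T.elt K) l where
  toFun v := localPart v K
  map_add' _ _ := Subtype.ext (map_add _ _ _)
  map_smul' _ _ := Subtype.ext (map_smul _ _ _)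

lemma localPartLin_apply (K : Fin T.numElements) (v : vemSpace T pr) :
    localPartLin pr K v = localPart v K := rfl

lemma localPart_mem_localSpace (v : vemSpace T pr) (K : Fin T.numElements) :
    localPart v K ∈ localSpace (pr K) := by
  obtain ⟨w, hw, he⟩ := (Submodule.mem_iInf _).1 v.2.2 K
  have : localPart v K = w := Subtype.ext he.symm
  rwa [this]

/-- The closures of the elements cover Ω, and their polygonal frontiers are null sets. -/
lemma ae_of_forall_elt (hΩ : MeasurableSet Ω) {p : Plane → Prop}
    (h : ∀ K, ∀ᵐ x, x ∈ (T.elt K).carrier → p x) : ∀ᵐ x ∂volume.restrict Ω, p x := by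
  have h1 : ∀ᵐ x, ∀ K, x ∉ frontier (T.elt K).carrier := by
    rw [ae_all_iff]
    exact fun K => measure_eq_zero_iff_ae_notMem.1 (T.elt K).volume_frontier
  rw [ae_restrict_iff' hΩ]
  filter_upwards [ae_all_iff.2 h, h1] with x hx hx' hxΩ
  have h2 : x ∈ closure Ω := subset_closure hxΩ
  rw [T.closure_eq] at h2
  obtain ⟨K, hK⟩ := mem_iUnion.1 h2
  refine hx K ?_
  by_contra hn
  exact hx' K ⟨hK, fun hi => hn (interior_subset hi)⟩

/-- A discrete function that is constant on every element vanishes. -/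
lemma eq_zero_of_localPart_constant (hΩ : IsOpen Ω) (hb : Bornology.IsBounded Ω)
    {v : vemSpace T pr} (h : ∀ K, ∃ q : Poly2 l, localPart v K = polyEnl (T.elt K) l q ∧
      ∀ j, MvPolynomial.pderiv j (q : MvPolynomial (Fin 2) ℝ) = 0) : v = 0 := by
  obtain ⟨g, φ, hg, hφ, hH⟩ := v.2.1
  refine Subtype.ext (eq_zero_of_H10_of_grad_eq_zero hΩ hb hφ hH ?_)
  refine ae_of_forall_elt (T := T) hΩ.measurableSet fun K => ?_
  obtain ⟨q, hq, hdq⟩ := h K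
  have hfin : IsFiniteMeasure (volume.restrict Ω) :=
    ⟨by simpa using hb.measure_lt_top⟩
  have hint : IntegrableOn (g 0) Ω := (Lp.memLp (g 0)).integrable one_le_two
  refine (T.elt K).isOpen_carrier.ae_eq_zero_of_integral_contDiff_smul_eq_zero
    ((hint.mono_set (T.elt_subset K)).locallyIntegrableOn) fun ψ hψ hψc hψs => ?_
  have t1 : IsTest (T.elt K).carrier ψ := ⟨hψ, hψc, hψs⟩
  have t2 : IsTest Ω ψ := ⟨hψ, hψc, hψs.trans (T.elt_subset K)⟩
  have e1 := hg 0 ψ t2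
  -- A test function supported in one element is a test function on Ω, so the global weak gradient
  -- can be tested element by element; there v is a polynomial with zero gradient.
  rw [setIntegral_test (isTest_partialD t2 0), ← setIntegral_test (isTest_partialD t1 0),
    setIntegral_test t2] at e1
  have e2 : ∫ x in (T.elt K).carrier, (v : L2 Ω) x * partialD 0 ψ x = 0 := by
    have e3 : restrictL2 (T.elt_subset K) (v : L2 Ω) = polyL2 (T.elt K) q :=
      congrArg Subtype.val hq
    have e4 := hasWeakGradient_polyL2 (T.elt K) q 0 ψ t1
    simp only [hdq] at e4
    rw [map_zero, integral_zero_mul, neg_zero, ← e3] at e4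
    rw [← e4]
    apply integral_congr_ae
    filter_upwards [coeFn_restrictL2 (T.elt_subset K) (v : L2 Ω)] with x hx
    rw [hx]
  rw [e2] at e1
  simp only [smul_eq_mul, mul_comm (ψ _)]
  linarith

/-- By unisolvence on each element, the collected degrees of freedom form an injective map into a
finite-dimensional space. -/
lemma finiteDimensional_vemSpace (hΩ : IsOpen Ω) (hb : Bornology.IsBounded Ω)
    (hT : ∀ K, ∃ x₀ r, IsStarBall (T.elt K).carrier x₀ r) :
    FiniteDimensional ℝ (vemSpace T pr) := by
  let Φ : vemSpace T pr →ₗ[ℝ] ∀ K, DofIndex (T.elt K) l → ℝ :=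
    LinearMap.pi fun K => dofLin (pr K) ∘ₗ localPartLin pr K
  refine FiniteDimensional.of_injective Φ ?_
  rw [← LinearMap.ker_eq_bot, LinearMap.ker_eq_bot']
  intro v hv
  refine eq_zero_of_localPart_constant hΩ hb fun K => ⟨0, ?_, fun j => by simp⟩
  obtain ⟨x₀, r, hK⟩ := hT K
  rw [map_zero]
  exact eq_zero_of_dof_eq_zero hK (pr K) (localPart_mem_localSpace v K)
    fun k => congrFun (congrFun hv K) k

/-- The discrete load as a linear form. -/
def discreteLoadLin (pr : ∀ K, Projections (T.elt K) l (b K)) (f : L2 Ω) :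
    vemSpace T pr →ₗ[ℝ] ℝ where
  toFun := discreteLoad pr f
  map_add' v w := by
    simp only [discreteLoad]
    rw [← Finset.sum_add_distrib]
    refine Finset.sum_congr rfl fun K _ => ?_
    simp only [mul_comm (evalP _ _), Submodule.coe_add, map_add]
    exact integral_add_mul _ _
      (memLp_bounded (contDiff_evalP _).continuous (T.elt K).isBounded_carrier)
  map_smul' c v := by
    simp only [discreteLoad]
    rw [RingHom.id_apply, smul_eq_mul, Finset.mul_sum]
    refine Finset.sum_congr rfl fun K _ => ?_
    simp only [mul_comm (evalP _ _), Submodule.coe_smul, map_smul]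
    exact integral_smul_mul _ _ _

end Global

end

end QuasiVEM

/-! ### Assembly of the local estimates -/

theorem mainTheorem5 (Ω : Set Plane) (hΩ : IsPolygonalDomain Ω)
    (T : Mesh Ω) (ρ : ℝ) (hρ : 0 < ρ) (hT : T.IsRegular ρ)
    (l : ℕ) (hl : 1 ≤ l)
    (b : ∀ K, DofBasis (T.elt K) l)
    (pr : ∀ K, Projections (T.elt K) l (b K))
    (μ : Plane → ℝ → ℝ) (m M : ℝ) (hμ : NonlinearityAssumptions Ω μ m M)
    (f : L2 Ω) :
    ∃! u : vemSpace T pr, ∀ v : vemSpace T pr,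
      discreteForm pr μ m M u u v = discreteLoad pr f v := by
  have hstar := hT.isStarBall hρ
  have hm := hμ.pos_m
  have hM := hμ.pos_M
  have : FiniteDimensional ℝ (vemSpace T pr) :=
    finiteDimensional_vemSpace hΩ.isOpen hΩ.isBounded hstar
  let B : vemSpace T pr →ₗ[ℝ] vemSpace T pr →ₗ[ℝ] ℝ :=
    ∑ K, (referenceForm (pr K) m M).compl₁₂ (localPartLin pr K) (localPartLin pr K)
  have hB : ∀ v w, B v w =
      ∑ K, referenceForm (pr K) m M (localPart v K) (localPart w K) := fun v w => by
    simp [B, LinearMap.sum_apply, localPartLin_apply]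
  let A : vemSpace T pr → vemSpace T pr →ₗ[ℝ] ℝ := fun u =>
    ∑ K, localFormLin hμ (T.elt_subset K) (pr K) (localPart u K) ∘ₗ localPartLin pr K
  have hA : ∀ u v, A u v = discreteForm pr μ m M u u v := fun u v => by
    simp only [A, LinearMap.sum_apply]
    rfl
  have hsub : ∀ (u w : vemSpace T pr) K, localPart (u - w) K = localPart u K - localPart w K :=
    fun u w K => (localPartLin pr K).map_sub u w
  -- The local constants min m 1 and 3M + 1 do not depend on the element, so they survive summation.
  -- The norm on V_h is the one inherited from L²(Ω); it serves only as a Hilbert norm.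
  have key := existsUnique_variational B (fun v hv => ?_) A (α := min m 1) (C := 3 * M + 1)
    (lt_min hm one_pos) (by positivity) (fun u w => ?_) (fun u w v => ?_) (discreteLoadLin pr f)
  · simp only [hA] at key
    exact key
  · have hnn : ∀ K, 0 ≤ referenceForm (pr K) m M (localPart v K) (localPart v K) := fun K =>
      referenceForm_self_nonneg (pr K) hm hM _
    rw [hB]
    refine lt_of_le_of_ne (Finset.sum_nonneg fun K _ => hnn K) fun h0 => hv ?_
    refine eq_zero_of_localPart_constant hΩ.isOpen hΩ.isBounded fun K => ?_
    obtain ⟨x₀, r, hK⟩ := hstar K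
    exact eq_polyEnl_of_referenceForm_eq_zero hK (pr K) hm hM (localPart_mem_localSpace v K)
      ((Finset.sum_eq_zero_iff_of_nonneg fun K _ => hnn K).1 h0.symm K (Finset.mem_univ K))
  · rw [hB, hA, hA, discreteForm, discreteForm, ← Finset.sum_sub_distrib, Finset.mul_sum]
    refine Finset.sum_le_sum fun K _ => ?_
    rw [hsub]
    exact localForm_stronglyMonotone hμ (T.elt_subset K) (pr K) _ _
  · rw [hB, hB, hA, hA, discreteForm, discreteForm, ← Finset.sum_sub_distrib,
      ← Finset.sum_add_distrib, Finset.mul_sum]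
    refine (Finset.abs_sum_le_sum_abs _ _).trans (Finset.sum_le_sum fun K _ => ?_)
    rw [hsub]
    exact abs_localForm_sub_localForm_le hμ (T.elt_subset K) (pr K) _ _ _
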